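/- Let $p\ge 2$ be an integer, $\operatorname{Im}\tau>0$, and let $-z=a+b\tau$ with $0<a,b<1$. Put $\tilde q=e^{2\pi i/p}$, $\Theta\left[{c\atop 0}\right](x,T)=\sum_{l\in\mathbb Z}e^{\pi i(l+c)^2T}e^{2\pi i(l+c)x}$, $E(x,\tau)=\Theta_1(x,\tau)/\Theta_1'(0,\tau)$ with $\Theta_1$ the first Jacobi theta function, and let $\eta$ be the Dedekind eta function. For $\mu\in\mathbb Z$ consider $$\omega_\mu(t,z,\tau)=\frac1{\eta^3(\tau)}\,\Theta\left[{\mu/2p\atop 0}\right](-z-2t,2p\tau)\,E(t,\tau)^{-1/p}E(z+t,\tau)^{-1/p}E(-z,\tau)^{1/2p}\,\frac{d^2}{dt^2}\ln\frac{E(z+t,\tau)}{E(t,\tau)}\,dt .$$ It is taken on the following cut plane. For each $m\in\mathbb Z$ list the branch points $P_{m,2j}=m+j\tau$, $P_{m,2j+1}=m+j\tau-z$ ($j\in\mathbb Z$), and cut along the straight segment $[P_{m,k},P_{m,k+1}]$ for every $k\not\equiv 1-2m\pmod p$. (Every line of cuts then consists of $p-1$ segments and joins $p$ branch points; $[0,-z]$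 is a cut and $[-z,\tau]$ is not.) Fix any holomorphic determination of $E(t,\tau)^{-1/p}E(z+t,\tau)^{-1/p}$ on the cut plane, and any value of $E(-z,\tau)^{1/2p}$; they are the same for all $\mu$. At the branch points the integrals below diverge, and they are understood as Hadamard finite parts: cut off each straight segment of integration $[a,b]$ at $a+\varepsilon(b-a)$ and $b-\varepsilon(b-a)$, subtract the divergent terms in $\varepsilon^{-1-1/p}$ and $\varepsilon^{-1/p}$, and let $\varepsilon\to0^+$. The paths from $0$ to $1$ and from $0$ to $\tau$ are straight segments, and $\int_0^{-z}$ is taken below the cut $[0,-z]$, that is, along any broken line $0\to w\to -z$ with $w$ in the open triangle with vertices $0,1,-z$. Then: (i) For every $\mu$ the integral of $\omega_\mu$ around every piecewise $C^1$ loop that is contractible in the cut plane is zero. (ii) For every $\mu$ the finite parts $A_\mu=\int_0^1\omega_\mu$, $B_\mu=\int_0^\tau\omega_\mu$ and $C_\mu=\int_0^{-z}\omega_\mu$ exist, are unique, and $C_\mu$ does not depend on $w$. For all $\mu\in\mathbb Z$, $$A_\mu+\tilde q^{-\mu}A_{-\mu}=(1-\tilde q^{-\mu})\,C_\mu ,\tag{5}$$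 $$B_\mu+B_{2-\mu}=\tilde q^{-1}\,(C_\mu-C_{\mu-2}) ,\tag{6}$$ $$(1-\tilde q^{-\mu+1})\,B_\mu=A_\mu-\tilde q^{-1}A_{\mu-2}+(\tilde q^{-1}-1)\,C_\mu .\tag{7}$$ (iii) All these integrals are expressed through the $A_\mu$. If $\mu\not\equiv0,1\pmod p$, $$B_\mu=-\frac{\tilde q^{\mu-1}}{1-\tilde q^{\mu}}A_\mu+\frac{\tilde q^{\mu-2}}{1-\tilde q^{\mu-1}}A_{\mu-2}+\frac{\tilde q^{\mu-2}(1-\tilde q)}{(1-\tilde q^{\mu-1})(1-\tilde q^{\mu})}A_{-\mu} ;\tag{8}$$ $B_\mu=(A_\mu-\tilde q^{-1}A_{\mu-2})/(1-\tilde q)$ if $\mu\equiv0$, and $B_\mu=A_\mu/(\tilde q-1)$ if $\mu\equiv1\pmod p$; moreover $C_\mu=(A_\mu+\tilde q^{-\mu}A_{-\mu})/(1-\tilde q^{-\mu})$ if $\mu\not\equiv0$, and $C_\mu=0$ if $\mu\equiv0\pmod p$. (iv) (Selection rules) $A_\mu=0$ if $\mu\equiv0$ or $\mu\equiv-1\pmod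 p$. (v) As formal relations between sequences $A,B,C:\mathbb Z\to\mathbb C$, the relations (5) and (7), for all indices, do not imply (6) at any index $\mu\equiv1\pmod p$. They do imply (6) at each $\mu\not\equiv1\pmod p$, where for $\mu\equiv2\pmod p$ one also uses that $C_{\mu-2}=C_{2-\mu}=0$. -/

import Mathlib

open Complex Filter Topology Set

noncomputable section

/-- The root of unity `q̃ = e^{2πi/p}`. -/
def qTilde (p : ℕ) : ℂ := cexp (2 * Real.pi * I / p)

/-- The theta function with characteristics `(a, 0)`:
`∑_l e^{πi (l+a)² T} e^{2πi (l+a) x}`. -/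
def thetaChar (a x T : ℂ) : ℂ :=
  ∑' l : ℤ, cexp (Real.pi * I * ((l : ℂ) + a) ^ 2 * T) * cexp (2 * Real.pi * I * ((l : ℂ) + a) * x)

/-- The first Jacobi theta function,
`Θ₁(x, τ) = -i ∑_n (-1)^n e^{πi (n+1/2)² τ} e^{2πi (n+1/2) x}`. -/
def theta1 (x τ : ℂ) : ℂ :=
  -I * ∑' n : ℤ, (-1 : ℂ) ^ n * cexp (Real.pi * I * ((n : ℂ) + 1 / 2) ^ 2 * τ) *
    cexp (2 * Real.pi * I * ((n : ℂ) + 1 / 2) * x)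

/-- The prime form `E(x, τ) = Θ₁(x, τ) / Θ₁'(0, τ)` of the torus. -/
def primeForm (x τ : ℂ) : ℂ := theta1 x τ / deriv (fun y => theta1 y τ) 0

/-- The branch points, arranged in columns.  Column `m` consists, from bottom to top, of
`…, m, m - z, m + τ, m + τ - z, m + 2τ, …`; the index `k = 0` is the lattice point `m`.  Thus
`branchPoint m (2j) = m + jτ` and `branchPoint m (2j+1) = m + jτ - z`. -/
def branchPoint (z τ : ℂ) (m k : ℤ) : ℂ :=
  (m : ℂ) + ((k / 2 : ℤ) : ℂ) * τ - ((k % 2 : ℤ) : ℂ) * z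

/-- The cut plane.  In every column consecutive branch points are joined by straight cuts, except
that every `p`-th segment is left out, so that each line of cuts consists of `p - 1` segments
through `p` branch points.  In column `m` the omitted segments are those from the `k`-th to the
`(k+1)`-st point with `k ≡ 1 - 2m (mod p)`; in particular the segment from `-z` to `τ` is omitted,
and the segment from `0` to `-z` is a cut.  The cut plane is mapped to itself by
`t ↦ τ - z - t` and by `t ↦ 1 - z - t`. -/
def cutPlane (p : ℕ) (z τ : ℂ) : Set ℂ :=
  {t | ∀ m k : ℤ, ¬ (k ≡ 1 - 2 * m [ZMOD p]) →
    t ∉ segment ℝ (branchPoint z τ m k) (branchPoint z τ m (k + 1))}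

/-- `f` is a holomorphic determination of `E(t, τ)^{-1/p} E(z + t, τ)^{-1/p}` on the cut plane. -/
structure IsBranch (p : ℕ) (z τ : ℂ) (f : ℂ → ℂ) : Prop where
  differentiableOn : DifferentiableOn ℂ f (cutPlane p z τ)
  pow_mul_eq_one : ∀ t ∈ cutPlane p z τ, f t ^ p * (primeForm t τ * primeForm (z + t) τ) = 1

/-- The coefficient of `dt` in the form `ω_μ(t, z, τ)`.  Here `f` is the chosen determination of
`E(t, τ)^{-1/p} E(z + t, τ)^{-1/p}`, and `κ` that of `E(-z, τ)^{1/(2p)}`; the second derivative of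
`ln (E(z + t, τ) / E(t, τ))` is the derivative of the logarithmic derivative. -/
def omega (p : ℕ) (z τ κ : ℂ) (f : ℂ → ℂ) (μ : ℤ) (t : ℂ) : ℂ :=
  1 / ModularForm.eta τ ^ 3 * thetaChar ((μ : ℂ) / (2 * p)) (-z - 2 * t) (2 * p * τ) *
    f t * κ * deriv (logDeriv fun s => primeForm (z + s) τ / primeForm s τ) t

/-- The path `c`, parametrized by `[0, 1]`, is piecewise continuously differentiable. -/
def PiecewiseC1 (c : ℝ → ℂ) : Prop :=
  ∃ (n : ℕ) (u : ℕ → ℝ), Monotone u ∧ u 0 = 0 ∧ u n = 1 ∧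
    ∀ i < n, ContDiffOn ℝ 1 c (Icc (u i) (u (i + 1)))

/-- `L` is the Hadamard finite part, as `a` and `b` are approached, of `∫_a^b F(t) dt` along the
straight segment: the constant term of the truncated integral after removal of the divergent terms
in `ε^{-1-1/p}` and `ε^{-1/p}`.  These are the only divergent terms that can arise if, at each end
point `e`, `F(t) = (t - e)^{-2-1/p} h(t)` with `h` holomorphic at `e`, and `p ≥ 2`. -/
def HasFPIntegral (p : ℕ) (F : ℂ → ℂ) (a b L : ℂ) : Prop :=
  ∃ c₁ c₂ : ℂ, Tendsto
    (fun ε : ℝ => (∫ u in ε..(1 - ε), F (a + (u : ℂ) * (b - a)) * (b - a))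
      - c₁ * ((ε ^ (-1 - 1 / (p : ℝ)) : ℝ) : ℂ) - c₂ * ((ε ^ (-1 / (p : ℝ)) : ℝ) : ℂ))
    (𝓝[>] 0) (𝓝 L)

/-- The finite part integral along the broken line from `a` to `w` to `b`. -/
def HasFPIntegralVia (p : ℕ) (F : ℂ → ℂ) (a w b L : ℂ) : Prop :=
  ∃ L₁ L₂ : ℂ, HasFPIntegral p F a w L₁ ∧ HasFPIntegral p F w b L₂ ∧ L = L₁ + L₂

/-- The open triangle with vertices `0`, `1`, `-z`.  It borders the cut from `0` to `-z` from
below. -/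
def lowerTriangle (z : ℂ) : Set ℂ := interior (convexHull ℝ {0, 1, -z})

/-- The relation `A_μ + q̃^{-μ} A_{-μ} = (1 - q̃^{-μ}) C_μ`. -/
def Relation5 (p : ℕ) (A C : ℤ → ℂ) (μ : ℤ) : Prop :=
  A μ + qTilde p ^ (-μ) * A (-μ) = (1 - qTilde p ^ (-μ)) * C μ

/-- The relation `B_μ + B_{2-μ} = q̃^{-1} (C_μ - C_{μ-2})`. -/
def Relation6 (p : ℕ) (B C : ℤ → ℂ) (μ : ℤ) : Prop :=
  B μ + B (2 - μ) = (qTilde p)⁻¹ * (C μ - C (μ - 2))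

/-- The relation `(1 - q̃^{-μ+1}) B_μ = A_μ - q̃^{-1} A_{μ-2} + (q̃^{-1} - 1) C_μ`. -/
def Relation7 (p : ℕ) (A B C : ℤ → ℂ) (μ : ℤ) : Prop :=
  (1 - qTilde p ^ (-μ + 1)) * B μ =
    A μ - (qTilde p)⁻¹ * A (μ - 2) + ((qTilde p)⁻¹ - 1) * C μ

end

/-! All relations come from point reflections. Under t ↦ -z - t the product E(t)E(z+t) is invariant,
the second logarithmic derivative of E(z+t)/E(t) changes sign, and the theta factor passes from μ to
-μ. Composing with the translation by 1 adds the factor q̃^{-μ}; composing with the translation by τ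
replaces -μ by 2-μ. So `omega_reflect`, `omega_one_reflect`, `omega_tau_reflect` and
`omega_one_add_tau_reflect` carry ω_μ to a multiple of ω_{-μ} or ω_{2-μ}, once it is known how the
chosen determination f behaves.

That behaviour is `IsBranch.exists_monodromy`. A determination cannot change under a reflection that
has a fixed point in a connected region avoiding the cuts. Following f from the lower row of cells
to the upper one past the left side of the column through 0 then fixes the jump across the cut
[0,-z]: the continuation g through this cut equals f on its right and q̃ f on its left.

Let D_μ be the integral over the uncut segment [-z,τ]. Reflecting g in the middle of [0,-z] gives
C_{-μ} = -C_μ, reflecting f in the middle of [-z,τ] gives D_{2-μ} = -D_μ, and pushing the path from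
0 to τ against the column from the left gives B_μ = q̃^{-1}C_μ + D_μ. Going round the parallelograms
0, 1, 1-z, -z and -z, 1-z, 1+τ, τ, with opposite sides exchanged by reflections, gives two more
equations. Together with the period 2p in μ these form `PeriodRelations`; (5)-(8) and the selection
rules are linear algebra over it. The residues where a coefficient 1 - q̃^k vanishes need the
periodicity and the oddness of C, which is also why (5) and (7) alone miss (6) at μ ≡ 1.

Divergence does no harm. Near a branch point e the integrand is (t-e)^{-2-1/p} times a holomorphic
function, so a primitive is a sum of the powers -1-1/p and -1/p and a function with a limit at e
(`exists_cornerValue`). No logarithm occurs, hence the constant term depends neither on the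
direction nor on the scale of the cutoff. In a convex region avoiding the cuts a finite part is
therefore a difference of numbers attached to its ends (`IsBranchOn.exists_isPotential`), and
contour deformation becomes the comparison of such potentials on overlapping or reflected regions
(`IsPotential.sub_eq_of_inter`, `IsPotential.sub_eq_of_reflect`). The local form rests on the zeros
of Θ₁ being exactly the lattice points, obtained from the product side of the triple product
(`theta1_eq_zero_imp`). -/

/-! ### Formal consequences of the relations (5) and (7). -/

lemma qTilde_isPrimitiveRoot {p : ℕ} (hp : p ≠ 0) : IsPrimitiveRoot (qTilde p) p :=
  Complex.isPrimitiveRoot_exp p hp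

lemma qTilde_ne_zero (p : ℕ) : qTilde p ≠ 0 := Complex.exp_ne_zero _

lemma qTilde_zpow_eq_one_iff {p : ℕ} (hp : p ≠ 0) (n : ℤ) :
    qTilde p ^ n = 1 ↔ n ≡ 0 [ZMOD p] := by
  rw [(qTilde_isPrimitiveRoot hp).zpow_eq_one_iff_dvd, Int.modEq_zero_iff_dvd]

lemma qTilde_zpow_of_modEq {p : ℕ} (hp : p ≠ 0) {m n : ℤ} (h : m ≡ n [ZMOD p]) :
    qTilde p ^ m = qTilde p ^ n := by
  have h1 : qTilde p ^ (m - n) = 1 := by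
    rw [qTilde_zpow_eq_one_iff hp]
    exact Int.modEq_zero_iff_dvd.2 (Int.modEq_iff_dvd.1 h.symm)
  rw [zpow_sub₀ (qTilde_ne_zero p), div_eq_one_iff_eq (zpow_ne_zero _ (qTilde_ne_zero p))] at h1
  exact h1

/-- The first relation at `ν` and `-ν` makes `C` odd away from the multiples of `p`. -/
lemma Relation5.odd {p : ℕ} (hp : p ≠ 0) {A C : ℤ → ℂ} (h5 : ∀ ν, Relation5 p A C ν) {ν : ℤ}
    (hν : ¬ ν ≡ 0 [ZMOD p]) : C ν = -C (-ν) := by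
  have hq := qTilde_ne_zero p
  have h1 := h5 ν
  have h2 := h5 (-ν)
  have h3 : qTilde p ^ ν ≠ 1 := fun h => hν ((qTilde_zpow_eq_one_iff hp ν).1 h)
  simp only [Relation5, neg_neg, zpow_neg] at h1 h2
  set r := qTilde p ^ ν
  have hr : r ≠ 0 := zpow_ne_zero _ hq
  field_simp at h1
  have : (r - 1) * (C ν + C (-ν)) = 0 := by linear_combination h2 - h1
  rcases mul_eq_zero.1 this with h | h
  · exact absurd (sub_eq_zero.1 h) h3
  · exact eq_neg_of_add_eq_zero_left h

/-- The relations (7) at μ and 2-μ carry proportional coefficients of B, and (5) at μ and μ-2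
eliminates every A. What remains is (6) times q̃^μ - q̃, a factor that vanishes exactly for μ ≡ 1.
The oddness of C at μ-2 follows from (5) except where μ ≡ 2, hence the extra hypothesis. -/
lemma relation6_of_relation5_of_relation7 {p : ℕ} (hp : p ≠ 0) {A B C : ℤ → ℂ}
    (h5 : ∀ ν, Relation5 p A C ν) (h7 : ∀ ν, Relation7 p A B C ν) {μ : ℤ}
    (hμ : ¬ μ ≡ 1 [ZMOD p]) (h2 : μ ≡ 2 [ZMOD p] → C (μ - 2) = 0 ∧ C (2 - μ) = 0) :
    Relation6 p B C μ := by
  have hq := qTilde_ne_zero p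
  have hC : C (μ - 2) = -C (2 - μ) := by
    by_cases h : μ ≡ 2 [ZMOD p]
    · simp [h2 h]
    · have : ¬ μ - 2 ≡ 0 [ZMOD p] := fun h' => h (by simpa using h'.add_right 2)
      simpa using Relation5.odd hp h5 this
  have hr1 : qTilde p ^ μ ≠ qTilde p := fun h => hμ <| by
    have : qTilde p ^ (μ - 1) = 1 := by rw [zpow_sub₀ hq, h, zpow_one, div_self hq]
    simpa using ((qTilde_zpow_eq_one_iff hp _).1 this).add_right 1
  have e1 := h7 μ
  have e2 := h7 (2 - μ)
  have e3 := h5 μ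
  have e4 := h5 (μ - 2)
  simp only [Relation5, Relation6, Relation7] at *
  rw [show 2 - μ - 2 = -μ by ring, show -(2 - μ) + 1 = μ - 1 by ring, zpow_sub₀ hq] at e2
  rw [zpow_add₀ hq, zpow_neg, zpow_one] at e1
  rw [zpow_neg] at e3
  rw [show -(μ - 2) = 2 - μ by ring, zpow_sub₀ hq] at e4
  rw [show (qTilde p) ^ (2 : ℤ) = qTilde p ^ 2 by norm_cast] at e4
  set r := qTilde p ^ μ
  set q := qTilde p
  have hr : r ≠ 0 := zpow_ne_zero _ hq
  rw [hC] at e4 ⊢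
  rw [zpow_one] at e2
  field_simp at e1 e2 e3 e4 ⊢
  have : (r - q) * (q * (B μ + B (2 - μ)) - (C μ - -C (2 - μ))) = 0 := by
    linear_combination e1 - q * e2 + q * e3 - e4
  rcases mul_eq_zero.1 this with h | h
  · exact absurd (sub_eq_zero.1 h) hr1
  · linear_combination h

/-- On the class of 1 the coefficient of B in (7) is zero, so B is free there: its indicator
function with A = C = 0 works, because 2-μ lies in the same class and the left side of (6) becomes
2. -/
lemma exists_relation5_relation7_not_relation6 {p : ℕ} (hp : p ≠ 0) {μ : ℤ}
    (hμ : μ ≡ 1 [ZMOD p]) : ∃ A B C : ℤ → ℂ,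
      (∀ ν, Relation5 p A C ν) ∧ (∀ ν, Relation7 p A B C ν) ∧ ¬ Relation6 p B C μ := by
  classical
  refine ⟨0, fun ν => if ν ≡ 1 [ZMOD p] then 1 else 0, 0, fun ν => by simp [Relation5],
    fun ν => ?_, ?_⟩
  · simp only [Relation7]
    split_ifs with h
    · have : qTilde p ^ (-ν + 1) = 1 := by
        rw [qTilde_zpow_eq_one_iff hp]
        simpa using h.neg.add_right 1
      simp [this]
    · simp
  · have : 2 - μ ≡ 1 [ZMOD p] := by
      simpa [← sub_eq_add_neg] using hμ.neg.add_left 2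
    simp only [Relation6, if_pos hμ, if_pos this]
    norm_num

/-! ### Linear algebra of the periods. -/

/-- The consequences of the contour relations between the periods `A`, `B`, `C`, and `D`, where
`D` is the integral over the segment that is not cut. -/
structure PeriodRelations (p : ℕ) (A B C D : ℤ → ℂ) : Prop where
  A_add : ∀ μ, A (μ + 2 * p) = A μ
  B_add : ∀ μ, B (μ + 2 * p) = B μ
  C_add : ∀ μ, C (μ + 2 * p) = C μ
  C_neg : ∀ μ, C (-μ) = -C μ
  D_two_sub : ∀ μ, D (2 - μ) = -D μ
  B_eq : ∀ μ, B μ = (qTilde p)⁻¹ * C μ + D μ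
  lower : ∀ μ, A μ + qTilde p ^ (-μ) * A (-μ) = C μ + qTilde p ^ (-μ) * C (-μ)
  upper : ∀ μ, -(qTilde p ^ (-μ) * A (-μ)) + qTilde p ^ (1 - μ) * D μ =
    D μ + (qTilde p)⁻¹ * A (μ - 2)

namespace PeriodRelations

variable {p : ℕ} {A B C D : ℤ → ℂ}

lemma periodic {X : ℤ → ℂ} (h : ∀ μ, X (μ + 2 * p) = X μ) (μ k : ℤ) :
    X (μ + k * (2 * p)) = X μ :=
  (show Function.Periodic X (2 * p) from h).int_mul k μ

lemma relation5 (h : PeriodRelations p A B C D) (μ : ℤ) : Relation5 p A C μ := by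
  have := h.lower μ
  rw [h.C_neg] at this
  simp only [Relation5]
  linear_combination this

lemma relation6 (h : PeriodRelations p A B C D) (μ : ℤ) : Relation6 p B C μ := by
  have h1 := h.C_neg (2 - μ)
  rw [neg_sub] at h1
  simp only [Relation6]
  rw [h.B_eq, h.B_eq, h.D_two_sub, h1]
  ring

/-- Substituting D = B - q̃^{-1}C in the equation of the upper parallelogram and removing A_{-μ} by
(5). -/
lemma relation7 (h : PeriodRelations p A B C D) (μ : ℤ) : Relation7 p A B C μ := by
  have hq := qTilde_ne_zero p
  have h5 := h.relation5 μ
  have h1 := h.upper μ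
  simp only [Relation5, Relation7] at *
  rw [h.B_eq, neg_add_eq_sub]
  have hz : qTilde p ^ (1 - μ) = qTilde p * qTilde p ^ (-μ) := by
    rw [sub_eq_add_neg, zpow_add₀ hq, zpow_one]
  rw [hz] at h1 ⊢
  field_simp at h1 ⊢
  linear_combination -qTilde p * h5 - h1

/-- For a multiple μ of p the indices μ and -μ differ by a multiple of 2p, so C_μ is its own
negative. -/
lemma C_eq_zero (h : PeriodRelations p A B C D) {μ : ℤ} (hμ : μ ≡ 0 [ZMOD p]) : C μ = 0 := by
  obtain ⟨k, rfl⟩ := Int.modEq_zero_iff_dvd.1 hμ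
  have h1 := periodic h.C_add (p * k) (-k)
  rw [show (p * k + -k * (2 * p) : ℤ) = -(p * k) by ring, h.C_neg] at h1
  exact self_eq_neg.1 h1.symm

lemma A_eq_zero (hp : p ≠ 0) (h : PeriodRelations p A B C D) {μ : ℤ}
    (hμ : μ ≡ 0 [ZMOD p] ∨ μ ≡ -1 [ZMOD p]) : A μ = 0 := by
  rcases hμ with hμ | hμ
  · have h5 := h.relation5 μ
    have hn : -μ ≡ 0 [ZMOD p] := by simpa using hμ.neg
    simp only [Relation5] at h5
    rw [(qTilde_zpow_eq_one_iff hp _).2 hn, h.C_eq_zero hμ] at h5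
    obtain ⟨k, rfl⟩ := Int.modEq_zero_iff_dvd.1 hμ
    have h1 := periodic h.A_add (p * k) (-k)
    rw [show (p * k + -k * (2 * p) : ℤ) = -(p * k) by ring] at h1
    rw [h1] at h5
    linear_combination h5 / 2
  -- At the index -μ ≡ 1 both coefficients of D are 1 and D cancels. The two remaining A agree,
  -- since -μ-2 and μ differ by a multiple of 2p.
  · have h1 := h.upper (-μ)
    have hn : -μ ≡ 1 [ZMOD p] := by simpa using hμ.neg
    have hq := qTilde_ne_zero p
    rw [neg_neg, sub_neg_eq_add,
      (qTilde_zpow_eq_one_iff hp (1 + μ)).2 (by simpa using hμ.add_left 1),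
      qTilde_zpow_of_modEq hp hμ, zpow_neg_one] at h1
    obtain ⟨k, hk⟩ := Int.modEq_iff_dvd.1 hμ
    have h2 := periodic h.A_add μ k
    rw [show (μ + k * (2 * p) : ℤ) = -μ - 2 by linear_combination -2 * hk] at h2
    rw [h2] at h1
    field_simp at h1
    linear_combination -h1 / 2

lemma C_eq (hp : p ≠ 0) (h : PeriodRelations p A B C D) {μ : ℤ} (hμ : ¬ μ ≡ 0 [ZMOD p]) :
    C μ = (A μ + qTilde p ^ (-μ) * A (-μ)) / (1 - qTilde p ^ (-μ)) := by
  have h5 := h.relation5 μ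
  have : 1 - qTilde p ^ (-μ) ≠ 0 := fun h' => hμ <| by
    simpa using ((qTilde_zpow_eq_one_iff hp _).1 (sub_eq_zero.1 h').symm).neg
  simp only [Relation5] at h5
  rw [h5, mul_div_cancel_left₀ _ this]

lemma B_eq_of_ne (hp : p ≠ 0) (h : PeriodRelations p A B C D) {μ : ℤ} (h0 : ¬ μ ≡ 0 [ZMOD p])
    (h1 : ¬ μ ≡ 1 [ZMOD p]) :
    B μ = -(qTilde p ^ (μ - 1) / (1 - qTilde p ^ μ)) * A μ
          + qTilde p ^ (μ - 2) / (1 - qTilde p ^ (μ - 1)) * A (μ - 2)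
          + qTilde p ^ (μ - 2) * (1 - qTilde p) /
              ((1 - qTilde p ^ (μ - 1)) * (1 - qTilde p ^ μ)) * A (-μ) := by
  have hq := qTilde_ne_zero p
  have n0 : qTilde p ^ μ ≠ 1 := fun h' => h0 ((qTilde_zpow_eq_one_iff hp _).1 h')
  have n1 : qTilde p ^ (μ - 1) ≠ 1 := fun h' => h1 <| by
    simpa using ((qTilde_zpow_eq_one_iff hp _).1 h').add_right 1
  have h5 := h.relation5 μ
  have h7 := h.relation7 μ
  simp only [Relation5, Relation7] at h5 h7
  rw [zpow_add₀ hq, zpow_neg, zpow_one] at h7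
  rw [zpow_neg] at h5
  rw [zpow_sub₀ hq, zpow_one] at n1
  rw [zpow_sub₀ hq, zpow_sub₀ hq, zpow_one, show (qTilde p) ^ (2 : ℤ) = qTilde p ^ 2 by norm_cast]
  have hr : qTilde p ^ μ ≠ 0 := zpow_ne_zero _ hq
  set r := qTilde p ^ μ
  set q := qTilde p
  have m0 : 1 - r ≠ 0 := sub_ne_zero.2 (Ne.symm n0)
  have m1 : q - r ≠ 0 := sub_ne_zero.2 fun h => n1 (by rw [← h, div_self hq])
  field_simp at h5 h7 ⊢
  linear_combination -(1 - r) * h7 - r * h5 * (1 - q)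

lemma B_eq_of_modEq_zero (hp : 2 ≤ p) (h : PeriodRelations p A B C D) {μ : ℤ}
    (hμ : μ ≡ 0 [ZMOD p]) : B μ = (A μ - (qTilde p)⁻¹ * A (μ - 2)) / (1 - qTilde p) := by
  have h7 := h.relation7 μ
  have n1 : 1 - qTilde p ≠ 0 :=
    sub_ne_zero.2 ((qTilde_isPrimitiveRoot (by lia)).ne_one (by lia)).symm
  simp only [Relation7] at h7
  rw [h.C_eq_zero hμ, mul_zero, add_zero,
    qTilde_zpow_of_modEq (by lia) (show -μ + 1 ≡ 1 [ZMOD p] by simpa using hμ.neg.add_right 1),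
    zpow_one] at h7
  rw [← h7, mul_div_cancel_left₀ _ n1]

/-- Here (7) says nothing about B. Instead 2-μ and μ differ by a multiple of 2p, so (6) with the
oddness of C reads 2B_μ = 2q̃^{-1}C_μ, and C_μ is known from (5) because A_{-μ} = 0 by the selection
rule. -/
lemma B_eq_of_modEq_one (hp : 2 ≤ p) (h : PeriodRelations p A B C D) {μ : ℤ}
    (hμ : μ ≡ 1 [ZMOD p]) : B μ = A μ / (qTilde p - 1) := by
  have hq := qTilde_ne_zero p
  have hp0 : p ≠ 0 := by lia
  have n1 : qTilde p - 1 ≠ 0 :=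
    sub_ne_zero.2 ((qTilde_isPrimitiveRoot hp0).ne_one (by lia))
  have h6 := h.relation6 μ
  have h5 := h.relation5 μ
  have hA : A (-μ) = 0 := h.A_eq_zero hp0 (Or.inr (by simpa using hμ.neg))
  simp only [Relation5, Relation6] at h5 h6
  obtain ⟨k, hk⟩ := Int.modEq_iff_dvd.1 hμ
  have e1 := periodic h.B_add μ k
  have e2 := periodic h.C_add μ k
  rw [show (μ + k * (2 * p) : ℤ) = 2 - μ by linear_combination -2 * hk] at e1 e2
  have e3 := h.C_neg (2 - μ)
  rw [neg_sub, e2] at e3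
  rw [e1, e3] at h6
  rw [hA, qTilde_zpow_of_modEq hp0 (show -μ ≡ -1 [ZMOD p] from hμ.neg), zpow_neg_one] at h5
  rw [eq_div_iff n1]
  field_simp at h5 h6
  refine mul_left_cancel₀ hq ?_
  linear_combination (qTilde p - 1) / 2 * h6 - h5
end PeriodRelations

/-! ### Infinite products, division of entire functions, doubly periodic functions. -/

/-- The q-Pochhammer symbol `(y; Q)_∞ = ∏_{n ≥ 0} (1 - Q^n y)`. -/
noncomputable def qPochhammer (Q y : ℂ) : ℂ := ∏' n : ℕ, (1 + -(Q ^ n * y))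

lemma summable_norm_pow_mul {Q : ℂ} (hQ : ‖Q‖ < 1) (y : ℂ) :
    Summable fun n : ℕ => ‖-(Q ^ n * y)‖ := by
  simpa using (summable_geometric_of_lt_one (norm_nonneg Q) hQ).mul_right ‖y‖

lemma exists_pow_mul_eq_one_of_qPochhammer_eq_zero {Q y : ℂ} (hQ : ‖Q‖ < 1)
    (h : qPochhammer Q y = 0) : ∃ n : ℕ, Q ^ n * y = 1 := by
  by_contra! hn
  refine tprod_one_add_ne_zero_of_summable (f := fun n : ℕ => -(Q ^ n * y)) (fun n h0 => ?_)
    (summable_norm_pow_mul hQ y) h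
  exact hn n (by linear_combination -h0)

lemma qPochhammer_eq_mul {Q : ℂ} (hQ : ‖Q‖ < 1) (y : ℂ) :
    qPochhammer Q y = (1 - y) * qPochhammer Q (Q * y) := by
  have hs : Summable fun n : ℕ => ‖-(Q ^ (n + 1) * y)‖ :=
    (summable_nat_add_iff (f := fun n : ℕ => ‖-(Q ^ n * y)‖) 1).2 (summable_norm_pow_mul hQ y)
  have h := tprod_eq_zero_mul' (f := fun n : ℕ => 1 + -(Q ^ n * y))
    (multipliable_one_add_of_summable hs)
  have e : ∀ n : ℕ, 1 + -(Q ^ (n + 1) * y) = 1 + -(Q ^ n * (Q * y)) := fun n => by ring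
  rw [pow_zero, one_mul, ← sub_eq_add_neg] at h
  simp_rw [e] at h
  exact h

lemma differentiable_qPochhammer {Q : ℂ} (hQ : ‖Q‖ < 1) : Differentiable ℂ (qPochhammer Q) := by
  intro y
  have ho : IsOpen (Metric.ball (0 : ℂ) (‖y‖ + 1)) := Metric.isOpen_ball
  have hs : Summable fun n : ℕ => ‖Q‖ ^ n * (‖y‖ + 1) :=
    (summable_geometric_of_lt_one (norm_nonneg Q) hQ).mul_right _
  have h := hs.hasProdLocallyUniformlyOn_nat_one_add (f := fun (n : ℕ) (y : ℂ) => -(Q ^ n * y)) ho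
    (.of_forall fun n x hx => by
      rw [mem_ball_zero_iff] at hx
      rw [norm_neg, norm_mul, norm_pow]
      gcongr) (fun n => by fun_prop)
  exact (h.differentiableOn (.of_forall fun _ => by
    simpa [Finset.prod_fn] using DifferentiableOn.finsetProd (fun _ _ => by fun_prop))
    ho).differentiableAt (ho.mem_nhds (by simp))

/-- An entire function whose zeros cancel the simple zeros of another one is divisible by it. -/
lemma exists_differentiable_mul_eq {j h : ℂ → ℂ} (hj : Differentiable ℂ j)
    (hh : Differentiable ℂ h) (hz : ∀ x, h x = 0 → j x = 0 ∧ deriv h x ≠ 0) :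
    ∃ r : ℂ → ℂ, Differentiable ℂ r ∧ ∀ x, r x * h x = j x := by
  classical
  refine ⟨fun x => if h x = 0 then deriv j x / deriv h x else j x / h x, fun x₀ => ?_, fun x => ?_⟩
  · by_cases h0 : h x₀ = 0
    · obtain ⟨hj0, hd⟩ := hz x₀ h0
      have dj : DifferentiableAt ℂ (dslope j x₀) x₀ :=
        ((differentiableOn_dslope univ_mem).2 hj.differentiableOn).differentiableAt univ_mem
      have dh : DifferentiableAt ℂ (dslope h x₀) x₀ :=
        ((differentiableOn_dslope univ_mem).2 hh.differentiableOn).differentiableAt univ_mem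
      have hne : dslope h x₀ x₀ ≠ 0 := by rwa [dslope_same]
      refine (dj.div dh hne).congr_of_eventuallyEq ?_
      -- Near a zero the quotient equals that of the difference quotients, which also takes the
      -- prescribed value at the zero itself.
      filter_upwards [dh.continuousAt.eventually_ne hne] with x hx
      rcases eq_or_ne x x₀ with rfl | hxx
      · simp [h0, dslope_same]
      · have e1 : h x = (x - x₀) * dslope h x₀ x := by
          simpa [h0] using (sub_smul_dslope h x₀ x).symm
        have e2 : j x = (x - x₀) * dslope j x₀ x := by
          simpa [hj0] using (sub_smul_dslope j x₀ x).symm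
        have hs := sub_ne_zero.2 hxx
        rw [if_neg (by rw [e1]; exact mul_ne_zero hs hx), e1, e2, mul_div_mul_left _ _ hs]
        rfl
    · refine ((hj x₀).div (hh x₀) h0).congr_of_eventuallyEq ?_
      filter_upwards [(hh x₀).continuousAt.eventually_ne h0] with x hx
      simp [hx]
  · by_cases h0 : h x = 0
    · simp [h0, (hz x h0).1]
    · simp [h0]

/-- The hypotheses are equivalences so that the property also travels along negative shifts. -/
lemma lattice_induction {τ : ℂ} {P : ℂ → Prop} (h0 : P 0) (h1 : ∀ x, P x ↔ P (x + 1))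
    (hτ : ∀ x, P x ↔ P (x + τ)) (m n : ℤ) : P (m + n * τ) := by
  have key : ∀ (w : ℂ), (∀ x, P x ↔ P (x + w)) → ∀ (k : ℤ) x, P x → P (x + k * w) := by
    intro w hw k
    induction k using Int.induction_on with
    | zero => intro x hx; simpa using hx
    | succ k ih =>
      intro x hx
      have := (hw _).1 (ih x hx)
      push_cast at this ⊢
      convert this using 1
      ring
    | pred k ih =>
      intro x hx
      refine (hw _).2 ?_
      convert ih x hx using 1
      push_cast
      ring
  simpa using key τ hτ n _ (key 1 h1 m 0 h0)

lemma exists_real_coords {τ : ℂ} (hτ : 0 < τ.im) (t : ℂ) : ∃ x y : ℝ, t = x + y * τ := by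
  refine ⟨t.re - t.im / τ.im * τ.re, t.im / τ.im, ?_⟩
  apply Complex.ext
  · simp
  · simp [hτ.ne']

/-- An entire function with the periods `1` and `τ` is constant. -/
lemma eq_const_of_doubly_periodic {τ : ℂ} (hτ : 0 < τ.im) {r : ℂ → ℂ} (hr : Differentiable ℂ r)
    (h1 : ∀ x, r (x + 1) = r x) (h2 : ∀ x, r (x + τ) = r x) (x y : ℂ) : r x = r y := by
  have hc : IsCompact ((fun v : ℝ × ℝ => r (v.1 + v.2 * τ)) '' (Icc 0 1 ×ˢ Icc 0 1)) := by
    refine (isCompact_Icc.prod (isCompact_Icc (a := (0 : ℝ)) (b := 1))).image ?_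
    have := hr.continuous
    fun_prop
  refine hr.apply_eq_apply_of_bounded (hc.isBounded.subset ?_) x y
  rintro _ ⟨t, rfl⟩
  obtain ⟨x, y, rfl⟩ := exists_real_coords hτ t
  refine ⟨(Int.fract x, Int.fract y), ⟨⟨Int.fract_nonneg _, (Int.fract_lt_one _).le⟩,
    ⟨Int.fract_nonneg _, (Int.fract_lt_one _).le⟩⟩, ?_⟩
  have k1 := (show Function.Periodic r 1 from h1).sub_int_mul_eq ⌊x⌋ (x := x + y * τ - ⌊y⌋ * τ)
  have k2 := (show Function.Periodic r τ from h2).sub_int_mul_eq ⌊y⌋ (x := x + y * τ)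
  change r _ = r _
  rw [← k2, ← k1]
  congr 1
  simp only [Int.fract]
  push_cast
  ring

/-! ### Zeros of the first theta function. -/

section theta

variable {τ : ℂ}

/-- Holomorphy, quasi-periods and parity of Θ₁ are all drawn from those of `jacobiTheta₂`. -/
lemma theta1_eq_jacobiTheta₂ (x τ : ℂ) : theta1 x τ =
    -I * cexp (Real.pi * I * τ / 4 + Real.pi * I * x) * jacobiTheta₂ (x + 1 / 2 + τ / 2) τ := by
  rw [theta1, jacobiTheta₂, mul_assoc (-I),
    ← tsum_mul_left (a := cexp (Real.pi * I * τ / 4 + Real.pi * I * x))]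
  refine congrArg (-I * ·) (tsum_congr fun n => ?_)
  have h : (-1 : ℂ) ^ n = cexp (n * (Real.pi * I)) := by
    rw [exp_int_mul, exp_pi_mul_I]
  rw [h, jacobiTheta₂_term, ← Complex.exp_add, ← Complex.exp_add, ← Complex.exp_add]
  congr 1
  ring

lemma differentiable_theta1 (hτ : 0 < τ.im) : Differentiable ℂ (fun x => theta1 x τ) := by
  simp_rw [theta1_eq_jacobiTheta₂]
  intro x
  have h1 : DifferentiableAt ℂ (fun x => jacobiTheta₂ (x + 1 / 2 + τ / 2) τ) x :=
    (differentiableAt_jacobiTheta₂_fst _ hτ).comp x (f := fun x => x + 1 / 2 + τ / 2)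
      (by fun_prop)
  fun_prop

lemma theta1_add_one (x τ : ℂ) : theta1 (x + 1) τ = -theta1 x τ := by
  rw [theta1_eq_jacobiTheta₂, theta1_eq_jacobiTheta₂, show x + 1 + 1 / 2 + τ / 2 =
    x + 1 / 2 + τ / 2 + 1 by ring, jacobiTheta₂_add_left, mul_add, ← add_assoc, Complex.exp_add,
    mul_one, exp_pi_mul_I]
  ring

lemma theta1_add_tau (x τ : ℂ) :
    theta1 (x + τ) τ = -cexp (-Real.pi * I * τ - 2 * Real.pi * I * x) * theta1 x τ := by
  rw [theta1_eq_jacobiTheta₂, theta1_eq_jacobiTheta₂, show x + τ + 1 / 2 + τ / 2 =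
    x + 1 / 2 + τ / 2 + τ by ring, jacobiTheta₂_add_left']
  have h : cexp (Real.pi * I * τ / 4 + Real.pi * I * (x + τ)) *
      cexp (-Real.pi * I * (τ + 2 * (x + 1 / 2 + τ / 2))) =
      -cexp (-Real.pi * I * τ - 2 * Real.pi * I * x) *
        cexp (Real.pi * I * τ / 4 + Real.pi * I * x) := by
    have h1 : (-1 : ℂ) = cexp (-(Real.pi * I)) := by rw [Complex.exp_neg, exp_pi_mul_I]; norm_num
    rw [neg_eq_neg_one_mul (cexp _), h1, ← Complex.exp_add, ← Complex.exp_add, ← Complex.exp_add]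
    congr 1
    ring
  linear_combination (-I * jacobiTheta₂ (x + 1 / 2 + τ / 2) τ) * h

lemma theta1_neg (x τ : ℂ) : theta1 (-x) τ = -theta1 x τ := by
  have h := jacobiTheta₂_add_left' (-x - 1 / 2 - τ / 2) τ
  rw [show -x - 1 / 2 - τ / 2 = -(x + 1 / 2 + τ / 2) by ring, jacobiTheta₂_neg_left] at h
  rw [theta1_eq_jacobiTheta₂, theta1_eq_jacobiTheta₂, show -x + 1 / 2 + τ / 2 =
    -(x + 1 / 2 + τ / 2) + τ + 1 by ring, jacobiTheta₂_add_left, h]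
  have h : cexp (Real.pi * I * τ / 4 + Real.pi * I * (-x)) *
      cexp (-Real.pi * I * (τ + 2 * -(x + 1 / 2 + τ / 2))) =
        -cexp (Real.pi * I * τ / 4 + Real.pi * I * x) := by
    have h1 : (-1 : ℂ) = cexp (Real.pi * I) := by rw [exp_pi_mul_I]
    rw [neg_eq_neg_one_mul (cexp _), h1, ← Complex.exp_add, ← Complex.exp_add]
    congr 1
    ring
  linear_combination (-I * jacobiTheta₂ (x + 1 / 2 + τ / 2) τ) * h

lemma theta1_zero (τ : ℂ) : theta1 0 τ = 0 := by
  have := theta1_neg 0 τ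
  rw [neg_zero] at this
  exact self_eq_neg.1 this

lemma theta1_lattice (τ : ℂ) (m n : ℤ) : theta1 (m + n * τ) τ = 0 := by
  refine lattice_induction (P := fun x => theta1 x τ = 0) (theta1_zero τ) (fun x => ?_)
    (fun x => ?_) m n
  · simp [theta1_add_one]
  · simp [theta1_add_tau, Complex.exp_ne_zero]

/-- The product side of the Jacobi triple product, up to a constant. -/
noncomputable def thetaProd (τ x : ℂ) : ℂ :=
  qPochhammer (cexp (2 * Real.pi * I * τ)) (cexp (2 * Real.pi * I * x)) *
    qPochhammer (cexp (2 * Real.pi * I * τ)) (cexp (2 * Real.pi * I * (τ - x)))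

lemma norm_nome_lt_one (hτ : 0 < τ.im) : ‖cexp (2 * Real.pi * I * τ)‖ < 1 := by
  rw [Complex.norm_exp, Real.exp_lt_one_iff]
  have : (2 * Real.pi * I * τ).re = -(2 * Real.pi * τ.im) := by simp
  rw [this]
  have := Real.pi_pos
  simp only [Left.neg_neg_iff]
  positivity

lemma differentiable_thetaProd (hτ : 0 < τ.im) : Differentiable ℂ (thetaProd τ) := by
  have := differentiable_qPochhammer (norm_nome_lt_one hτ)
  unfold thetaProd
  exact (this.comp (by fun_prop)).mul (this.comp (by fun_prop))

lemma cexp_two_pi_I_add_one (x : ℂ) :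
    cexp (2 * Real.pi * I * (x + 1)) = cexp (2 * Real.pi * I * x) := by
  rw [mul_add, mul_one, Complex.exp_add, exp_two_pi_mul_I, mul_one]

lemma thetaProd_add_one (x : ℂ) : thetaProd τ (x + 1) = thetaProd τ x := by
  rw [thetaProd, thetaProd, cexp_two_pi_I_add_one, ← cexp_two_pi_I_add_one (τ - (x + 1))]
  congr 4
  ring

lemma qPochhammer_one {Q : ℂ} (hQ : ‖Q‖ < 1) : qPochhammer Q 1 = 0 := by
  rw [qPochhammer_eq_mul hQ]; simp

/-- With y = e^{2πix}, the shift replaces the linear factor 1 - y by 1 - 1/y, and the ratio of the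
two is -1/y. -/
lemma thetaProd_add_tau (hτ : 0 < τ.im) (x : ℂ) :
    thetaProd τ (x + τ) = -cexp (-(2 * Real.pi * I * x)) * thetaProd τ x := by
  have hQ := norm_nome_lt_one hτ
  set Q := cexp (2 * Real.pi * I * τ) with hQd
  set y := cexp (2 * Real.pi * I * x) with hy
  have hy0 : y ≠ 0 := Complex.exp_ne_zero _
  have e1 : cexp (2 * Real.pi * I * (x + τ)) = Q * y := by
    rw [hQd, hy, ← Complex.exp_add]; congr 1; ring
  have e2 : cexp (2 * Real.pi * I * (τ - (x + τ))) = y⁻¹ := by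
    rw [hy, ← Complex.exp_neg]; congr 1; ring
  have e3 : cexp (2 * Real.pi * I * (τ - x)) = Q * y⁻¹ := by
    rw [hQd, hy, ← Complex.exp_neg, ← Complex.exp_add]; congr 1; ring
  rw [thetaProd, thetaProd, e1, e2, e3, Complex.exp_neg, ← hy, ← hQd]
  by_cases h1 : y = 1
  · simp [h1, qPochhammer_one hQ]
  · rw [qPochhammer_eq_mul hQ y⁻¹, qPochhammer_eq_mul hQ y]
    field_simp
    ring

lemma thetaProd_eq_zero (hτ : 0 < τ.im) {x : ℂ} (h : thetaProd τ x = 0) :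
    ∃ m n : ℤ, x = m + n * τ := by
  have hQ := norm_nome_lt_one hτ
  have hpi : (2 * Real.pi * I : ℂ) ≠ 0 := two_pi_I_ne_zero
  have key : ∀ w, qPochhammer (cexp (2 * Real.pi * I * τ)) (cexp (2 * Real.pi * I * w)) = 0 →
      ∃ m n : ℤ, w = m + n * τ := by
    intro w hw
    obtain ⟨n, hn⟩ := exists_pow_mul_eq_one_of_qPochhammer_eq_zero hQ hw
    rw [← Complex.exp_nat_mul, ← Complex.exp_add, Complex.exp_eq_one_iff] at hn
    obtain ⟨m, hm⟩ := hn
    refine ⟨m, -n, ?_⟩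
    apply mul_left_cancel₀ hpi
    push_cast
    linear_combination hm
  rcases mul_eq_zero.1 h with h | h
  · exact key x h
  · obtain ⟨m, n, hmn⟩ := key _ h
    refine ⟨-m, 1 - n, ?_⟩
    push_cast
    linear_combination -hmn

/-- After the factor 1 - e^{2πix} is split off, the value at 0 of the rest is the square of (Q;Q)_∞,
which is nonzero because |Q| < 1. -/
lemma deriv_thetaProd_zero_ne_zero (hτ : 0 < τ.im) : deriv (thetaProd τ) 0 ≠ 0 := by
  have hQ := norm_nome_lt_one hτ
  set Q := cexp (2 * Real.pi * I * τ) with hQd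
  have hd := differentiable_qPochhammer hQ
  have e : thetaProd τ = fun x => (1 - cexp (2 * Real.pi * I * x)) *
      (qPochhammer Q (Q * cexp (2 * Real.pi * I * x)) *
        qPochhammer Q (cexp (2 * Real.pi * I * (τ - x)))) := by
    funext x
    rw [thetaProd, ← hQd, qPochhammer_eq_mul hQ (cexp (2 * Real.pi * I * x))]
    ring
  have h1 : HasDerivAt (fun x : ℂ => 1 - cexp (2 * Real.pi * I * x)) (-(2 * Real.pi * I)) 0 := by
    have := (((hasDerivAt_id (0 : ℂ)).const_mul (2 * Real.pi * I)).cexp).const_sub 1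
    simpa using this
  have h2 : DifferentiableAt ℂ (fun x => qPochhammer Q (Q * cexp (2 * Real.pi * I * x)) *
        qPochhammer Q (cexp (2 * Real.pi * I * (τ - x)))) 0 :=
    ((hd.comp (f := fun x => Q * cexp (2 * Real.pi * I * x)) (by fun_prop)).mul
      (hd.comp (f := fun x => cexp (2 * Real.pi * I * (τ - x))) (by fun_prop))) 0
  have h3 := (h1.fun_mul h2.hasDerivAt).deriv
  rw [e, h3]
  have hQ0 : qPochhammer Q Q ≠ 0 := by
    intro h0
    obtain ⟨n, hn⟩ := exists_pow_mul_eq_one_of_qPochhammer_eq_zero hQ h0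
    rw [← pow_succ] at hn
    have := congrArg norm hn
    rw [norm_pow, norm_one] at this
    exact (pow_lt_one₀ (norm_nonneg _) hQ (by lia)).ne this
  simp only [mul_zero, Complex.exp_zero, sub_self, zero_mul, add_zero, mul_one, sub_zero, ← hQd]
  exact mul_ne_zero (neg_ne_zero.2 two_pi_I_ne_zero) (mul_ne_zero hQ0 hQ0)

lemma deriv_thetaProd_ne_zero (hτ : 0 < τ.im) {x : ℂ} (h : thetaProd τ x = 0) :
    deriv (thetaProd τ) x ≠ 0 := by
  obtain ⟨m, n, rfl⟩ := thetaProd_eq_zero hτ h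
  refine (lattice_induction (P := fun x => thetaProd τ x = 0 ∧ deriv (thetaProd τ) x ≠ 0)
    ⟨?_, deriv_thetaProd_zero_ne_zero hτ⟩ (fun x => ?_) (fun x => ?_) m n).2
  · simp [thetaProd, qPochhammer_one (norm_nome_lt_one hτ)]
  · have : deriv (thetaProd τ) (x + 1) = deriv (thetaProd τ) x := by
      rw [← deriv_comp_add_const]
      congr 1
      exact funext fun x => thetaProd_add_one x
    rw [thetaProd_add_one, this]
  · rw [thetaProd_add_tau hτ]
    simp only [mul_eq_zero, neg_eq_zero, Complex.exp_ne_zero, false_or]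
    refine and_congr_right fun h0 => ?_
    have : deriv (thetaProd τ) (x + τ) =
        -cexp (-(2 * Real.pi * I * x)) * deriv (thetaProd τ) x := by
      rw [← deriv_comp_add_const, funext fun x => thetaProd_add_tau hτ x]
      have := ((show Differentiable ℂ (fun x => -cexp (-(2 * Real.pi * I * x))) by
        fun_prop) x).hasDerivAt.mul (differentiable_thetaProd hτ x).hasDerivAt
      refine this.deriv.trans ?_
      rw [h0]
      ring
    rw [this]
    simp [Complex.exp_ne_zero]

/-- The zeros of the first theta function are the lattice points, unless it vanishes. -/
lemma theta1_eq_zero_imp (hτ : 0 < τ.im) (hne : ∃ x, theta1 x τ ≠ 0) {x : ℂ}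
    (hx : theta1 x τ = 0) : ∃ m n : ℤ, x = m + n * τ := by
  -- The factor e^{πix} gives Θ₁ the same multipliers as `thetaProd`, so the quotient is doubly
  -- periodic. Being entire as well, it is constant, and the triple product identity itself is not
  -- needed.
  set j : ℂ → ℂ := fun x => cexp (Real.pi * I * x) * theta1 x τ with hj
  have dj : Differentiable ℂ j := by
    have := differentiable_theta1 hτ
    fun_prop
  have dh := differentiable_thetaProd hτ
  obtain ⟨r, dr, hr⟩ := exists_differentiable_mul_eq dj dh (fun x h0 =>
    ⟨by obtain ⟨m, n, rfl⟩ := thetaProd_eq_zero hτ h0; simp [hj, theta1_lattice],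
      deriv_thetaProd_ne_zero hτ h0⟩)
  have j1 : ∀ x, j (x + 1) = j x := fun x => by
    simp only [hj]
    rw [theta1_add_one, mul_add, Complex.exp_add, mul_one, exp_pi_mul_I]
    ring
  have jτ : ∀ x, j (x + τ) = -cexp (-(2 * Real.pi * I * x)) * j x := fun x => by
    simp only [hj]
    have h : cexp (Real.pi * I * (x + τ)) * cexp (-Real.pi * I * τ - 2 * Real.pi * I * x) =
        cexp (-(2 * Real.pi * I * x)) * cexp (Real.pi * I * x) := by
      rw [← Complex.exp_add, ← Complex.exp_add]
      congr 1
      ring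
    rw [theta1_add_tau]
    linear_combination -theta1 x τ * h
  -- Periodicity of the quotient can be read off only where the denominator is nonzero; density and
  -- continuity give it everywhere.
  have dense : Dense {x | thetaProd τ x ≠ 0} := by
    have hd0 := deriv_thetaProd_zero_ne_zero hτ
    have ha : AnalyticOnNhd ℂ (thetaProd τ) univ := fun x _ => dh.analyticAt x
    intro x
    rw [mem_closure_iff_frequently]
    intro hx
    have hx' : thetaProd τ =ᶠ[𝓝 x] fun _ => 0 := by
      filter_upwards [hx] with y hy using not_not.1 hy
    have := ha.eq_of_eventuallyEq analyticOnNhd_const hx'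
    exact hd0 (by rw [this]; simp)
  have r1 : ∀ x, r (x + 1) = r x := by
    have hc := dr.continuous
    refine fun x => congrFun (Continuous.ext_on (f := fun x => r (x + 1)) dense (by fun_prop) hc
      fun y hy => ?_) x
    apply mul_right_cancel₀ hy
    simp only
    rw [hr, ← j1, ← hr, thetaProd_add_one]
  have rτ : ∀ x, r (x + τ) = r x := by
    have hc := dr.continuous
    refine fun x => congrFun (Continuous.ext_on (f := fun x => r (x + τ)) dense (by fun_prop) hc
      fun y hy => ?_) x
    have h1 := hr (y + τ)
    rw [jτ, ← hr, thetaProd_add_tau hτ] at h1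
    have : -cexp (-(2 * Real.pi * I * y)) * thetaProd τ y ≠ 0 :=
      mul_ne_zero (neg_ne_zero.2 (Complex.exp_ne_zero _)) hy
    apply mul_right_cancel₀ this
    simp only
    linear_combination h1
  have hconst := eq_const_of_doubly_periodic hτ dr r1 rτ
  obtain ⟨x₁, hx₁⟩ := hne
  have hr0 : r x ≠ 0 := by
    rw [hconst x x₁]
    intro h0
    have := hr x₁
    rw [h0, zero_mul] at this
    exact mul_ne_zero (Complex.exp_ne_zero _) hx₁ this.symm
  refine thetaProd_eq_zero hτ (x := x) ?_
  have := hr x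
  simp only [hj, hx, mul_zero] at this
  exact (mul_eq_zero.1 this).resolve_left hr0

end theta

/-! ### Transformation of the theta function with characteristic. -/

section thetaChar

lemma thetaChar_neg (c x T : ℂ) : thetaChar c (-x) T = thetaChar (-c) x T := by
  rw [thetaChar, thetaChar, ← (Equiv.neg ℤ).tsum_eq]
  refine tsum_congr fun l => ?_
  simp only [Equiv.neg_apply, Int.cast_neg]
  congr 2 <;> ring

lemma thetaChar_add_one (c x T : ℂ) : thetaChar (c + 1) x T = thetaChar c x T := by
  rw [thetaChar, thetaChar, ← (Equiv.addRight (1 : ℤ)).tsum_eq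
    (fun l : ℤ => cexp (Real.pi * I * ((l : ℂ) + c) ^ 2 * T) *
      cexp (2 * Real.pi * I * ((l : ℂ) + c) * x))]
  refine tsum_congr fun l => ?_
  simp only [Equiv.coe_addRight, Int.cast_add, Int.cast_one]
  congr 2 <;> ring

lemma thetaChar_sub_two (c x T : ℂ) :
    thetaChar c (x - 2) T = cexp (-(4 * Real.pi * I * c)) * thetaChar c x T := by
  rw [thetaChar, thetaChar, ← tsum_mul_left]
  refine tsum_congr fun l => ?_
  have h : cexp (2 * Real.pi * I * (l + c) * (x - 2)) =
      cexp (-(4 * Real.pi * I * c)) * cexp (2 * Real.pi * I * (l + c) * x) := by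
    rw [← Complex.exp_add, Complex.exp_eq_exp_iff_exists_int]
    exact ⟨-2 * l, by push_cast; ring⟩
  rw [h]
  ring

/-- Completing the square: with modulus 2pτ a shift of the argument by -2τ is a shift of the
characteristic by -1/p, that is, of μ by -2. -/
lemma thetaChar_sub_two_mul_tau {p : ℕ} (hp : p ≠ 0) (c x τ : ℂ) :
    thetaChar c (x - 2 * τ) (2 * p * τ) =
      cexp (2 * Real.pi * I * (x - τ) / p) * thetaChar (c - 1 / p) x (2 * p * τ) := by
  rw [thetaChar, thetaChar, ← tsum_mul_left]
  refine tsum_congr fun l => ?_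
  have hp' : (p : ℂ) ≠ 0 := Nat.cast_ne_zero.2 hp
  rw [← Complex.exp_add, ← Complex.exp_add, ← Complex.exp_add]
  congr 1
  field_simp
  ring

lemma thetaChar_eq_jacobiTheta₂ (c x T : ℂ) : thetaChar c x T =
    cexp (Real.pi * I * c ^ 2 * T + 2 * Real.pi * I * c * x) * jacobiTheta₂ (x + c * T) T := by
  rw [thetaChar, jacobiTheta₂, ← tsum_mul_left]
  refine tsum_congr fun l => ?_
  rw [jacobiTheta₂_term, ← Complex.exp_add, ← Complex.exp_add]
  congr 1
  ring

lemma differentiable_thetaChar {T : ℂ} (hT : 0 < T.im) (c : ℂ) :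
    Differentiable ℂ fun x => thetaChar c x T := by
  simp_rw [thetaChar_eq_jacobiTheta₂]
  intro x
  have h1 : DifferentiableAt ℂ (fun x => jacobiTheta₂ (x + c * T) T) x :=
    (differentiableAt_jacobiTheta₂_fst _ hT).comp x (f := fun x => x + c * T) (by fun_prop)
  fun_prop

end thetaChar

/-! ### Quasi-periods and zeros of the prime form. -/

section primeForm

variable {τ : ℂ}

lemma primeForm_add_one (x τ : ℂ) : primeForm (x + 1) τ = -primeForm x τ := by
  rw [primeForm, theta1_add_one, neg_div]; rfl

lemma primeForm_neg (x τ : ℂ) : primeForm (-x) τ = -primeForm x τ := by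
  rw [primeForm, theta1_neg, neg_div]; rfl

lemma primeForm_add_tau (x τ : ℂ) :
    primeForm (x + τ) τ = -cexp (-Real.pi * I * τ - 2 * Real.pi * I * x) * primeForm x τ := by
  rw [primeForm, theta1_add_tau, mul_div_assoc]; rfl

lemma differentiable_primeForm (hτ : 0 < τ.im) : Differentiable ℂ fun x => primeForm x τ :=
  (differentiable_theta1 hτ).div_const _

lemma primeForm_lattice (τ : ℂ) (m n : ℤ) : primeForm (m + n * τ) τ = 0 := by
  rw [primeForm, theta1_lattice, zero_div]

lemma primeForm_eq_zero_imp (hτ : 0 < τ.im) (h0 : deriv (fun y => theta1 y τ) 0 ≠ 0) {x : ℂ}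
    (hx : primeForm x τ = 0) : ∃ m n : ℤ, x = m + n * τ := by
  refine theta1_eq_zero_imp hτ ?_ ((div_eq_zero_iff.1 hx).resolve_right h0)
  by_contra! h
  simp [h] at h0

lemma deriv_primeForm_lattice_ne_zero (hτ : 0 < τ.im) (h0 : deriv (fun y => theta1 y τ) 0 ≠ 0)
    (m n : ℤ) : deriv (fun x => primeForm x τ) (m + n * τ) ≠ 0 := by
  refine (lattice_induction
    (P := fun x => primeForm x τ = 0 ∧ deriv (fun x => primeForm x τ) x ≠ 0)
    ⟨by simpa using primeForm_lattice τ 0 0, ?_⟩ (fun x => ?_) (fun x => ?_) m n).2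
  · simp only [primeForm]
    rw [deriv_div_const, div_self h0]
    exact one_ne_zero
  · have : deriv (fun x => primeForm x τ) (x + 1) = -deriv (fun x => primeForm x τ) x := by
      rw [← deriv_comp_add_const, ← deriv.fun_neg]
      congr 1
      exact funext fun x => primeForm_add_one x τ
    rw [primeForm_add_one, this, neg_eq_zero, neg_ne_zero]
  · rw [primeForm_add_tau]
    simp only [mul_eq_zero, neg_eq_zero, Complex.exp_ne_zero, false_or]
    refine and_congr_right fun hx => ?_
    have : deriv (fun x => primeForm x τ) (x + τ) =
        -cexp (-Real.pi * I * τ - 2 * Real.pi * I * x) * deriv (fun x => primeForm x τ) x := by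
      rw [← deriv_comp_add_const, funext fun x => primeForm_add_tau x τ]
      have := ((show Differentiable ℂ (fun x => -cexp (-Real.pi * I * τ - 2 * Real.pi * I * x)) by
        fun_prop) x).hasDerivAt.fun_mul (differentiable_primeForm hτ x).hasDerivAt
      rw [this.deriv, hx]
      ring
    rw [this]
    simp [Complex.exp_ne_zero]

end primeForm

/-! ### The two factors of the form: symmetries and local structure. -/

section quotients

variable {z τ : ℂ}

/-- The product `E(t) E(z + t)`, of which `f` is a determination of the power `-1/p`. -/
noncomputable def primeProd (z τ t : ℂ) : ℂ := primeForm t τ * primeForm (z + t) τ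

/-- The second logarithmic derivative of `E(z + t) / E(t)`. -/
noncomputable def pForm (z τ : ℂ) : ℂ → ℂ :=
  deriv (logDeriv fun s => primeForm (z + s) τ / primeForm s τ)

lemma primeProd_reflect (z τ t : ℂ) : primeProd z τ (-z - t) = primeProd z τ t := by
  rw [primeProd, primeProd, show -z - t = -(z + t) by ring, show z + -(z + t) = -t by ring,
    primeForm_neg, primeForm_neg]
  ring

lemma primeProd_add_one (z τ t : ℂ) : primeProd z τ (t + 1) = primeProd z τ t := by
  rw [primeProd, primeProd, ← add_assoc, primeForm_add_one, primeForm_add_one]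
  ring

lemma primeProd_add_tau (z τ t : ℂ) : primeProd z τ (t + τ) =
    cexp (-(2 * Real.pi * I * (τ + z + 2 * t))) * primeProd z τ t := by
  rw [primeProd, primeProd, ← add_assoc, primeForm_add_tau, primeForm_add_tau]
  have h : cexp (-Real.pi * I * τ - 2 * Real.pi * I * t) *
      cexp (-Real.pi * I * τ - 2 * Real.pi * I * (z + t)) =
      cexp (-(2 * Real.pi * I * (τ + z + 2 * t))) := by
    rw [← Complex.exp_add]
    congr 1
    ring
  linear_combination (primeForm t τ * primeForm (z + t) τ) * h

lemma differentiable_primeProd (hτ : 0 < τ.im) : Differentiable ℂ (primeProd z τ) := by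
  have := differentiable_primeForm hτ
  exact this.mul (this.comp (f := fun t => z + t) (by fun_prop))

lemma pForm_add_one (t : ℂ) : pForm z τ (t + 1) = pForm z τ t := by
  have : (fun s => logDeriv (fun s => primeForm (z + s) τ / primeForm s τ) (s + 1)) =
      logDeriv fun s => primeForm (z + s) τ / primeForm s τ := by
    funext s
    rw [logDeriv_apply, ← deriv_comp_add_const]
    simp only [← add_assoc, primeForm_add_one, neg_div_neg_eq]
    rfl
  conv_rhs => rw [pForm, ← this, deriv_comp_add_const]
  rfl

lemma pForm_add_tau (t : ℂ) : pForm z τ (t + τ) = pForm z τ t := by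
  have : (fun s => logDeriv (fun s => primeForm (z + s) τ / primeForm s τ) (s + τ)) =
      logDeriv fun s => primeForm (z + s) τ / primeForm s τ := by
    funext s
    have e : ∀ s, primeForm (z + s + τ) τ / primeForm (s + τ) τ =
        cexp (-(2 * Real.pi * I * z)) * (primeForm (z + s) τ / primeForm s τ) := fun s => by
      rw [primeForm_add_tau, primeForm_add_tau, mul_div_mul_comm, neg_div_neg_eq, ← Complex.exp_sub]
      congr 2
      ring
    rw [← logDeriv_const_mul (f := fun s => primeForm (z + s) τ / primeForm s τ) s _
      (Complex.exp_ne_zero (-(2 * Real.pi * I * z))), logDeriv_apply, ← deriv_comp_add_const]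
    simp only [← add_assoc, e]
    rfl
  conv_rhs => rw [pForm, ← this, deriv_comp_add_const]
  rfl

/-- The reflection inverts the quotient E(z+s)/E(s). Its logarithmic derivative is therefore
invariant, and one more derivative changes sign. -/
lemma pForm_reflect (t : ℂ) : pForm z τ (-z - t) = -pForm z τ t := by
  have : (fun s => logDeriv (fun s => primeForm (z + s) τ / primeForm s τ) (-z - s)) =
      logDeriv fun s => primeForm (z + s) τ / primeForm s τ := by
    funext s
    set v : ℂ → ℂ := fun s => primeForm (z + s) τ / primeForm s τ with hv
    have e : ∀ s, v (-z - s) = (v s)⁻¹ := fun s => by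
      simp only [hv]
      rw [show z + (-z - s) = -s by ring, show -z - s = -(z + s) by ring, primeForm_neg,
        primeForm_neg, neg_div_neg_eq, inv_div]
    have e1 : deriv (fun s => v (-z - s)) s = -deriv v (-z - s) := deriv_comp_const_sub v (-z) s
    by_cases hd : DifferentiableAt ℂ v s
    · by_cases h0 : v s = 0
      -- At zeros and at points of non-differentiability both sides are 0 by the conventions for
      -- division and `deriv`, so the identity needs no exclusion of points.
      · simp [logDeriv_apply, e, h0]
      · have : deriv (fun s => v (-z - s)) s = -deriv v s / v s ^ 2 := by
          simp_rw [e]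
          exact deriv_fun_inv'' hd h0
        rw [logDeriv_apply, logDeriv_apply, e]
        rw [this] at e1
        field_simp at e1 ⊢
        linear_combination e1
    · by_cases hd' : DifferentiableAt ℂ v (-z - s)
      · have hz : v (-z - s) = 0 := by
          by_contra h0
          refine hd ?_
          have : DifferentiableAt ℂ (fun s => (v (-z - s))⁻¹) s :=
            (DifferentiableAt.comp s (f := fun s => -z - s) hd' (by fun_prop)).inv h0
          simpa [e] using this
        rw [logDeriv_apply, hz, div_zero, logDeriv_eq_zero_of_not_differentiableAt _ _ hd]
      · rw [logDeriv_eq_zero_of_not_differentiableAt _ _ hd,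
          logDeriv_eq_zero_of_not_differentiableAt _ _ hd']
  have h2 := deriv_comp_const_sub (logDeriv fun s => primeForm (z + s) τ / primeForm s τ) (-z) t
  rw [this] at h2
  rw [pForm, h2, neg_neg]

lemma analyticAt_pForm (hτ : 0 < τ.im) {t : ℂ} (h : primeProd z τ t ≠ 0) :
    AnalyticAt ℂ (pForm z τ) t := by
  have d := differentiable_primeForm hτ
  have a1 : AnalyticAt ℂ (fun s => primeForm s τ) t := d.analyticAt t
  have a2 : AnalyticAt ℂ (fun s => primeForm (z + s) τ) t :=
    (d.comp (f := fun s => z + s) (by fun_prop)).analyticAt t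
  have a3 := a2.fun_div a1 (left_ne_zero_of_mul h)
  exact (a3.deriv.div a3 (div_ne_zero (right_ne_zero_of_mul h) (left_ne_zero_of_mul h))).deriv

/-- If `v = (t - e)^s m(t)` near `e`, the second logarithmic derivative of `v` has at most a double
pole at `e`. -/
lemma exists_analyticAt_deriv_logDeriv {v m : ℂ → ℂ} {e : ℂ} (s : ℤ) (hm : AnalyticAt ℂ m e)
    (hm0 : m e ≠ 0) (hv : ∀ᶠ t in 𝓝[≠] e, v t = (t - e) ^ s * m t) :
    ∃ h, AnalyticAt ℂ h e ∧ ∀ᶠ t in 𝓝[≠] e, deriv (logDeriv v) t = h t / (t - e) ^ 2 := by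
  have hl : AnalyticAt ℂ (logDeriv m) e := hm.deriv.div hm hm0
  refine ⟨fun t => -s + (t - e) ^ 2 * deriv (logDeriv m) t, ?_, ?_⟩
  · have := hl.deriv
    fun_prop
  have h1 : ∀ᶠ t in 𝓝[≠] e, logDeriv v t = s * (t - e)⁻¹ + logDeriv m t := by
    have hv' := eventually_eventually_nhdsWithin.2 hv
    filter_upwards [hv', (hm.eventually_analyticAt.filter_mono nhdsWithin_le_nhds),
      (hm.continuousAt.eventually_ne hm0).filter_mono nhdsWithin_le_nhds,
      self_mem_nhdsWithin] with t ht ha h0 hne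
    have hs : t - e ≠ 0 := sub_ne_zero.2 hne
    have ht' : v =ᶠ[𝓝 t] fun t => (t - e) ^ s * m t := by
      rwa [(isOpen_compl_singleton (x := e)).nhdsWithin_eq hne] at ht
    have hd : DifferentiableAt ℂ (fun t : ℂ => (t - e) ^ s) t :=
      DifferentiableAt.zpow (by fun_prop) (Or.inl hs)
    rw [(logDeriv_congr_nhds ht').eq_of_nhds,
      logDeriv_mul (f := fun t : ℂ => (t - e) ^ s) t (zpow_ne_zero _ hs) h0 hd ha.differentiableAt,
      logDeriv_fun_zpow (f := fun t : ℂ => t - e) (by fun_prop)]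
    simp [logDeriv_apply]
  have h1' := eventually_eventually_nhdsWithin.2 h1
  filter_upwards [h1', (hl.eventually_analyticAt.filter_mono nhdsWithin_le_nhds),
      self_mem_nhdsWithin] with t ht ha hne
  have hs : t - e ≠ 0 := sub_ne_zero.2 hne
  have ht' : logDeriv v =ᶠ[𝓝 t] fun t => s * (t - e)⁻¹ + logDeriv m t := by
    rwa [(isOpen_compl_singleton (x := e)).nhdsWithin_eq hne] at ht
  have d1 : HasDerivAt (fun t : ℂ => (t - e)⁻¹) (-1 / (t - e) ^ 2) t :=
    ((hasDerivAt_id t).sub_const e).fun_inv hs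
  have d2 := (d1.const_mul (s : ℂ)).fun_add ha.differentiableAt.hasDerivAt
  rw [ht'.deriv_eq, d2.deriv]
  field_simp

/-- The branch points of `ω`. -/
def IsBranchPoint (z τ e : ℂ) : Prop := ∃ m n : ℤ, e = m + n * τ ∨ e = m + n * τ - z

lemma isBranchPoint_of_primeProd_eq_zero (hτ : 0 < τ.im)
    (h0 : deriv (fun y => theta1 y τ) 0 ≠ 0) {t : ℂ} (h : primeProd z τ t = 0) :
    IsBranchPoint z τ t := by
  rcases mul_eq_zero.1 h with h | h
  · obtain ⟨m, n, hmn⟩ := primeForm_eq_zero_imp hτ h0 h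
    exact ⟨m, n, Or.inl hmn⟩
  · obtain ⟨m, n, hmn⟩ := primeForm_eq_zero_imp hτ h0 h
    exact ⟨m, n, Or.inr (by linear_combination hmn)⟩

lemma IsBranchPoint.primeProd_eq_zero {e : ℂ} (h : IsBranchPoint z τ e) :
    primeProd z τ e = 0 := by
  obtain ⟨m, n, rfl | rfl⟩ := h
  · rw [primeProd, primeForm_lattice, zero_mul]
  · rw [primeProd, add_sub_cancel, primeForm_lattice, mul_zero]

/-- At a branch point `E(t) E(z + t)` has a simple zero and the second logarithmic derivative of
`E(z + t) / E(t)` at most a double pole. -/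
lemma IsBranchPoint.exists_local (hτ : 0 < τ.im) (h0 : deriv (fun y => theta1 y τ) 0 ≠ 0)
    (hz : ∀ m n : ℤ, z ≠ m + n * τ) {e : ℂ} (he : IsBranchPoint z τ e) :
    ∃ k h : ℂ → ℂ, AnalyticAt ℂ k e ∧ k e ≠ 0 ∧ AnalyticAt ℂ h e ∧
      (∀ t, primeProd z τ t = (t - e) * k t) ∧
      ∀ᶠ t in 𝓝[≠] e, pForm z τ t = h t / (t - e) ^ 2 := by
  have d := differentiable_primeForm hτ
  have d' : Differentiable ℂ fun s => primeForm (z + s) τ :=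
    d.comp (f := fun s => z + s) (by fun_prop)
  obtain ⟨m, n, rfl | rfl⟩ := he
  · set e : ℂ := m + n * τ with he
    set E := fun s => primeForm s τ
    have ak : AnalyticAt ℂ (dslope E e) e :=
      (((differentiableOn_dslope univ_mem).2 d.differentiableOn).analyticAt univ_mem)
    have ak0 : dslope E e e ≠ 0 := by
      rw [dslope_same]; exact deriv_primeForm_lattice_ne_zero hτ h0 m n
    have hE : ∀ t, E t = (t - e) * dslope E e t := fun t => by
      have := sub_smul_dslope E e t
      rw [show E e = 0 from primeForm_lattice τ m n, sub_zero, smul_eq_mul] at this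
      exact this.symm
    have b : AnalyticAt ℂ (fun s => primeForm (z + s) τ) e := d'.analyticAt e
    have b0 : primeForm (z + e) τ ≠ 0 := fun h => by
      obtain ⟨m', n', h'⟩ := primeForm_eq_zero_imp hτ h0 h
      refine hz (m' - m) (n' - n) ?_
      push_cast
      linear_combination h' - he
    obtain ⟨h, ha, hh⟩ := exists_analyticAt_deriv_logDeriv
      (v := fun s => primeForm (z + s) τ / primeForm s τ) (-1) (b.fun_div ak ak0)
      (div_ne_zero b0 ak0) (by
        filter_upwards with t
        rw [show primeForm t τ = _ from hE t, zpow_neg_one, div_eq_mul_inv,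
          mul_inv]
        ring)
    refine ⟨fun t => dslope E e t * primeForm (z + t) τ, h, ak.mul b, mul_ne_zero ak0 b0, ha,
      fun t => ?_, hh⟩
    rw [primeProd, show primeForm t τ = _ from hE t]
    ring
  · set e : ℂ := m + n * τ - z with he
    set E := fun s => primeForm (z + s) τ
    have ak : AnalyticAt ℂ (dslope E e) e :=
      (((differentiableOn_dslope univ_mem).2 d'.differentiableOn).analyticAt univ_mem)
    have hze : z + e = m + n * τ := by rw [he]; ring
    have ak0 : dslope E e e ≠ 0 := by
      rw [dslope_same]
      have : deriv E e = deriv (fun s => primeForm s τ) (z + e) :=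
        deriv_comp_const_add (fun s => primeForm s τ) z e
      rw [this, hze]
      exact deriv_primeForm_lattice_ne_zero hτ h0 m n
    have hE : ∀ t, E t = (t - e) * dslope E e t := fun t => by
      have := sub_smul_dslope E e t
      rw [show E e = 0 by simp only [E]; rw [hze, primeForm_lattice], sub_zero, smul_eq_mul] at this
      exact this.symm
    have b : AnalyticAt ℂ (fun s => primeForm s τ) e := d.analyticAt e
    have b0 : primeForm e τ ≠ 0 := fun h => by
      obtain ⟨m', n', h'⟩ := primeForm_eq_zero_imp hτ h0 h
      refine hz (m - m') (n - n') ?_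
      push_cast
      linear_combination he - h'
    obtain ⟨h, ha, hh⟩ := exists_analyticAt_deriv_logDeriv
      (v := fun s => primeForm (z + s) τ / primeForm s τ) 1 (ak.fun_div b b0)
      (div_ne_zero ak0 b0) (by
        filter_upwards with t
        rw [show primeForm (z + t) τ = _ from hE t, zpow_one]
        ring)
    refine ⟨fun t => primeForm t τ * dslope E e t, h, b.mul ak, mul_ne_zero b0 ak0, ha,
      fun t => ?_, hh⟩
    rw [primeProd, show primeForm (z + t) τ = _ from hE t]
    ring

end quotients

/-! ### Transformation of the form under the reflections. -/

section omega

variable {p : ℕ} {z τ κ : ℂ} {f : ℂ → ℂ} {t : ℂ}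

lemma omega_eq (p : ℕ) (z τ κ : ℂ) (f : ℂ → ℂ) (μ : ℤ) (t : ℂ) : omega p z τ κ f μ t =
    1 / ModularForm.eta τ ^ 3 * κ * thetaChar ((μ : ℂ) / (2 * p)) (-z - 2 * t) (2 * p * τ) *
      f t * pForm z τ t := by
  rw [omega, pForm]
  ring

/-- Adding 2p to μ adds 1 to the characteristic μ/2p. -/
lemma omega_add_two_mul (hp : p ≠ 0) (μ : ℤ) :
    omega p z τ κ f (μ + 2 * p) = omega p z τ κ f μ := by
  have hp' : (p : ℂ) ≠ 0 := Nat.cast_ne_zero.2 hp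
  funext t
  rw [omega, omega, ← thetaChar_add_one ((μ : ℂ) / (2 * p))]
  congr 6
  push_cast
  field_simp

lemma omega_reflect (hf : f (-z - t) = f t) (μ : ℤ) :
    omega p z τ κ f μ (-z - t) = -omega p z τ κ f (-μ) t := by
  rw [omega_eq, omega_eq, hf, pForm_reflect, show -z - 2 * (-z - t) = -(-z - 2 * t) by ring,
    thetaChar_neg]
  push_cast
  rw [neg_div]
  ring

lemma qTilde_zpow_neg (p : ℕ) (μ : ℤ) :
    qTilde p ^ (-μ) = cexp (-(4 * Real.pi * I * (μ / (2 * p)))) := by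
  rw [qTilde, ← Complex.exp_int_mul]
  congr 1
  push_cast
  rw [mul_comm (2 : ℂ) (p : ℂ), ← div_div]
  ring

lemma omega_one_reflect (hf : f (1 - z - t) = f t) (μ : ℤ) :
    omega p z τ κ f μ (1 - z - t) = -(qTilde p ^ (-μ) * omega p z τ κ f (-μ) t) := by
  rw [omega_eq, omega_eq, hf, show 1 - z - t = -z - t + 1 by ring, pForm_add_one, pForm_reflect,
    show -z - 2 * (-z - t + 1) = -(-z - 2 * t) - 2 by ring, thetaChar_sub_two, thetaChar_neg,
    qTilde_zpow_neg]
  push_cast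
  rw [neg_div]
  ring

/-- The exponential from the theta function and the one from f are inverse to each other; only the
change of characteristic survives. -/
lemma omega_tau_reflect (hp : p ≠ 0)
    (hf : f (τ - z - t) = cexp (2 * Real.pi * I * (τ - z - 2 * t) / p) * f t) (μ : ℤ) :
    omega p z τ κ f μ (τ - z - t) = -omega p z τ κ f (2 - μ) t := by
  have hp' : (p : ℂ) ≠ 0 := Nat.cast_ne_zero.2 hp
  rw [omega_eq, omega_eq, hf, show τ - z - t = -z - t + τ by ring, pForm_add_tau, pForm_reflect,
    show -z - 2 * (-z - t + τ) = -(-z - 2 * t) - 2 * τ by ring, thetaChar_sub_two_mul_tau hp,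
    thetaChar_neg]
  have h : cexp (2 * Real.pi * I * (-(-z - 2 * t) - τ) / p) *
      cexp (2 * Real.pi * I * (τ - z - 2 * t) / p) = 1 := by
    rw [← Complex.exp_add, Complex.exp_eq_one_iff]
    exact ⟨0, by push_cast; ring⟩
  have h2 : -((μ : ℂ) / (2 * p) - 1 / p) = ((2 - μ : ℤ) : ℂ) / (2 * p) := by
    push_cast
    field_simp
    ring
  rw [h2]
  linear_combination (-(1 / ModularForm.eta τ ^ 3 * κ *
    thetaChar (((2 - μ : ℤ) : ℂ) / (2 * p)) (-z - 2 * t) (2 * p * τ) * f t * pForm z τ t)) * h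

lemma omega_one_add_tau_reflect (hp : p ≠ 0)
    (hf : f (1 + τ - z - t) = qTilde p * cexp (2 * Real.pi * I * (τ - z - 2 * t) / p) * f t)
    (μ : ℤ) :
    omega p z τ κ f μ (1 + τ - z - t) = -(qTilde p ^ (1 - μ) * omega p z τ κ f (2 - μ) t) := by
  have hp' : (p : ℂ) ≠ 0 := Nat.cast_ne_zero.2 hp
  rw [omega_eq, omega_eq, hf, show 1 + τ - z - t = -z - t + τ + 1 by ring, pForm_add_one,
    pForm_add_tau, pForm_reflect,
    show -z - 2 * (-z - t + τ + 1) = -(-z - 2 * t) - 2 * τ - 2 by ring, thetaChar_sub_two,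
    thetaChar_sub_two_mul_tau hp, thetaChar_neg, ← qTilde_zpow_neg, sub_eq_add_neg 1 μ,
    zpow_add₀ (qTilde_ne_zero p), zpow_one]
  have h : cexp (2 * Real.pi * I * (-(-z - 2 * t) - τ) / p) *
      cexp (2 * Real.pi * I * (τ - z - 2 * t) / p) = 1 := by
    rw [← Complex.exp_add, Complex.exp_eq_one_iff]
    exact ⟨0, by push_cast; ring⟩
  have h2 : -((μ : ℂ) / (2 * p) - 1 / p) = ((2 - μ : ℤ) : ℂ) / (2 * p) := by
    push_cast
    field_simp
    ring
  rw [h2]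
  linear_combination (-(1 / ModularForm.eta τ ^ 3 * κ * qTilde p * qTilde p ^ (-μ) *
    thetaChar (((2 - μ : ℤ) : ℂ) / (2 * p)) (-z - 2 * t) (2 * p * τ) * f t * pForm z τ t)) * h

end omega

/-! ### Cauchy's theorem for contractible loops. -/

/-- The integral of `F` along the straight segment from `a` to `b`. -/
noncomputable def segmentIntegral (F : ℂ → ℂ) (a b : ℂ) : ℂ :=
  ∫ u in (0 : ℝ)..1, F (a + (u : ℂ) * (b - a)) * (b - a)

lemma hasDerivAt_comp_line {G : ℂ → ℂ} {F : ℂ} (a b : ℂ) {u : ℝ}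
    (h : HasDerivAt G F (a + (u : ℂ) * (b - a))) :
    HasDerivAt (fun u : ℝ => G (a + (u : ℂ) * (b - a))) (F * (b - a)) u := by
  have h1 : HasDerivAt (fun w : ℂ => a + w * (b - a)) (b - a) (u : ℂ) := by
    simpa using ((hasDerivAt_id (u : ℂ)).mul_const (b - a)).const_add a
  exact (HasDerivAt.comp (u : ℂ) h h1).comp_ofReal

lemma segmentIntegral_self (F : ℂ → ℂ) (a : ℂ) : segmentIntegral F a a = 0 := by
  simp [segmentIntegral]

lemma segmentIntegral_eq_sub {F G : ℂ → ℂ} {D : Set ℂ} (hD : Convex ℝ D) (hF : ContinuousOn F D)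
    (hG : ∀ w ∈ D, HasDerivAt G (F w) w) {a b : ℂ} (ha : a ∈ D) (hb : b ∈ D) :
    segmentIntegral F a b = G b - G a := by
  have hmem : ∀ u ∈ uIcc (0 : ℝ) 1, a + (u : ℂ) * (b - a) ∈ D := fun u hu => by
    rw [uIcc_of_le zero_le_one] at hu
    exact hD.add_smul_sub_mem ha hb hu
  have := intervalIntegral.integral_eq_sub_of_hasDerivAt
    (f := fun u : ℝ => G (a + (u : ℂ) * (b - a)))
    (f' := fun u : ℝ => F (a + (u : ℂ) * (b - a)) * (b - a))
    (fun u hu => hasDerivAt_comp_line a b (hG _ (hmem u hu)))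
    (((hF.comp (by fun_prop) hmem).mul continuousOn_const).intervalIntegrable)
  rw [segmentIntegral, this]
  simp

lemma exists_primitive {D : Set ℂ} (hD : Convex ℝ D) (ho : IsOpen D) {F : ℂ → ℂ}
    (hF : DifferentiableOn ℂ F D) : ∃ G : ℂ → ℂ, ∀ w ∈ D, HasDerivAt G (F w) w := by
  obtain ⟨G, hG⟩ := hD.exists_forall_hasDerivWithinAt hF
  exact ⟨G, fun w hw => (hG w hw).hasDerivAt (ho.mem_nhds hw)⟩

/-- In a family of squares on each of which the integral vanishes, the sum over the bottom row
vanishes if the three other sides do not contribute. -/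
lemma sum_grid_eq_zero {N : ℕ} {e₁ e₂ : ℕ → ℕ → ℂ}
    (h : ∀ i < N, ∀ j < N, e₁ i j + e₂ (i + 1) j = e₂ i j + e₁ i (j + 1))
    (hl : ∀ j < N, e₂ 0 j = 0) (hr : ∀ j < N, e₂ N j = 0) (ht : ∀ i < N, e₁ i N = 0) :
    ∑ i ∈ Finset.range N, e₁ i 0 = 0 := by
  have step : ∀ j < N, ∑ i ∈ Finset.range N, e₁ i j = ∑ i ∈ Finset.range N, e₁ i (j + 1) := by
    intro j hj
    have h1 : ∑ i ∈ Finset.range N, (e₁ i j - e₁ i (j + 1)) =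
        ∑ i ∈ Finset.range N, (e₂ i j - e₂ (i + 1) j) :=
      Finset.sum_congr rfl fun i hi => by
        linear_combination h i (Finset.mem_range.1 hi) j hj
    rw [Finset.sum_range_sub', hl j hj, hr j hj, sub_zero, Finset.sum_sub_distrib] at h1
    exact sub_eq_zero.1 h1
  have all : ∀ j ≤ N, ∑ i ∈ Finset.range N, e₁ i 0 = ∑ i ∈ Finset.range N, e₁ i j := by
    intro j
    induction j with
    | zero => intro; rfl
    | succ j ih => intro hj; rw [ih (by lia), step j (by lia)]
  rw [all N le_rfl]
  exact Finset.sum_eq_zero fun i hi => ht i (Finset.mem_range.1 hi)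

lemma PiecewiseC1.exists_countable {c : ℝ → ℂ} (hc : PiecewiseC1 c) :
    ∃ S : Set ℝ, S.Countable ∧ ∀ s ∈ Ioo (0 : ℝ) 1 \ S, DifferentiableAt ℝ c s := by
  obtain ⟨n, u, hu, h0, h1, hd⟩ := hc
  refine ⟨range u, countable_range u, fun s hs => ?_⟩
  have hex : ∃ k, s < u k := ⟨n, h1 ▸ hs.1.2⟩
  classical
  have hk := Nat.find_spec hex
  have hk0 : Nat.find hex ≠ 0 := fun h => by
    rw [h, h0] at hk
    exact lt_asymm hk hs.1.1
  obtain ⟨i, hi⟩ := Nat.exists_eq_succ_of_ne_zero hk0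
  have hle : u i ≤ s := not_lt.1 (Nat.find_min hex (show i < Nat.find hex by lia))
  have hlt : u i < s := lt_of_le_of_ne hle fun h => hs.2 ⟨i, h⟩
  have hin : i < n := by
    have := Nat.find_min' hex (h1 ▸ hs.1.2 : s < u n)
    lia
  rw [hi] at hk
  exact ((hd i hin).differentiableOn one_ne_zero).differentiableAt (Icc_mem_nhds hlt hk)

/-- On each closed piece the one-sided derivative is continuous and agrees with `deriv` in the
interior. -/
lemma PiecewiseC1.intervalIntegrable {c : ℝ → ℂ} (hc : PiecewiseC1 c) {φ : ℝ → ℂ}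
    (hφ : Continuous φ) :
    IntervalIntegrable (fun s => φ s * deriv c s) MeasureTheory.volume 0 1 := by
  obtain ⟨n, u, hu, h0, h1, hd⟩ := hc
  rw [← h0, ← h1]
  refine IntervalIntegrable.trans_iterate fun i hi => ?_
  rcases (hu (Nat.le_succ i)).eq_or_lt with h | h
  · rw [h]
  · have h2 : ContinuousOn (fun s => φ s * derivWithin c (Icc (u i) (u (i + 1))) s)
        (uIcc (u i) (u (i + 1))) := by
      rw [uIcc_of_le h.le]
      exact hφ.continuousOn.mul
        ((hd i hi).continuousOn_derivWithin (uniqueDiffOn_Icc h) le_rfl)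
    refine h2.intervalIntegrable.congr_uIoo fun s hs => ?_
    rw [uIoo_of_le h.le] at hs
    simp only
    rw [derivWithin_of_mem_nhds (Icc_mem_nhds hs.1 hs.2)]

/-- Cauchy's theorem: the integral of a holomorphic function along a piecewise continuously
differentiable loop that is contractible in its domain vanishes. -/
theorem integral_eq_zero_of_homotopic_refl {U : Set ℂ} (hU : IsOpen U) {F : ℂ → ℂ}
    (hF : DifferentiableOn ℂ F U) {x : U} (γ : Path x x) (hγ : γ.Homotopic (Path.refl x))
    (hc : PiecewiseC1 fun s : ℝ => (γ.extend s : ℂ)) :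
    ∫ s in (0 : ℝ)..1, F (γ.extend s : ℂ) * deriv (fun r : ℝ => (γ.extend r : ℂ)) s = 0 := by
  obtain ⟨H⟩ := hγ
  set π : ℝ → unitInterval := projIcc 0 1 zero_le_one with hπ
  have hπc : Continuous π := continuous_projIcc
  set K : ℝ × ℝ → ℂ := fun q => (H (π q.1, π q.2) : ℂ) with hK
  have hKc : Continuous K := by
    have := H.continuous
    fun_prop
  have hKU : ∀ q, K q ∈ U := fun q => (H _).2
  have hπ0 : π 0 = 0 := projIcc_left _
  have hπ1 : π 1 = 1 := projIcc_right _
  have hK0 : ∀ s, K (0, s) = γ.extend s := fun s => by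
    simp only [hK, hπ0]
    rw [H.apply_zero]
    rfl
  have hK1 : ∀ s, K (1, s) = x := fun s => by
    simp only [hK, hπ1]
    rw [H.apply_one]
    rfl
  have hKl : ∀ s, K (s, 0) = x := fun s => by
    simp [hK, hπ0]
  have hKr : ∀ s, K (s, 1) = x := fun s => by
    simp [hK, hπ1]
  -- A Lebesgue number for balls contained in U: each small square of parameters is sent by the
  -- homotopy into a ball, where F has a primitive.
  obtain ⟨δ, hδ, hL⟩ := lebesgue_number_lemma_of_metric
    (s := Icc (0 : ℝ) 1 ×ˢ Icc (0 : ℝ) 1)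
    (c := fun i : {b : ℂ × ℝ // Metric.ball b.1 b.2 ⊆ U} => K ⁻¹' Metric.ball i.1.1 i.1.2)
    (isCompact_Icc.prod isCompact_Icc) (fun i => Metric.isOpen_ball.preimage hKc)
    (fun q _ => by
      obtain ⟨r, hr, hrU⟩ := Metric.isOpen_iff.1 hU _ (hKU q)
      exact mem_iUnion.2 ⟨⟨(K q, r), hrU⟩, Metric.mem_ball_self hr⟩)
  obtain ⟨M, hM⟩ := exists_nat_one_div_lt hδ
  set N := M + 1
  have hN : (0 : ℝ) < N := by positivity
  have hN' : 1 / (N : ℝ) < δ := by exact_mod_cast hM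
  have hprim : ∀ q ∈ Icc (0 : ℝ) 1 ×ˢ Icc (0 : ℝ) 1, ∃ (B : Set ℂ) (G : ℂ → ℂ), Convex ℝ B ∧
      B ⊆ U ∧ (∀ w ∈ B, HasDerivAt G (F w) w) ∧ ∀ q', dist q' q < δ → K q' ∈ B := by
    intro q hq
    obtain ⟨i, hi⟩ := hL q hq
    obtain ⟨G, hG⟩ := exists_primitive (convex_ball i.1.1 i.1.2) Metric.isOpen_ball
      (hF.mono i.2)
    exact ⟨_, G, convex_ball _ _, i.2, hG, fun q' hq' => hi hq'⟩
  have hgrid : ∀ k < N, (k / N : ℝ) ∈ Icc (0 : ℝ) 1 := fun k hk => by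
    refine ⟨by positivity, (div_le_one hN).2 ?_⟩
    exact_mod_cast hk.le
  have hstep : ∀ k : ℕ, ((k + 1 : ℕ) / N : ℝ) - k / N = 1 / N := fun k => by
    push_cast
    ring
  have hnn : (N : ℝ) / N = 1 := div_self hN.ne'
  have hd1 : ∀ k : ℕ, dist ((k + 1 : ℕ) / N : ℝ) (k / N) < δ := fun k => by
    rw [Real.dist_eq, hstep, abs_of_pos (by positivity)]
    exact hN'
  -- The homotopy is only continuous, so straight chords between images of grid points replace the
  -- images of grid edges. The left, right and top edges of the grid all sit at the base point.
  have hgridsum : ∑ i ∈ Finset.range N, segmentIntegral F (K (0, (i : ℕ) / N))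
      (K (0, (i + 1 : ℕ) / N)) = 0 := by
    have h0 : ((0 : ℕ) / N : ℝ) = 0 := by simp
    have key := sum_grid_eq_zero (N := N)
      (e₁ := fun i j => segmentIntegral F (K (j / N, i / N)) (K (j / N, (i + 1 : ℕ) / N)))
      (e₂ := fun i j => segmentIntegral F (K (j / N, i / N)) (K ((j + 1 : ℕ) / N, i / N)))
      (fun i hi j hj => by
        obtain ⟨B, G, hB, hBU, hG, hKB⟩ := hprim (j / N, i / N) ⟨hgrid j hj, hgrid i hi⟩
        have m00 := hKB (j / N, i / N) (by rw [dist_self]; exact hδ)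
        have m01 := hKB (j / N, (i + 1 : ℕ) / N) (by
          rw [Prod.dist_eq]; exact max_lt (by rw [dist_self]; exact hδ) (hd1 i))
        have m10 := hKB ((j + 1 : ℕ) / N, i / N) (by
          rw [Prod.dist_eq]; exact max_lt (hd1 j) (by rw [dist_self]; exact hδ))
        have m11 := hKB ((j + 1 : ℕ) / N, (i + 1 : ℕ) / N) (by
          rw [Prod.dist_eq]; exact max_lt (hd1 j) (hd1 i))
        have hcB := hF.continuousOn.mono hBU
        rw [segmentIntegral_eq_sub hB hcB hG m00 m01, segmentIntegral_eq_sub hB hcB hG m01 m11,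
          segmentIntegral_eq_sub hB hcB hG m00 m10, segmentIntegral_eq_sub hB hcB hG m10 m11]
        ring)
      (fun j _ => by simp only [h0, hKl, segmentIntegral_self])
      (fun j _ => by simp only [hnn, hKr, segmentIntegral_self])
      (fun i _ => by simp only [hnn, hK1, segmentIntegral_self])
    simpa only [h0] using key
  have hcont : Continuous fun s : ℝ => (γ.extend s : ℂ) := by
    have := γ.continuous_extend
    fun_prop
  have hint := hc.intervalIntegrable (φ := fun s => F (γ.extend s : ℂ))
    (hF.continuousOn.comp_continuous hcont fun s => (γ.extend s).2)
  obtain ⟨S, hS, hSd⟩ := hc.exists_countable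
  have hmono : ∀ k < N, uIcc ((k : ℕ) / N : ℝ) ((k + 1 : ℕ) / N) ⊆ uIcc 0 1 := fun k hk => by
    have h1 := hgrid k hk
    have h2 : ((k + 1 : ℕ) / N : ℝ) ∈ Icc (0 : ℝ) 1 := by
      refine ⟨by positivity, (div_le_one hN).2 ?_⟩
      exact_mod_cast hk
    rw [uIcc_of_le zero_le_one]
    exact uIcc_subset_Icc h1 h2
  have hpiece : ∀ k < N, ∫ s in ((k : ℕ) / N : ℝ)..((k + 1 : ℕ) / N),
      F (γ.extend s : ℂ) * deriv (fun r : ℝ => (γ.extend r : ℂ)) s =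
      segmentIntegral F (K (0, (k : ℕ) / N)) (K (0, (k + 1 : ℕ) / N)) := by
    intro k hk
    obtain ⟨B, G, hB, hBU, hG, hKB⟩ :=
      hprim (0, k / N) ⟨⟨le_rfl, zero_le_one⟩, hgrid k hk⟩
    have hle : (k / N : ℝ) ≤ (k + 1 : ℕ) / N := by
      have := hstep k
      have : 0 < 1 / (N : ℝ) := by positivity
      linarith
    have hmem : ∀ s ∈ Icc (k / N : ℝ) ((k + 1 : ℕ) / N), (γ.extend s : ℂ) ∈ B := by
      intro s hs
      rw [← hK0]
      refine hKB _ ?_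
      rw [Prod.dist_eq]
      refine max_lt (by rw [dist_self]; exact hδ) ?_
      rw [Real.dist_eq, abs_of_nonneg (by linarith [hs.1])]
      have := hstep k
      linarith [hs.2]
    rw [segmentIntegral_eq_sub hB (hF.continuousOn.mono hBU) hG
      (by rw [hK0]; exact hmem _ (left_mem_Icc.2 hle))
      (by rw [hK0]; exact hmem _ (right_mem_Icc.2 hle)), hK0, hK0]
    -- A piece of the loop inside a ball has the same integral as its chord; the countably many
    -- break points are harmless.
    refine MeasureTheory.integral_eq_of_hasDerivAt_off_countable_of_le
      (fun s => G (γ.extend s : ℂ)) _ hle hS (fun s hs => ?_) (fun s hs => ?_)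
      (hint.mono_set (hmono k hk))
    · exact ((hG _ (hmem s hs)).continuousAt.comp
        (f := fun s => (γ.extend s : ℂ)) hcont.continuousAt).continuousWithinAt
    · have hs' : s ∈ Ioo (0 : ℝ) 1 := by
        have h1 := hgrid k hk
        have h2 := hmono k hk right_mem_uIcc
        rw [uIcc_of_le zero_le_one] at h2
        exact ⟨lt_of_le_of_lt h1.1 hs.1.1, lt_of_lt_of_le hs.1.2 h2.2⟩
      have hd := (hSd s ⟨hs', hs.2⟩).hasDerivAt
      have := (hG _ (hmem s (Ioo_subset_Icc_self hs.1))).comp_of_eq s hd rfl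
      exact this
  have hsum := intervalIntegral.sum_integral_adjacent_intervals (n := N)
    (a := fun k : ℕ => (k / N : ℝ))
    (f := fun s => F (γ.extend s : ℂ) * deriv (fun r : ℝ => (γ.extend r : ℂ)) s)
    (fun k hk => hint.mono_set (hmono k hk))
  simp only [Nat.cast_zero, zero_div, hnn] at hsum
  rw [← hsum, ← hgridsum]
  exact Finset.sum_congr rfl fun k hk => hpiece k (Finset.mem_range.1 hk)

/-! ### Finite parts. -/

/-- `L` is the constant term of `G(e + ε d)` as `ε → 0⁺`, apart from terms in `ε^{-1-1/p}` and
`ε^{-1/p}`. -/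
def HasCornerValue (p : ℕ) (G : ℂ → ℂ) (e d L : ℂ) : Prop :=
  ∃ c₁ c₂ : ℂ, Tendsto
    (fun ε : ℝ => G (e + ε * d) - c₁ * ((ε ^ (-1 - 1 / (p : ℝ)) : ℝ) : ℂ)
      - c₂ * ((ε ^ (-1 / (p : ℝ)) : ℝ) : ℂ)) (𝓝[>] 0) (𝓝 L)

lemma tendsto_rpow_zero {s : ℝ} (hs : 0 < s) :
    Tendsto (fun ε : ℝ => ((ε ^ s : ℝ) : ℂ)) (𝓝[>] 0) (𝓝 0) := by
  have h := (Real.continuousAt_rpow_const 0 s (Or.inr hs.le)).tendsto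
  rw [Real.zero_rpow hs.ne'] at h
  have := (Complex.continuous_ofReal.tendsto 0).comp (h.mono_left
    (nhdsWithin_le_nhds (s := Ioi 0)))
  rwa [Complex.ofReal_zero] at this

/-- The functions ε^{-1-1/p}, ε^{-1/p} and 1 have different orders at 0, so multiplying by ε^{1+1/p}
and then by ε^{1/p} forces the coefficients to agree one after the other. -/
lemma HasFPIntegral.unique {p : ℕ} (hp : 0 < p) {F : ℂ → ℂ} {a b L L' : ℂ}
    (h : HasFPIntegral p F a b L) (h' : HasFPIntegral p F a b L') : L = L' := by
  obtain ⟨c₁, c₂, hc⟩ := h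
  obtain ⟨d₁, d₂, hd⟩ := h'
  have hp' : (0 : ℝ) < 1 / p := by positivity
  have h1 : Tendsto (fun ε : ℝ => (d₁ - c₁) * ((ε ^ (-1 - 1 / (p : ℝ)) : ℝ) : ℂ)
      + (d₂ - c₂) * ((ε ^ (-1 / (p : ℝ)) : ℝ) : ℂ)) (𝓝[>] 0) (𝓝 (L - L')) :=
    (hc.sub hd).congr fun ε => by ring
  have e1 : ∀ ε : ℝ, 0 < ε → ((ε ^ (-1 - 1 / (p : ℝ)) : ℝ) : ℂ) * ((ε ^ (1 + 1 / (p : ℝ)) : ℝ) : ℂ)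
      = 1 := fun ε hε => by
    rw [← Complex.ofReal_mul, ← Real.rpow_add hε]
    norm_num
  have e2 : ∀ ε : ℝ, 0 < ε → ((ε ^ (-1 / (p : ℝ)) : ℝ) : ℂ) * ((ε ^ (1 + 1 / (p : ℝ)) : ℝ) : ℂ)
      = ((ε ^ (1 : ℝ) : ℝ) : ℂ) := fun ε hε => by
    rw [← Complex.ofReal_mul, ← Real.rpow_add hε]
    congr 2
    ring
  have e3 : ∀ ε : ℝ, 0 < ε → ((ε ^ (-1 / (p : ℝ)) : ℝ) : ℂ) * ((ε ^ (1 / (p : ℝ)) : ℝ) : ℂ)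
      = 1 := fun ε hε => by
    rw [← Complex.ofReal_mul, ← Real.rpow_add hε, neg_div, neg_add_cancel]
    norm_num
  have h2 : d₁ - c₁ = 0 := by
    have t1 := h1.mul (tendsto_rpow_zero (s := 1 + 1 / (p : ℝ)) (by positivity))
    have t2 : Tendsto (fun ε : ℝ => (d₁ - c₁) + (d₂ - c₂) * ((ε ^ (1 : ℝ) : ℝ) : ℂ)) (𝓝[>] 0)
        (𝓝 ((d₁ - c₁) + (d₂ - c₂) * 0)) :=
      tendsto_const_nhds.add ((tendsto_rpow_zero one_pos).const_mul _)
    have t3 := tendsto_nhds_unique (t1.congr' (by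
      filter_upwards [self_mem_nhdsWithin] with ε hε
      linear_combination (d₁ - c₁) * e1 ε hε + (d₂ - c₂) * e2 ε hε)) t2
    simpa using t3.symm
  rw [h2] at h1
  have h3 : d₂ - c₂ = 0 := by
    have t1 := h1.mul (tendsto_rpow_zero hp')
    have t2 : Tendsto (fun ε : ℝ => (d₂ - c₂)) (𝓝[>] (0 : ℝ)) (𝓝 (d₂ - c₂)) := tendsto_const_nhds
    have t3 := tendsto_nhds_unique (t1.congr' (by
      filter_upwards [self_mem_nhdsWithin] with ε hε
      linear_combination (d₂ - c₂) * e3 ε hε)) t2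
    simpa using t3.symm
  rw [h3] at h1
  simp only [zero_mul, add_zero] at h1
  exact (sub_eq_zero.1 (tendsto_nhds_unique h1 tendsto_const_nhds))

lemma HasFPIntegralVia.unique {p : ℕ} (hp : 0 < p) {F : ℂ → ℂ} {a w b L L' : ℂ}
    (h : HasFPIntegralVia p F a w b L) (h' : HasFPIntegralVia p F a w b L') : L = L' := by
  obtain ⟨L₁, L₂, h1, h2, rfl⟩ := h
  obtain ⟨M₁, M₂, k1, k2, rfl⟩ := h'
  rw [h1.unique hp k1, h2.unique hp k2]

/-- The substitution `t ↦ c - t` in a finite part integral. -/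
lemma HasFPIntegral.reflect {p : ℕ} {F F' : ℂ → ℂ} {c a b ρ L : ℂ}
    (h : HasFPIntegral p F' a b L)
    (hF : ∀ u ∈ Ioo (0 : ℝ) 1, F (c - (a + u * (b - a))) = -(ρ * F' (a + u * (b - a)))) :
    HasFPIntegral p F (c - a) (c - b) (ρ * L) := by
  obtain ⟨c₁, c₂, h⟩ := h
  refine ⟨ρ * c₁, ρ * c₂, (h.const_mul ρ).congr' ?_⟩
  filter_upwards [Ioo_mem_nhdsGT (show (0 : ℝ) < 1 / 2 by norm_num)] with ε hε
  rw [mul_sub, mul_sub, ← intervalIntegral.integral_const_mul, mul_assoc, mul_assoc]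
  congr 2
  refine intervalIntegral.integral_congr fun u hu => ?_
  rw [uIcc_of_le (by linarith [hε.2])] at hu
  have h1 := hF u ⟨lt_of_lt_of_le hε.1 hu.1, lt_of_le_of_lt hu.2 (by linarith [hε.1])⟩
  rw [show c - a + (u : ℂ) * (c - b - (c - a)) = c - (a + u * (b - a)) by ring, h1]
  ring

lemma HasFPIntegral.congr {p : ℕ} {F F' : ℂ → ℂ} {a b L : ℂ} (h : HasFPIntegral p F' a b L)
    (hF : ∀ u ∈ Ioo (0 : ℝ) 1, F (a + u * (b - a)) = F' (a + u * (b - a))) :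
    HasFPIntegral p F a b L := by
  obtain ⟨c₁, c₂, h⟩ := h
  refine ⟨c₁, c₂, h.congr' ?_⟩
  filter_upwards [Ioo_mem_nhdsGT (show (0 : ℝ) < 1 / 2 by norm_num)] with ε hε
  congr 2
  refine intervalIntegral.integral_congr fun u hu => ?_
  rw [uIcc_of_le (by linarith [hε.2])] at hu
  rw [hF u ⟨lt_of_lt_of_le hε.1 hu.1, lt_of_le_of_lt hu.2 (by linarith [hε.1])⟩]

lemma HasFPIntegral.const_mul {p : ℕ} {F : ℂ → ℂ} {a b L : ℂ} (h : HasFPIntegral p F a b L)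
    (ρ : ℂ) : HasFPIntegral p (fun t => ρ * F t) a b (ρ * L) := by
  obtain ⟨c₁, c₂, h⟩ := h
  refine ⟨ρ * c₁, ρ * c₂, (h.const_mul ρ).congr fun ε => ?_⟩
  rw [mul_sub, mul_sub, ← intervalIntegral.integral_const_mul]
  simp only [mul_assoc]

lemma hasCornerValue_of_continuousAt {G : ℂ → ℂ} {w : ℂ} (h : ContinuousAt G w) (p : ℕ) (d : ℂ) :
    HasCornerValue p G w d (G w) := by
  refine ⟨0, 0, ?_⟩
  simp only [zero_mul, sub_zero]
  have h1 : Tendsto (fun ε : ℝ => w + ε * d) (𝓝[>] 0) (𝓝 w) := by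
    have : Continuous fun ε : ℝ => w + ε * d := by fun_prop
    simpa using (this.tendsto 0).mono_left nhdsWithin_le_nhds
  exact h.tendsto.comp h1

/-- The fundamental theorem of calculus for finite parts. -/
lemma hasFPIntegral_of_hasCornerValue {p : ℕ} {F G : ℂ → ℂ} {a b La Lb : ℂ}
    (hF : ∀ u ∈ Ioo (0 : ℝ) 1, ContinuousAt F (a + u * (b - a)))
    (hG : ∀ u ∈ Ioo (0 : ℝ) 1, HasDerivAt G (F (a + u * (b - a))) (a + u * (b - a)))
    (ha : HasCornerValue p G a (b - a) La) (hb : HasCornerValue p G b (a - b) Lb) :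
    HasFPIntegral p F a b (Lb - La) := by
  obtain ⟨c₁, c₂, hc⟩ := ha
  obtain ⟨d₁, d₂, hd⟩ := hb
  refine ⟨d₁ - c₁, d₂ - c₂, (hd.sub hc).congr' ?_⟩
  filter_upwards [Ioo_mem_nhdsGT (show (0 : ℝ) < 1 / 2 by norm_num)] with ε hε
  have hmem : ∀ u ∈ uIcc ε (1 - ε), u ∈ Ioo (0 : ℝ) 1 := fun u hu => by
    rw [uIcc_of_le (by linarith [hε.2])] at hu
    exact ⟨lt_of_lt_of_le hε.1 hu.1, lt_of_le_of_lt hu.2 (by linarith [hε.1])⟩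
  rw [intervalIntegral.integral_eq_sub_of_hasDerivAt
    (f := fun u : ℝ => G (a + (u : ℂ) * (b - a)))
    (fun u hu => hasDerivAt_comp_line a b (hG u (hmem u hu)))
    (ContinuousOn.intervalIntegrable fun u hu => ?_)]
  · rw [show a + ((1 - ε : ℝ) : ℂ) * (b - a) = b + ε * (a - b) by push_cast; ring]
    ring
  · have h1 : ContinuousAt (fun u : ℝ => a + (u : ℂ) * (b - a)) u := by fun_prop
    exact ((ContinuousAt.comp (f := fun u : ℝ => a + (u : ℂ) * (b - a)) (hF u (hmem u hu)) h1).mul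
      continuousAt_const).continuousWithinAt

lemma finite_setOf_pow_eq {p : ℕ} (hp : 0 < p) (a : ℂ) : {x : ℂ | x ^ p = a}.Finite :=
  (Polynomial.nthRoots p a).toFinset.finite_toSet.subset fun x hx => by
    simpa [Polynomial.mem_nthRoots hp] using hx

/-- A continuous function one of whose powers is constant is constant. -/
lemma exists_eq_const_of_pow_eq {p : ℕ} (hp : 0 < p) {D : Set ℂ} (hD : IsPreconnected D)
    {φ : ℂ → ℂ} (hφ : ContinuousOn φ D) {a : ℂ} (h : ∀ t ∈ D, φ t ^ p = a) :
    ∃ c, ∀ t ∈ D, φ t = c := by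
  rcases D.eq_empty_or_nonempty with rfl | ⟨x, hx⟩
  · exact ⟨0, by simp⟩
  · exact ⟨φ x, fun t ht => hD.constant_of_mapsTo (finite_setOf_pow_eq hp a).isDiscrete hφ h ht hx⟩

/-- Two terms are enough: against (t-e)^{-2-1/p} the remainder leaves an integrable singularity of
order -1/p. -/
lemma exists_taylor_two {h : ℂ → ℂ} {e : ℂ} (hh : AnalyticAt ℂ h e) :
    ∃ (h₀ h₁ : ℂ) (h₂ : ℂ → ℂ), AnalyticAt ℂ h₂ e ∧
      ∀ t, h t = h₀ + h₁ * (t - e) + (t - e) ^ 2 * h₂ t := by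
  have hds : ∀ {h : ℂ → ℂ}, AnalyticAt ℂ h e → AnalyticAt ℂ (dslope h e) e :=
    fun ⟨_, hp⟩ => ⟨_, hp.has_fpower_series_dslope_fslope⟩
  refine ⟨h e, dslope h e e, dslope (dslope h e) e, hds (hds hh), fun t => ?_⟩
  have h1 := sub_smul_dslope h e t
  have h2 := sub_smul_dslope (dslope h e) e t
  simp only [smul_eq_mul] at h1 h2
  linear_combination -h1 - (t - e) * h2

/-! ### Primitives at a branch point. -/

section corner

variable {p : ℕ} {ρ e : ℂ}

/-- The branch of `(ρ (t - e))^{1/p}` on the half-plane where `ρ (t - e)` has positive real part. -/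
noncomputable def cornerRoot (p : ℕ) (ρ e t : ℂ) : ℂ := cexp (Complex.log (ρ * (t - e)) / p)

lemma cornerRoot_ne_zero (t : ℂ) : cornerRoot p ρ e t ≠ 0 := Complex.exp_ne_zero _

lemma cornerRoot_pow (hp : p ≠ 0) {t : ℂ} (ht : 0 < (ρ * (t - e)).re) :
    cornerRoot p ρ e t ^ p = ρ * (t - e) := by
  have h0 : ρ * (t - e) ≠ 0 := fun h => by simp [h] at ht
  rw [cornerRoot, ← Complex.exp_nat_mul, mul_div_cancel₀ _ (Nat.cast_ne_zero.2 hp),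
    Complex.exp_log h0]

lemma hasDerivAt_cornerRoot {t : ℂ} (ht : 0 < (ρ * (t - e)).re) :
    HasDerivAt (cornerRoot p ρ e) (cornerRoot p ρ e t / (p * (t - e))) t := by
  have h0 : ρ * (t - e) ≠ 0 := fun h => by simp [h] at ht
  have h1 : HasDerivAt (fun t => ρ * (t - e)) ρ t := by
    simpa using ((hasDerivAt_id t).sub_const e).const_mul ρ
  have h2 := ((h1.clog (Or.inl ht)).div_const (p : ℂ)).cexp
  refine h2.congr_deriv ?_
  rw [cornerRoot, div_mul_cancel_left₀ (left_ne_zero_of_mul h0), ← one_div, div_div,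
    mul_one_div, mul_comm (p : ℂ)]

/-- The principal logarithm is additive under scaling by a positive real. -/
lemma cornerRoot_ray {d : ℂ} (hd : ρ * d ≠ 0) {ε : ℝ} (hε : 0 < ε) :
    cornerRoot p ρ e (e + ε * d) = ((ε ^ (1 / (p : ℝ)) : ℝ) : ℂ) * cornerRoot p ρ e (e + d) := by
  rw [cornerRoot, cornerRoot, add_sub_cancel_left, add_sub_cancel_left,
    show ρ * (ε * d) = ε * (ρ * d) by ring, Complex.log_ofReal_mul hε hd,
    Real.rpow_def_of_pos hε, Complex.ofReal_exp, ← Complex.exp_add]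
  congr 1
  push_cast
  ring

/-- Near `e`, a determination of `((t - e) k(t))^{-1/p}` is an analytic multiple of the root of
`t - e`. -/
lemma exists_analyticAt_branch (hp : 0 < p) {D : Set ℂ} (hD : Convex ℝ D)
    (hρ : ∀ t ∈ D, 0 < (ρ * (t - e)).re) {g k : ℂ → ℂ} (hg : ContinuousOn g D)
    (hk : AnalyticAt ℂ k e) (hk0 : k e ≠ 0) (hgk : ∀ t ∈ D, g t ^ p * ((t - e) * k t) = 1) :
    ∃ m : ℂ → ℂ, AnalyticAt ℂ m e ∧ ∀ᶠ t in 𝓝 e, t ∈ D → g t = m t / cornerRoot p ρ e t := by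
  have a1 : AnalyticAt ℂ (fun t => k t / k e) e := hk.fun_div analyticAt_const hk0
  have h1 : k e / k e ∈ slitPlane := by rw [div_self hk0]; exact one_mem_slitPlane
  -- Dividing by k(e) puts the quotient near 1, where the principal logarithm is analytic. Then g ·
  -- `cornerRoot` / k₁ has constant p-th power, hence is constant near e inside D.
  set k₁ : ℂ → ℂ := fun t => cexp (-(Complex.log (k t / k e) / p)) with hk₁
  have a2 : AnalyticAt ℂ k₁ e := ((a1.clog h1).div analyticAt_const
    (Nat.cast_ne_zero.2 hp.ne')).neg.cexp
  have hev : ∀ᶠ t in 𝓝 e, ContinuousAt k₁ t ∧ k t ≠ 0 :=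
    (a2.eventually_analyticAt.mono fun t ht => ht.continuousAt).and
      (hk.continuousAt.eventually_ne hk0)
  obtain ⟨δ, hδ, hball⟩ := Metric.eventually_nhds_iff_ball.1 hev
  have hpow : ∀ t ∈ D ∩ Metric.ball e δ, (g t * cornerRoot p ρ e t / k₁ t) ^ p = ρ / k e := by
    intro t ht
    have hkt := (hball t ht.2).2
    have e1 : k₁ t ^ p = k e / k t := by
      rw [hk₁]
      simp only
      rw [← Complex.exp_nat_mul, mul_neg, mul_div_cancel₀ _ (Nat.cast_ne_zero.2 hp.ne'),
        Complex.exp_neg, Complex.exp_log (div_ne_zero hkt hk0), inv_div]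
    rw [div_pow, mul_pow, cornerRoot_pow hp.ne' (hρ t ht.1), e1]
    have := hgk t ht.1
    field_simp
    linear_combination ρ * this
  have hcont : ContinuousOn (fun t => g t * cornerRoot p ρ e t / k₁ t) (D ∩ Metric.ball e δ) := by
    intro t ht
    refine ((hg t ht.1).mono inter_subset_left).mul
      (hasDerivAt_cornerRoot (hρ t ht.1)).continuousAt.continuousWithinAt |>.div
        (hball t ht.2).1.continuousWithinAt (Complex.exp_ne_zero _)
  obtain ⟨c, hc⟩ := exists_eq_const_of_pow_eq hp
    (hD.inter (convex_ball e δ)).isPreconnected hcont hpow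
  refine ⟨fun t => c * k₁ t, analyticAt_const.mul a2, ?_⟩
  filter_upwards [Metric.ball_mem_nhds e hδ] with t ht htD
  rw [← hc t ⟨htD, ht⟩, div_mul_cancel₀ _ (Complex.exp_ne_zero _),
    mul_div_cancel_right₀ _ (cornerRoot_ne_zero t)]

/-- A primitive of `h(t) (t - e)^{-2-1/p}` has a corner value at `e`. -/
lemma exists_cornerValue_of_eq (hp : 2 ≤ p) {D : Set ℂ} (hD : Convex ℝ D) (ho : IsOpen D)
    (he : e ∈ closure D) (hρ0 : ρ ≠ 0) (hρ : ∀ t ∈ D, 0 < (ρ * (t - e)).re) {F G h : ℂ → ℂ}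
    (hh : AnalyticAt ℂ h e)
    (hF : ∀ᶠ t in 𝓝 e, t ∈ D → F t = h t / (cornerRoot p ρ e t * (t - e) ^ 2))
    (hG : ∀ w ∈ D, HasDerivAt G (F w) w) : ∃ L, ∀ w ∈ D, HasCornerValue p G e (w - e) L := by
  have hp0 : (p : ℂ) ≠ 0 := Nat.cast_ne_zero.2 (by lia)
  have hpr : (0 : ℝ) < p := by exact_mod_cast (by lia : 0 < p)
  have hp1 : (p : ℂ) + 1 ≠ 0 := by exact_mod_cast Nat.succ_ne_zero p
  obtain ⟨h₀, h₁, h₂, ha, hT⟩ := exists_taylor_two hh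
  -- In the variable v with v^p = ρ(t-e) the remainder h₂ dt / v becomes H dv. The exponent p-2 is
  -- where p ≥ 2 enters: H is analytic at v = 0.
  set H : ℂ → ℂ := fun v => p / ρ * v ^ (p - 2) * h₂ (e + v ^ p / ρ) with hH
  have haH : AnalyticAt ℂ H 0 := by
    have h3 : AnalyticAt ℂ (fun v : ℂ => e + v ^ p / ρ) 0 := by fun_prop (disch := assumption)
    have h4 : AnalyticAt ℂ (fun v : ℂ => h₂ (e + v ^ p / ρ)) 0 :=
      AnalyticAt.fun_comp (by simpa [show p ≠ 0 by lia] using ha) h3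
    exact (analyticAt_const.mul (analyticAt_id.pow _)).mul h4
  obtain ⟨r, hr, hball⟩ := Metric.eventually_nhds_iff_ball.1 haH.eventually_analyticAt
  obtain ⟨Φ, hΦ⟩ := exists_primitive (convex_ball (0 : ℂ) r) Metric.isOpen_ball
    (fun v hv => (hball v hv).differentiableAt.differentiableWithinAt)
  obtain ⟨δ, hδ, hFb⟩ := Metric.eventually_nhds_iff_ball.1 hF
  -- The second bound keeps the root V inside the disc of radius r on which the primitive Φ of H is
  -- available.
  set δ' := min δ (r ^ p / ‖ρ‖) with hδ'
  have hδ'0 : 0 < δ' := lt_min hδ (div_pos (pow_pos hr p) (norm_pos_iff.2 hρ0))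
  set B := D ∩ Metric.ball e δ' with hB
  have hBconv : Convex ℝ B := hD.inter (convex_ball e δ')
  have hBo : IsOpen B := ho.inter Metric.isOpen_ball
  set V := cornerRoot p ρ e with hV
  -- The derivatives of 1/(V(t-e)) and 1/V are -(1+1/p)/(V(t-e)²) and -1/(pV(t-e)); α and β match
  -- them with the first two Taylor terms.
  set α : ℂ := -(h₀ * p / (p + 1)) with hα
  set β : ℂ := -(h₁ * p) with hβ
  have hder : ∀ t ∈ B, HasDerivAt (fun t => G t - (α / (V t * (t - e)) + β / V t + Φ (V t))) 0 t := by
    intro t ht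
    have hre := hρ t ht.1
    have hte : t - e ≠ 0 := fun h => by simp [h] at hre
    have hV0 : V t ≠ 0 := cornerRoot_ne_zero t
    have hVp : V t ^ p = ρ * (t - e) := cornerRoot_pow (by lia) hre
    have hVd : HasDerivAt V (V t / (p * (t - e))) t := hasDerivAt_cornerRoot hre
    have hVr : V t ∈ Metric.ball (0 : ℂ) r := by
      rw [mem_ball_zero_iff]
      refine lt_of_pow_lt_pow_left₀ p hr.le ?_
      rw [← norm_pow, hVp, norm_mul]
      have h5 : ‖t - e‖ < r ^ p / ‖ρ‖ := by
        rw [← dist_eq_norm]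
        exact lt_of_lt_of_le ht.2 (min_le_right _ _)
      rw [lt_div_iff₀ (norm_pos_iff.2 hρ0)] at h5
      linarith
    have hte' : HasDerivAt (fun t : ℂ => t - e) 1 t := (hasDerivAt_id t).sub_const e
    have d1 := (hasDerivAt_const t α).fun_div (hVd.fun_mul hte') (mul_ne_zero hV0 hte)
    have d2 := (hasDerivAt_const t β).fun_div hVd hV0
    have d3 := HasDerivAt.comp t (hΦ (V t) hVr) hVd
    have d4 := (hG t ht.1).fun_sub ((d1.fun_add d2).fun_add d3)
    refine d4.congr_deriv ?_
    have hFt := hFb t (Metric.ball_subset_ball (min_le_left _ _) ht.2) ht.1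
    have hHV : H (V t) * V t = p * (t - e) * h₂ t / V t := by
      simp only [hH]
      rw [hVp, mul_div_cancel_left₀ _ hρ0, add_sub_cancel]
      have : V t ^ (p - 2) * V t * V t = ρ * (t - e) := by
        rw [← hVp, ← pow_succ, ← pow_succ]
        congr 1
        lia
      rw [eq_div_iff hV0]
      linear_combination (p / ρ * h₂ t) * this + p * (t - e) * h₂ t * div_self hρ0
    have hHV' : H (V t) * (V t / (p * (t - e))) = h₂ t / V t := by
      rw [← mul_div_assoc, hHV]
      field_simp
    rw [hFt, hHV', hT t, hα, hβ]
    field_simp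
    ring
  obtain ⟨L, hL⟩ : ∃ L, ∀ t ∈ B, G t - (α / (V t * (t - e)) + β / V t + Φ (V t)) = L :=
    hBo.exists_is_const_of_deriv_eq_zero hBconv.isPreconnected
      (fun t ht => (hder t ht).differentiableAt.differentiableWithinAt)
      (fun t ht => (hder t ht).deriv)
  refine ⟨L + Φ 0, fun w hw => ?_⟩
  set d := w - e with hd
  have hρd : ρ * d ≠ 0 := fun h => by
    have := hρ w hw
    rw [← hd, h] at this
    simp at this
  have hd0 : d ≠ 0 := right_ne_zero_of_mul hρd
  refine ⟨α / (V (e + d) * d), β / V (e + d), ?_⟩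
  have hlim : Tendsto (fun ε : ℝ => L + Φ (((ε ^ (1 / (p : ℝ)) : ℝ) : ℂ) * V (e + d))) (𝓝[>] 0)
      (𝓝 (L + Φ 0)) := by
    refine tendsto_const_nhds.add ?_
    have h6 := (tendsto_rpow_zero (s := 1 / (p : ℝ)) (by positivity)).mul_const (V (e + d))
    rw [zero_mul] at h6
    exact (hΦ 0 (Metric.mem_ball_self hr)).continuousAt.tendsto.comp h6
  refine hlim.congr' ?_
  have hray : ∀ᶠ ε : ℝ in 𝓝[>] 0, e + ε * d ∈ B := by
    have h7 : Tendsto (fun ε : ℝ => e + ε * d) (𝓝[>] 0) (𝓝 e) := by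
      have : Continuous fun ε : ℝ => e + ε * d := by fun_prop
      simpa using (this.tendsto 0).mono_left nhdsWithin_le_nhds
    filter_upwards [h7 (Metric.ball_mem_nhds e hδ'0),
      Ioc_mem_nhdsGT (show (0 : ℝ) < 1 by norm_num)] with ε h8 h9
    refine ⟨?_, h8⟩
    have := hD.add_smul_sub_mem_interior' he (by rwa [ho.interior_eq] : w ∈ interior D) h9
    rw [ho.interior_eq] at this
    exact this
  filter_upwards [hray, self_mem_nhdsWithin] with ε hε hε0
  have hε0' : (0 : ℝ) < ε := hε0
  have h10 := hL _ hε
  have hray := cornerRoot_ray (p := p) (e := e) hρd hε0'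
  rw [← hV] at hray
  rw [hray, add_sub_cancel_left] at h10
  have e1 : ((ε ^ (-1 - 1 / (p : ℝ)) : ℝ) : ℂ) = 1 / (((ε ^ (1 / (p : ℝ)) : ℝ) : ℂ) * ε) := by
    rw [Real.rpow_sub hε0', Real.rpow_neg_one]
    push_cast
    field_simp
  have e2 : ((ε ^ (-1 / (p : ℝ)) : ℝ) : ℂ) = 1 / ((ε ^ (1 / (p : ℝ)) : ℝ) : ℂ) := by
    rw [neg_div, Real.rpow_neg hε0'.le, Complex.ofReal_inv]
    exact (one_div _).symm
  have hx : ((ε ^ (1 / (p : ℝ)) : ℝ) : ℂ) ≠ 0 := by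
    exact_mod_cast (Real.rpow_pos_of_pos hε0' _).ne'
  have hεc : (ε : ℂ) ≠ 0 := by exact_mod_cast hε0'.ne'
  have hVd : V (e + d) ≠ 0 := cornerRoot_ne_zero _
  rw [e1, e2, ← h10]
  field_simp
  ring

/-- A primitive of `g(t) h(t) (t - e)^{-2}`, with `g` a determination of `((t - e) k(t))^{-1/p}`,
has a corner value at `e`. -/
lemma exists_cornerValue (hp : 2 ≤ p) {D : Set ℂ} (hD : Convex ℝ D) (ho : IsOpen D)
    (he : e ∈ closure D) (heD : e ∉ D) {F G g h k : ℂ → ℂ} (hg : ContinuousOn g D)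
    (hk : AnalyticAt ℂ k e) (hk0 : k e ≠ 0) (hgk : ∀ t ∈ D, g t ^ p * ((t - e) * k t) = 1)
    (hh : AnalyticAt ℂ h e) (hF : ∀ᶠ t in 𝓝[≠] e, F t = g t * h t / (t - e) ^ 2)
    (hG : ∀ w ∈ D, HasDerivAt G (F w) w) : ∃ L, ∀ w ∈ D, HasCornerValue p G e (w - e) L := by
  -- Separating e from the convex open set D gives a half-plane containing D with e on its boundary,
  -- and with it a single-valued root of t-e on D, with ρ = -φ(1).
  obtain ⟨φ, hφ⟩ := RCLike.geometric_hahn_banach_open_point (𝕜 := ℂ) hD ho heD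
  have hφ' : ∀ a : ℂ, φ a = φ 1 * a := fun a => by
    have := φ.map_smul a 1
    simpa [mul_comm] using this
  have hρ : ∀ t ∈ D, 0 < (-φ 1 * (t - e)).re := fun t ht => by
    have h1 := hφ t ht
    rw [hφ' t, hφ' e] at h1
    have : (-φ 1 * (t - e)) = φ 1 * e - φ 1 * t := by ring
    rw [this, Complex.sub_re]
    exact sub_pos.2 h1
  have hne : D.Nonempty := closure_nonempty_iff.1 ⟨e, he⟩
  have hρ0 : -φ 1 ≠ 0 := fun h => by
    obtain ⟨t, ht⟩ := hne
    have := hρ t ht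
    simp [h] at this
  obtain ⟨m, hm, hgm⟩ := exists_analyticAt_branch (by lia) hD hρ hg hk hk0 hgk
  refine exists_cornerValue_of_eq hp hD ho he hρ0 hρ (hm.mul hh) ?_ hG
  filter_upwards [hgm, eventually_nhdsWithin_iff.1 hF] with t h1 h2 htD
  rw [h2 (fun h => heD (h ▸ htD)), h1 htD]
  simp only [Pi.mul_apply]
  rw [← div_div]
  ring

end corner

/-- Rescaling ε only rescales the coefficients of pure powers; a logarithmic term would have shifted
the constant. -/
lemma HasCornerValue.smul {p : ℕ} {G : ℂ → ℂ} {e d L : ℂ} (h : HasCornerValue p G e d L) {r : ℝ}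
    (hr : 0 < r) : HasCornerValue p G e (r * d) L := by
  obtain ⟨c₁, c₂, h⟩ := h
  refine ⟨c₁ * ((r ^ (-1 - 1 / (p : ℝ)) : ℝ) : ℂ), c₂ * ((r ^ (-1 / (p : ℝ)) : ℝ) : ℂ), ?_⟩
  have h1 : Tendsto (fun ε : ℝ => r * ε) (𝓝[>] 0) (𝓝[>] 0) := by
    refine tendsto_nhdsWithin_iff.2 ⟨?_, ?_⟩
    · have : Continuous fun ε : ℝ => r * ε := by fun_prop
      simpa using (this.tendsto 0).mono_left (nhdsWithin_le_nhds (s := Ioi 0))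
    · filter_upwards [self_mem_nhdsWithin] with ε hε using mul_pos hr hε
  refine (h.comp h1).congr' ?_
  filter_upwards [self_mem_nhdsWithin] with ε hε
  have hε' : 0 < ε := hε
  simp only [Function.comp_apply]
  rw [Real.mul_rpow hr.le hε'.le, Real.mul_rpow hr.le hε'.le, Complex.ofReal_mul,
    Complex.ofReal_mul, Complex.ofReal_mul, mul_comm (r : ℂ), mul_assoc, mul_assoc c₁,
    mul_assoc c₂]

/-- The open segment from a point of the closure to a point of a convex open set lies in it. -/
lemma Convex.line_mem_of_mem_closure {D : Set ℂ} (hD : Convex ℝ D) (ho : IsOpen D) {e w : ℂ}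
    (he : e ∈ closure D) (hw : w ∈ D) {u : ℝ} (hu : u ∈ Ioc (0 : ℝ) 1) :
    e + (u : ℂ) * (w - e) ∈ D := by
  have := hD.add_smul_sub_mem_interior' he (by rwa [ho.interior_eq] : w ∈ interior D) hu
  rw [ho.interior_eq] at this
  exact this

lemma Convex.line_mem_of_mem_closure' {D : Set ℂ} (hD : Convex ℝ D) (ho : IsOpen D) {e w : ℂ}
    (he : e ∈ closure D) (hw : w ∈ D) {u : ℝ} (hu : u ∈ Ico (0 : ℝ) 1) :
    w + (u : ℂ) * (e - w) ∈ D := by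
  have := hD.line_mem_of_mem_closure ho he hw (u := 1 - u) ⟨by linarith [hu.2], by linarith [hu.1]⟩
  convert this using 1
  push_cast
  ring

/-! ### Branches on convex regions and their potentials. -/

/-- The finite part integrals of `F` through `D` between branch points are differences of `c`. -/
structure IsPotential (p : ℕ) (z τ : ℂ) (F : ℂ → ℂ) (D : Set ℂ) (c : ℂ → ℂ) : Prop where
  via : ∀ {a b : ℂ}, IsBranchPoint z τ a → IsBranchPoint z τ b → a ∈ closure D → b ∈ closure D →
    ∀ w ∈ D, HasFPIntegralVia p F a w b (c b - c a)
  straight : ∀ {a b : ℂ}, IsBranchPoint z τ a → IsBranchPoint z τ b → a ∈ closure D →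
    b ∈ closure D → (∀ u ∈ Ioo (0 : ℝ) 1, a + (u : ℂ) * (b - a) ∈ D) →
    HasFPIntegral p F a b (c b - c a)

/-- `g` is a holomorphic determination of `E(t)^{-1/p} E(z + t)^{-1/p}` on `D`. -/
structure IsBranchOn (p : ℕ) (z τ : ℂ) (D : Set ℂ) (g : ℂ → ℂ) : Prop where
  differentiableOn : DifferentiableOn ℂ g D
  pow_mul : ∀ t ∈ D, g t ^ p * primeProd z τ t = 1

namespace IsBranchOn

variable {p : ℕ} {z τ : ℂ} {D : Set ℂ} {g g' : ℂ → ℂ}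

lemma mono {D' : Set ℂ} (h : IsBranchOn p z τ D g) (hD : D' ⊆ D) : IsBranchOn p z τ D' g :=
  ⟨h.differentiableOn.mono hD, fun t ht => h.pow_mul t (hD ht)⟩

lemma primeProd_ne_zero (h : IsBranchOn p z τ D g) {t : ℂ} (ht : t ∈ D) : primeProd z τ t ≠ 0 :=
  fun h0 => by simpa [h0] using h.pow_mul t ht

lemma ne_zero (hp : p ≠ 0) (h : IsBranchOn p z τ D g) {t : ℂ} (ht : t ∈ D) : g t ≠ 0 :=
  fun h0 => by simpa [h0, hp] using h.pow_mul t ht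

lemma const_mul (h : IsBranchOn p z τ D g) {r : ℂ} (hr : r ^ p = 1) :
    IsBranchOn p z τ D fun t => r * g t :=
  ⟨h.differentiableOn.const_mul r, fun t ht => by rw [mul_pow, hr, one_mul, h.pow_mul t ht]⟩

lemma exists_eq_mul (hp : p ≠ 0) (hD : IsPreconnected D) (h : IsBranchOn p z τ D g)
    (h' : IsBranchOn p z τ D g') : ∃ r, ∀ t ∈ D, g t = r * g' t := by
  obtain ⟨r, hr⟩ := exists_eq_const_of_pow_eq (φ := fun t => g t / g' t) (a := 1)
    (Nat.pos_of_ne_zero hp) hD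
    (h.differentiableOn.continuousOn.div h'.differentiableOn.continuousOn
      fun t ht => h'.ne_zero hp ht)
    (fun t ht => by
      have h1 := h.pow_mul t ht
      have h2 := h'.pow_mul t ht
      rw [div_pow, div_eq_one_iff_eq (pow_ne_zero _ (h'.ne_zero hp ht))]
      exact mul_right_cancel₀ (h.primeProd_ne_zero ht) (h1.trans h2.symm))
  exact ⟨r, fun t ht => by rw [← hr t ht, div_mul_cancel₀ _ (h'.ne_zero hp ht)]⟩

/-- Two determinations which are proportional at a point are proportional. -/
lemma eq_mul_of_eq (hp : p ≠ 0) (hD : IsPreconnected D) (h : IsBranchOn p z τ D g)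
    (h' : IsBranchOn p z τ D g') {r w : ℂ} (hw : w ∈ D) (hr : g w = r * g' w) :
    ∀ t ∈ D, g t = r * g' t := by
  obtain ⟨s, hs⟩ := h.exists_eq_mul hp hD h'
  have : s = r := mul_right_cancel₀ (h'.ne_zero hp hw) ((hs w hw).symm.trans hr)
  exact this ▸ hs

lemma pow_eq_one (h : IsBranchOn p z τ D g) (h' : IsBranchOn p z τ D g') {r w : ℂ} (hw : w ∈ D)
    (hr : g w = r * g' w) : r ^ p = 1 := by
  have h1 := h.pow_mul w hw
  rwa [hr, mul_pow, mul_assoc, h'.pow_mul w hw, mul_one] at h1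

end IsBranchOn

/-- A primitive of the logarithmic derivative is a logarithm up to a constant c; dividing by -p and
exponentiating gives the root. -/
lemma exists_isBranchOn {p : ℕ} (hp : p ≠ 0) {z τ : ℂ} (hτ : 0 < τ.im) {D : Set ℂ}
    (hD : Convex ℝ D) (ho : IsOpen D) (h : ∀ t ∈ D, primeProd z τ t ≠ 0) :
    ∃ g, IsBranchOn p z τ D g := by
  rcases D.eq_empty_or_nonempty with rfl | ⟨w, hw⟩
  · exact ⟨0, by simp [differentiableOn_empty], by simp⟩
  have hd := differentiable_primeProd (z := z) hτ
  obtain ⟨G, hG⟩ := exists_primitive hD ho (F := fun t => deriv (primeProd z τ) t / primeProd z τ t)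
    ((hd.deriv.differentiableOn).fun_div hd.differentiableOn h)
  have hder : ∀ t ∈ D, HasDerivAt (fun t => primeProd z τ t * cexp (-G t)) 0 t := fun t ht => by
    refine ((hd t).hasDerivAt.fun_mul (hG t ht).fun_neg.cexp).congr_deriv ?_
    field_simp [h t ht]
    ring
  obtain ⟨c, hc⟩ := ho.exists_is_const_of_deriv_eq_zero hD.isPreconnected
    (fun t ht => (hder t ht).differentiableAt.differentiableWithinAt)
    (fun t ht => (hder t ht).deriv)
  have hc0 : c ≠ 0 := by
    rw [← hc w hw]
    exact mul_ne_zero (h w hw) (Complex.exp_ne_zero _)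
  have hpc : (p : ℂ) ≠ 0 := Nat.cast_ne_zero.2 hp
  refine ⟨fun t => cexp (-(Complex.log c + G t) / p), ?_, fun t ht => ?_⟩
  · intro t ht
    have := (hG t ht).differentiableAt
    exact DifferentiableAt.differentiableWithinAt (by fun_prop)
  · rw [← Complex.exp_nat_mul, mul_div_cancel₀ _ hpc, neg_add, Complex.exp_add, Complex.exp_neg,
      Complex.exp_log hc0, mul_assoc, mul_comm (cexp _), hc t ht, inv_mul_cancel₀ hc0]

section potential

variable {p : ℕ} {z τ κ : ℂ} {D : Set ℂ} {g : ℂ → ℂ}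

lemma IsBranchOn.differentiableOn_omega (hp : p ≠ 0) (hτ : 0 < τ.im) (h : IsBranchOn p z τ D g)
    (μ : ℤ) : DifferentiableOn ℂ (omega p z τ κ g μ) D := by
  intro t ht
  have hT : 0 < (2 * p * τ : ℂ).im := by
    have : (2 * p * τ : ℂ) = ((2 * p : ℝ) : ℂ) * τ := by push_cast; ring
    rw [this, Complex.im_ofReal_mul]
    have : (0 : ℝ) < p := by exact_mod_cast Nat.pos_of_ne_zero hp
    positivity
  have h1 := differentiable_thetaChar hT ((μ : ℂ) / (2 * p))
  have h2 := (analyticAt_pForm hτ (h.primeProd_ne_zero ht)).differentiableAt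
  have h3 : Differentiable ℂ fun t => thetaChar ((μ : ℂ) / (2 * p)) (-z - 2 * t) (2 * p * τ) :=
    h1.comp (g := fun x => thetaChar ((μ : ℂ) / (2 * p)) x (2 * p * τ)) (f := fun t => -z - 2 * t)
      (by fun_prop)
  have h4 : omega p z τ κ g μ = fun t => 1 / ModularForm.eta τ ^ 3 * κ *
      thetaChar ((μ : ℂ) / (2 * p)) (-z - 2 * t) (2 * p * τ) * g t * pForm z τ t :=
    funext fun t => omega_eq p z τ κ g μ t
  rw [h4]
  exact (((h3 t).const_mul _).differentiableWithinAt.mul (h.differentiableOn t ht)).mul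
    h2.differentiableWithinAt

/-- The potential at e is the constant term at e of one primitive G. On a broken line the values of
G at the intermediate point w cancel, so the result does not depend on w. -/
theorem IsBranchOn.exists_isPotential (hp : 2 ≤ p) (hτ : 0 < τ.im)
    (h0 : deriv (fun y => theta1 y τ) 0 ≠ 0) (hz : ∀ m n : ℤ, z ≠ m + n * τ) (hD : Convex ℝ D)
    (ho : IsOpen D) (h : IsBranchOn p z τ D g) (μ : ℤ) :
    ∃ c, IsPotential p z τ (omega p z τ κ g μ) D c := by
  have hp0 : p ≠ 0 := by lia
  have hω := h.differentiableOn_omega (κ := κ) hp0 hτ μ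
  obtain ⟨G, hG⟩ := exists_primitive hD ho hω
  have hcorner : ∀ e, ∃ L, IsBranchPoint z τ e → e ∈ closure D →
      ∀ w ∈ D, HasCornerValue p G e (w - e) L := by
    intro e
    by_cases he : IsBranchPoint z τ e ∧ e ∈ closure D
    · obtain ⟨k, m, hk, hk0, hm, hkN, hmW⟩ := he.1.exists_local hτ h0 hz
      have heD : e ∉ D := fun h' => h.primeProd_ne_zero h' he.1.primeProd_eq_zero
      have hT : 0 < (2 * p * τ : ℂ).im := by
        have : (2 * p * τ : ℂ) = ((2 * p : ℝ) : ℂ) * τ := by push_cast; ring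
        rw [this, Complex.im_ofReal_mul]
        have : (0 : ℝ) < p := by exact_mod_cast Nat.pos_of_ne_zero hp0
        positivity
      have h3 : Differentiable ℂ fun t =>
          thetaChar ((μ : ℂ) / (2 * p)) (-z - 2 * t) (2 * p * τ) :=
        (differentiable_thetaChar hT ((μ : ℂ) / (2 * p))).comp
          (g := fun x => thetaChar ((μ : ℂ) / (2 * p)) x (2 * p * τ)) (f := fun t => -z - 2 * t)
          (by fun_prop)
      obtain ⟨L, hL⟩ := exists_cornerValue hp hD ho he.2 heD h.differentiableOn.continuousOn hk hk0
        (fun t ht => by rw [← hkN t, h.pow_mul t ht])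
        (((analyticAt_const (v := 1 / ModularForm.eta τ ^ 3 * κ)).mul (h3.analyticAt e)).mul hm)
        (F := omega p z τ κ g μ) (by
          filter_upwards [hmW] with t ht
          rw [omega_eq, ht]
          simp only [Pi.mul_apply]
          ring) hG
      exact ⟨L, fun _ _ => hL⟩
    · exact ⟨0, fun h1 h2 => absurd ⟨h1, h2⟩ he⟩
  choose c hc using hcorner
  have hcont : ∀ t ∈ D, ContinuousAt (omega p z τ κ g μ) t := fun t ht =>
    (hω.differentiableAt (ho.mem_nhds ht)).continuousAt
  refine ⟨c, fun {a b} ha hb haD hbD w hw => ⟨G w - c a, c b - G w, ?_, ?_, by ring⟩,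
    fun {a b} ha hb haD hbD hab => ?_⟩
  · have hm : ∀ u ∈ Ioo (0 : ℝ) 1, a + (u : ℂ) * (w - a) ∈ D := fun u hu =>
      hD.line_mem_of_mem_closure ho haD hw ⟨hu.1, hu.2.le⟩
    exact hasFPIntegral_of_hasCornerValue (fun u hu => hcont _ (hm u hu))
      (fun u hu => hG _ (hm u hu)) (hc a ha haD w hw)
      (hasCornerValue_of_continuousAt (hG w hw).continuousAt _ _)
  · have hm : ∀ u ∈ Ioo (0 : ℝ) 1, w + (u : ℂ) * (b - w) ∈ D := fun u hu =>
      hD.line_mem_of_mem_closure' ho hbD hw ⟨hu.1.le, hu.2⟩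
    exact hasFPIntegral_of_hasCornerValue (fun u hu => hcont _ (hm u hu))
      (fun u hu => hG _ (hm u hu)) (hasCornerValue_of_continuousAt (hG w hw).continuousAt _ _)
      (hc b hb hbD w hw)
  -- Constant terms are known only towards points of D, and b is not one of them. The midpoint gives
  -- half of the direction, and rescaling by 2 restores it.
  · have hmid := hab (1 / 2) ⟨by norm_num, by norm_num⟩
    have h1 := (hc a ha haD _ hmid).smul (show (0 : ℝ) < 2 by norm_num)
    have h2 := (hc b hb hbD _ hmid).smul (show (0 : ℝ) < 2 by norm_num)
    push_cast at h1 h2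
    rw [show (2 : ℂ) * (a + 1 / 2 * (b - a) - a) = b - a by ring] at h1
    rw [show (2 : ℂ) * (a + 1 / 2 * (b - a) - b) = a - b by ring] at h2
    exact hasFPIntegral_of_hasCornerValue (fun u hu => hcont _ (hab u hu))
      (fun u hu => hG _ (hab u hu)) h1 h2

end potential

namespace IsPotential

variable {p : ℕ} {z τ : ℂ} {D₁ D₂ : Set ℂ} {F₁ F₂ c₁ c₂ : ℂ → ℂ}

/-- Comparison of potentials on overlapping domains. -/
lemma sub_eq_of_inter (hp : 0 < p) (h₁ : IsPotential p z τ F₁ D₁ c₁)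
    (h₂ : IsPotential p z τ F₂ D₂ c₂) (hD₁ : Convex ℝ D₁) (ho₁ : IsOpen D₁) (hD₂ : Convex ℝ D₂)
    (ho₂ : IsOpen D₂) {ρ w : ℂ} (hw : w ∈ D₁ ∩ D₂) (hF : ∀ t ∈ D₁ ∩ D₂, F₁ t = ρ * F₂ t) {a b : ℂ}
    (ha : IsBranchPoint z τ a) (hb : IsBranchPoint z τ b) (ha₁ : a ∈ closure D₁)
    (ha₂ : a ∈ closure D₂) (hb₁ : b ∈ closure D₁) (hb₂ : b ∈ closure D₂) :
    c₁ b - c₁ a = ρ * (c₂ b - c₂ a) := by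
  have hv := h₁.via ha hb ha₁ hb₁ w hw.1
  obtain ⟨L, M, hL, hM, hLM⟩ := h₂.via ha hb ha₂ hb₂ w hw.2
  refine hv.unique hp ⟨ρ * L, ρ * M, (hL.const_mul ρ).congr fun u hu => hF _ ⟨?_, ?_⟩,
    (hM.const_mul ρ).congr fun u hu => hF _ ⟨?_, ?_⟩, by rw [hLM, mul_add]⟩
  · exact hD₁.line_mem_of_mem_closure ho₁ ha₁ hw.1 ⟨hu.1, hu.2.le⟩
  · exact hD₂.line_mem_of_mem_closure ho₂ ha₂ hw.2 ⟨hu.1, hu.2.le⟩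
  · exact hD₁.line_mem_of_mem_closure' ho₁ hb₁ hw.1 ⟨hu.1.le, hu.2⟩
  · exact hD₂.line_mem_of_mem_closure' ho₂ hb₂ hw.2 ⟨hu.1.le, hu.2⟩

/-- Comparison of potentials under the point reflection `t ↦ s - t`. -/
lemma sub_eq_of_reflect (hp : 0 < p) (h₁ : IsPotential p z τ F₁ D₁ c₁)
    (h₂ : IsPotential p z τ F₂ D₂ c₂) (hD₁ : Convex ℝ D₁) (ho₁ : IsOpen D₁) (hD₂ : Convex ℝ D₂)
    (ho₂ : IsOpen D₂) {ρ s w : ℂ} (hw₁ : s - w ∈ D₁) (hw₂ : w ∈ D₂)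
    (hF : ∀ t ∈ D₂, s - t ∈ D₁ → F₁ (s - t) = -(ρ * F₂ t)) {a b : ℂ}
    (ha : IsBranchPoint z τ a) (hb : IsBranchPoint z τ b) (ha' : IsBranchPoint z τ (s - a))
    (hb' : IsBranchPoint z τ (s - b)) (ha₁ : s - a ∈ closure D₁)
    (ha₂ : a ∈ closure D₂) (hb₁ : s - b ∈ closure D₁) (hb₂ : b ∈ closure D₂) :
    c₁ (s - b) - c₁ (s - a) = ρ * (c₂ b - c₂ a) := by
  have hv := h₁.via ha' hb' ha₁ hb₁ (s - w) hw₁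
  obtain ⟨L, M, hL, hM, hLM⟩ := h₂.via ha hb ha₂ hb₂ w hw₂
  refine hv.unique hp ⟨ρ * L, ρ * M, hL.reflect fun u hu => hF _ ?_ ?_,
    hM.reflect fun u hu => hF _ ?_ ?_, by rw [hLM, mul_add]⟩
  · exact hD₂.line_mem_of_mem_closure ho₂ ha₂ hw₂ ⟨hu.1, hu.2.le⟩
  · rw [show s - (a + u * (w - a)) = (s - a) + u * ((s - w) - (s - a)) by ring]
    exact hD₁.line_mem_of_mem_closure ho₁ ha₁ hw₁ ⟨hu.1, hu.2.le⟩
  · exact hD₂.line_mem_of_mem_closure' ho₂ hb₂ hw₂ ⟨hu.1.le, hu.2⟩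
  · rw [show s - (w + u * (b - w)) = (s - w) + u * ((s - b) - (s - w)) by ring]
    exact hD₁.line_mem_of_mem_closure' ho₁ hb₁ hw₁ ⟨hu.1.le, hu.2⟩

end IsPotential

/-! ### Real coordinates and convex polygons. -/

/-- The second of the real coordinates `x`, `y` of `x + y τ`. -/
noncomputable def coordY (τ : ℂ) : ℂ →L[ℝ] ℝ := (τ.im)⁻¹ • Complex.imCLM

/-- The first of the real coordinates `x`, `y` of `x + y τ`. -/
noncomputable def coordX (τ : ℂ) : ℂ →L[ℝ] ℝ := Complex.reCLM - τ.re • coordY τ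

section coord

variable {τ : ℂ}

lemma coordY_ofReal (x : ℝ) : coordY τ x = 0 := by simp [coordY]

lemma coordX_ofReal (x : ℝ) : coordX τ x = x := by simp [coordX, coordY]

lemma coordY_ofReal_mul (hτ : 0 < τ.im) (y : ℝ) : coordY τ (y * τ) = y := by
  simp [coordY, mul_comm y, hτ.ne']

lemma coordX_ofReal_mul (hτ : 0 < τ.im) (y : ℝ) : coordX τ (y * τ) = 0 := by
  simp only [coordX, _root_.sub_apply, _root_.smul_apply,
    coordY_ofReal_mul hτ]
  simp [mul_comm]

lemma coordX_one : coordX τ 1 = 1 := by simpa using coordX_ofReal (τ := τ) 1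

lemma coordY_one : coordY τ 1 = 0 := by simpa using coordY_ofReal (τ := τ) 1

lemma coordX_self (hτ : 0 < τ.im) : coordX τ τ = 0 := by simpa using coordX_ofReal_mul hτ 1

lemma coordY_self (hτ : 0 < τ.im) : coordY τ τ = 1 := by simpa using coordY_ofReal_mul hτ 1

lemma coord_real_mul (x : ℝ) (t : ℂ) :
    coordX τ (x * t) = x * coordX τ t ∧ coordY τ (x * t) = x * coordY τ t := by
  rw [← Complex.real_smul, map_smul, map_smul]
  exact ⟨rfl, rfl⟩

lemma coordX_add_mul (hτ : 0 < τ.im) (x y : ℝ) : coordX τ (x + y * τ) = x := by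
  rw [map_add, coordX_ofReal, coordX_ofReal_mul hτ, add_zero]

lemma coordY_add_mul (hτ : 0 < τ.im) (x y : ℝ) : coordY τ (x + y * τ) = y := by
  rw [map_add, coordY_ofReal, coordY_ofReal_mul hτ, zero_add]

end coord

/-- The set where the affine functions `α x + β y + γ` with `(α, β, γ)` in `l` are positive. -/
def polygon (τ : ℂ) (l : List (ℝ × ℝ × ℝ)) : Set ℂ :=
  {t | ∀ h ∈ l, 0 < h.1 * coordX τ t + h.2.1 * coordY τ t + h.2.2}

section polygon

variable {τ : ℂ} {l : List (ℝ × ℝ × ℝ)}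

lemma isOpen_polygon : IsOpen (polygon τ l) := by
  have : polygon τ l = ⋂ h ∈ l.toFinset, {t | 0 < h.1 * coordX τ t + h.2.1 * coordY τ t + h.2.2} := by
    ext t
    simp [polygon]
  rw [this]
  exact isOpen_biInter_finset fun h _ => isOpen_lt continuous_const (by fun_prop)

lemma line_mem_polygon {e w : ℂ}
    (he : ∀ h ∈ l, 0 ≤ h.1 * coordX τ e + h.2.1 * coordY τ e + h.2.2) (hw : w ∈ polygon τ l) {u : ℝ}
    (hu : u ∈ Ioc (0 : ℝ) 1) : e + (u : ℂ) * (w - e) ∈ polygon τ l := by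
  intro h hh
  rw [map_add, map_add, (coord_real_mul _ _).1, (coord_real_mul _ _).2, map_sub, map_sub]
  have h1 := mul_nonneg (sub_nonneg.2 hu.2) (he h hh)
  have h2 := mul_pos hu.1 (hw h hh)
  linarith

lemma convex_polygon : Convex ℝ (polygon τ l) := by
  refine convex_iff_segment_subset.2 fun a ha b hb => ?_
  rintro _ ⟨s, u, hs, hu, hsu, rfl⟩
  rcases hu.eq_or_lt with rfl | hu
  · rw [add_zero] at hsu
    simpa [hsu] using ha
  · have := line_mem_polygon (fun h hh => (ha h hh).le) hb (u := u) ⟨hu, by linarith⟩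
    convert this using 1
    simp only [Complex.real_smul]
    have : (s : ℂ) = 1 - u := by rw [← Complex.ofReal_one, ← hsu]; push_cast; ring
    rw [this]
    ring

lemma mem_closure_polygon {e w : ℂ} (hw : w ∈ polygon τ l)
    (he : ∀ h ∈ l, 0 ≤ h.1 * coordX τ e + h.2.1 * coordY τ e + h.2.2) :
    e ∈ closure (polygon τ l) := by
  have h1 : Tendsto (fun u : ℝ => e + (u : ℂ) * (w - e)) (𝓝[>] 0) (𝓝 e) := by
    have : Continuous fun u : ℝ => e + (u : ℂ) * (w - e) := by fun_prop
    simpa using (this.tendsto 0).mono_left (nhdsWithin_le_nhds (s := Ioi 0))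
  refine mem_closure_of_tendsto h1 ?_
  filter_upwards [Ioc_mem_nhdsGT (show (0 : ℝ) < 1 by norm_num)] with u hu
    using line_mem_polygon he hw hu

/-- An affine function which is nonnegative on a set is positive in its interior. -/
lemma pos_of_mem_interior (hτ : 0 < τ.im) {S : Set ℂ} {α β γ : ℝ} (h0 : α ≠ 0 ∨ β ≠ 0)
    (hS : ∀ t ∈ S, 0 ≤ α * coordX τ t + β * coordY τ t + γ) {t : ℂ} (ht : t ∈ interior S) :
    0 < α * coordX τ t + β * coordY τ t + γ := by
  -- A small step against the gradient stays in S and lowers the value by u(α² + β²) > 0.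
  have h1 : Tendsto (fun u : ℝ => t - (u : ℂ) * (α + β * τ)) (𝓝[>] 0) (𝓝 t) := by
    have : Continuous fun u : ℝ => t - (u : ℂ) * (α + β * τ) := by fun_prop
    simpa using (this.tendsto 0).mono_left (nhdsWithin_le_nhds (s := Ioi 0))
  obtain ⟨u, hu, hu0⟩ := ((h1.eventually (mem_interior_iff_mem_nhds.1 ht)).and self_mem_nhdsWithin).exists
  have h2 := hS _ hu
  rw [map_sub, map_sub, (coord_real_mul _ _).1, (coord_real_mul _ _).2, coordX_add_mul hτ,
    coordY_add_mul hτ] at h2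
  have h3 : 0 < α ^ 2 + β ^ 2 := by
    rcases h0 with h | h <;> positivity
  have h4 := mul_pos (show 0 < u from hu0) h3
  linarith

end polygon

/-! ### Geometry of the cut plane. -/

section branchPoint

variable {z τ : ℂ} {p : ℕ}

lemma branchPoint_even (m j : ℤ) : branchPoint z τ m (2 * j) = m + j * τ := by
  simp [branchPoint]

lemma branchPoint_odd (m j : ℤ) : branchPoint z τ m (2 * j + 1) = m + j * τ - z := by
  have h1 : (2 * j + 1) / 2 = j := by lia
  have h2 : (2 * j + 1) % 2 = 1 := by lia
  simp [branchPoint, h1, h2]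

lemma one_sub_branchPoint (m k : ℤ) :
    1 - z - branchPoint z τ m k = branchPoint z τ (1 - m) (1 - k) := by
  obtain ⟨j, rfl | rfl⟩ := Int.even_or_odd' k
  · rw [branchPoint_even, show 1 - 2 * j = 2 * (-j) + 1 by ring, branchPoint_odd]
    push_cast
    ring
  · rw [branchPoint_odd, show 1 - (2 * j + 1) = 2 * (-j) by ring, branchPoint_even]
    push_cast
    ring

lemma tau_sub_branchPoint (m k : ℤ) :
    τ - z - branchPoint z τ m k = branchPoint z τ (-m) (3 - k) := by
  obtain ⟨j, rfl | rfl⟩ := Int.even_or_odd' k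
  · rw [branchPoint_even, show 3 - 2 * j = 2 * (1 - j) + 1 by ring, branchPoint_odd]
    push_cast
    ring
  · rw [branchPoint_odd, show 3 - (2 * j + 1) = 2 * (1 - j) by ring, branchPoint_even]
    push_cast
    ring

lemma sub_mem_segment {s t a b : ℂ} (h : s - t ∈ segment ℝ a b) :
    t ∈ segment ℝ (s - b) (s - a) := by
  obtain ⟨u, v, hu, hv, huv, h⟩ := h
  refine ⟨v, u, hv, hu, by rw [add_comm, huv], ?_⟩
  have huv' : (u : ℂ) + v = 1 := by exact_mod_cast huv
  simp only [Complex.real_smul] at h ⊢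
  linear_combination s * huv' - h

/-- Segment k of column m goes to segment -k of column 1-m, and k ≡ 1-2m is equivalent to -k ≡
1-2(1-m). -/
lemma one_sub_mem_cutPlane {t : ℂ} (ht : t ∈ cutPlane p z τ) : 1 - z - t ∈ cutPlane p z τ := by
  intro m k hk hs
  refine ht (1 - m) (-k) (fun h => hk ?_) ?_
  · have := h.neg
    rw [neg_neg] at this
    convert this using 1
    ring
  · have := sub_mem_segment hs
    rwa [one_sub_branchPoint, one_sub_branchPoint, show 1 - (k + 1) = -k by ring,
      show 1 - k = -k + 1 by ring] at this

/-- Segment k of column m goes to segment 2-k of column -m, and k ≡ 1-2m is equivalent to 2-k ≡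
1+2m. -/
lemma tau_sub_mem_cutPlane {t : ℂ} (ht : t ∈ cutPlane p z τ) : τ - z - t ∈ cutPlane p z τ := by
  intro m k hk hs
  refine ht (-m) (2 - k) (fun h => hk ?_) ?_
  · have := h.neg.add_left 2
    convert this using 1 <;> ring
  · have := sub_mem_segment hs
    rwa [tau_sub_branchPoint, tau_sub_branchPoint, show 3 - (k + 1) = 2 - k by ring,
      show 3 - k = 2 - k + 1 by ring] at this

variable {a b : ℝ}

lemma coordX_eq_of_neg_eq (hτ : 0 < τ.im) (hz : -z = a + b * τ) : coordX τ z = -a := by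
  rw [← neg_neg z, hz, map_neg, coordX_add_mul hτ]

lemma coordY_eq_of_neg_eq (hτ : 0 < τ.im) (hz : -z = a + b * τ) : coordY τ z = -b := by
  rw [← neg_neg z, hz, map_neg, coordY_add_mul hτ]

lemma coord_of_mem_segment (hτ : 0 < τ.im) (hz : -z = a + b * τ) {m k : ℤ} {t : ℂ}
    (ht : t ∈ segment ℝ (branchPoint z τ m k) (branchPoint z τ m (k + 1))) :
    ∃ s ∈ Icc (0 : ℝ) 1, ∃ j : ℤ,
      (k = 2 * j ∧ coordX τ t = m + s * a ∧ coordY τ t = j + s * b) ∨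
      (k = 2 * j + 1 ∧ coordX τ t = m + (1 - s) * a ∧ coordY τ t = j + b + s * (1 - b)) := by
  obtain ⟨v, s, hv, hs, hvs, rfl⟩ := ht
  obtain rfl : v = 1 - s := by linarith
  have hz' : z = -(a + b * τ) := by rw [← hz, neg_neg]
  refine ⟨s, ⟨hs, by linarith⟩, ?_⟩
  obtain ⟨j, rfl | rfl⟩ := Int.even_or_odd' k
  · refine ⟨j, Or.inl ⟨rfl, ?_⟩⟩
    have e : (1 - s) • branchPoint z τ m (2 * j) + s • branchPoint z τ m (2 * j + 1) =
        ((m + s * a : ℝ) : ℂ) + ((j + s * b : ℝ) : ℂ) * τ := by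
      rw [branchPoint_even, branchPoint_odd, hz']
      simp only [Complex.real_smul]
      push_cast
      ring
    rw [e]
    exact ⟨coordX_add_mul hτ _ _, coordY_add_mul hτ _ _⟩
  · refine ⟨j, Or.inr ⟨rfl, ?_⟩⟩
    have e : (1 - s) • branchPoint z τ m (2 * j + 1) + s • branchPoint z τ m (2 * j + 1 + 1) =
        ((m + (1 - s) * a : ℝ) : ℂ) + ((j + b + s * (1 - b) : ℝ) : ℂ) * τ := by
      rw [show 2 * j + 1 + 1 = 2 * (j + 1) by ring, branchPoint_even, branchPoint_odd, hz']
      simp only [Complex.real_smul]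
      push_cast
      ring
    rw [e]
    exact ⟨coordX_add_mul hτ _ _, coordY_add_mul hτ _ _⟩

/-- The cuts are locally finite: both coordinates vary by at most 1 along a cut, so near t only
finitely many pairs of indices matter, and each segment is closed. -/
theorem isOpen_cutPlane (hτ : 0 < τ.im) (hz : -z = a + b * τ) (ha : a ∈ Ioo (0 : ℝ) 1)
    (hb : b ∈ Ioo (0 : ℝ) 1) : IsOpen (cutPlane p z τ) := by
  refine isOpen_iff_mem_nhds.2 fun t ht => ?_
  set M := ⌈|coordX τ t|⌉ + 3
  set K := 2 * (⌈|coordY τ t|⌉ + 4)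
  have hX : ∀ᶠ s in 𝓝 t, |coordX τ s - coordX τ t| < 1 := by
    have : Continuous fun s => |coordX τ s - coordX τ t| := by fun_prop
    exact this.continuousAt.eventually_lt_const (by simp)
  have hY : ∀ᶠ s in 𝓝 t, |coordY τ s - coordY τ t| < 1 := by
    have : Continuous fun s => |coordY τ s - coordY τ t| := by fun_prop
    exact this.continuousAt.eventually_lt_const (by simp)
  have hfin : ∀ᶠ s in 𝓝 t, ∀ x ∈ Finset.Icc (-M) M ×ˢ Finset.Icc (-K) K,
      ¬ (x.2 ≡ 1 - 2 * x.1 [ZMOD p]) →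
        s ∉ segment ℝ (branchPoint z τ x.1 x.2) (branchPoint z τ x.1 (x.2 + 1)) := by
    refine (Filter.eventually_all_finset _).2 fun x _ => ?_
    by_cases hx : x.2 ≡ 1 - 2 * x.1 [ZMOD p]
    · simp [hx]
    · have hc : IsClosed (segment ℝ (branchPoint z τ x.1 x.2) (branchPoint z τ x.1 (x.2 + 1))) := by
        rw [← convexHull_pair]
        exact ((Set.toFinite _).isCompact_convexHull ℝ).isClosed
      filter_upwards [hc.isOpen_compl.mem_nhds (ht x.1 x.2 hx)] with s hs _ using hs
  filter_upwards [hX, hY, hfin] with s h1 h2 h3 m k hk hs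
  refine h3 (m, k) ?_ hk hs
  have hXc := Int.le_ceil |coordX τ t|
  have hYc := Int.le_ceil |coordY τ t|
  rw [abs_lt] at h1 h2
  have b1 := abs_le.1 (le_refl |coordX τ t|)
  have b2 := abs_le.1 (le_refl |coordY τ t|)
  obtain ⟨u, ⟨hu0, hu1⟩, j, ⟨rfl, hx, hy⟩ | ⟨rfl, hx, hy⟩⟩ := coord_of_mem_segment hτ hz hs
  · have n1 : 0 ≤ u * a := mul_nonneg hu0 ha.1.le
    have n2 : u * a ≤ 1 := mul_le_one₀ hu1 ha.1.le ha.2.le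
    have n3 : 0 ≤ u * b := mul_nonneg hu0 hb.1.le
    have n4 : u * b ≤ 1 := mul_le_one₀ hu1 hb.1.le hb.2.le
    have i1 : m ≤ ⌈|coordX τ t|⌉ + 3 := by
      exact_mod_cast (by linarith : (m : ℝ) ≤ ⌈|coordX τ t|⌉ + 3)
    have i2 : -⌈|coordX τ t|⌉ - 3 ≤ m := by
      exact_mod_cast (by linarith : -(⌈|coordX τ t|⌉ : ℝ) - 3 ≤ m)
    have i3 : j ≤ ⌈|coordY τ t|⌉ + 3 := by
      exact_mod_cast (by linarith : (j : ℝ) ≤ ⌈|coordY τ t|⌉ + 3)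
    have i4 : -⌈|coordY τ t|⌉ - 3 ≤ j := by
      exact_mod_cast (by linarith : -(⌈|coordY τ t|⌉ : ℝ) - 3 ≤ j)
    simp only [Finset.mem_product, Finset.mem_Icc, M, K]
    refine ⟨⟨?_, ?_⟩, ?_, ?_⟩ <;> linarith
  · have n1 : 0 ≤ (1 - u) * a := mul_nonneg (by linarith) ha.1.le
    have n2 : (1 - u) * a ≤ 1 := mul_le_one₀ (by linarith) ha.1.le ha.2.le
    have n3 : 0 ≤ u * (1 - b) := mul_nonneg hu0 (by linarith [hb.2])
    have n4 : u * (1 - b) ≤ 1 := mul_le_one₀ hu1 (by linarith [hb.2]) (by linarith [hb.1])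
    have i1 : m ≤ ⌈|coordX τ t|⌉ + 3 := by
      exact_mod_cast (by linarith : (m : ℝ) ≤ ⌈|coordX τ t|⌉ + 3)
    have i2 : -⌈|coordX τ t|⌉ - 3 ≤ m := by
      exact_mod_cast (by linarith : -(⌈|coordX τ t|⌉ : ℝ) - 3 ≤ m)
    have i3 : j ≤ ⌈|coordY τ t|⌉ + 3 := by
      exact_mod_cast (by linarith [hb.1] : (j : ℝ) ≤ ⌈|coordY τ t|⌉ + 3)
    have i4 : -⌈|coordY τ t|⌉ - 3 ≤ j := by
      exact_mod_cast (by linarith [hb.2] : -(⌈|coordY τ t|⌉ : ℝ) - 3 ≤ j)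
    simp only [Finset.mem_product, Finset.mem_Icc, M, K]
    refine ⟨⟨?_, ?_⟩, ?_, ?_⟩ <;> linarith

/-- Away from all segments between consecutive branch points of a column one is in the cut
plane. -/
lemma mem_cutPlane_of_forall (hτ : 0 < τ.im) (hz : -z = a + b * τ) {t : ℂ}
    (h : ∀ (m j : ℤ), ∀ s ∈ Icc (0 : ℝ) 1,
      ¬ (coordX τ t = m + s * a ∧ coordY τ t = j + s * b) ∧
      (coordX τ t = m + (1 - s) * a → coordY τ t = j + b + s * (1 - b) →
        2 * j + 1 ≡ 1 - 2 * m [ZMOD p])) :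
    t ∈ cutPlane p z τ := by
  intro m k hk hs
  obtain ⟨s, hs', j, ⟨rfl, hx, hy⟩ | ⟨rfl, hx, hy⟩⟩ := coord_of_mem_segment hτ hz hs
  · exact (h m j s hs').1 ⟨hx, hy⟩
  · exact hk ((h m j s hs').2 hx hy)

lemma int_trichotomy (m : ℤ) : (m : ℝ) ≤ -1 ∨ m = 0 ∨ (1 : ℝ) ≤ m := by
  rcases lt_trichotomy m 0 with h | h | h
  · exact Or.inl (by exact_mod_cast (by lia : m ≤ -1))
  · exact Or.inr (Or.inl h)
  · exact Or.inr (Or.inr (by exact_mod_cast h))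

end branchPoint

/-! ### The convex regions used for the contours. -/

section regions

variable (τ : ℂ) (a b : ℝ) (c : ℤ)

/-- The strip between the real axis and its parallel through `a + b τ`. -/
def strip : Set ℂ := polygon τ [(0, 1, 0), (0, -1, b)]

/-- The open parallelogram with vertices `c`, `c + 1`, `c + 1 + a + b τ`, `c + a + b τ`. -/
def lowerCell : Set ℂ :=
  polygon τ [(0, 1, 0), (0, -1, b), (b, -a, -b * c), (-b, a, b + b * c)]

/-- The open parallelogram with vertices `c + a + b τ`, `c + 1 + a + b τ`, `c + 1 + τ`, `c + τ`. -/
def upperCell : Set ℂ :=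
  polygon τ [(0, 1, -b), (0, -1, 1), (1 - b, a, -a - (1 - b) * c),
    (-(1 - b), -a, a + (1 - b) + (1 - b) * c)]

/-- The union of the upper cells for `c = -1` and `c = 0` and of the segment between them. -/
def doubleCell : Set ℂ :=
  polygon τ [(0, 1, -b), (0, -1, 1), (1 - b, a, -a + (1 - b)), (-(1 - b), -a, a + (1 - b))]

/-- A neighbourhood of the open segment from `0` to `1`. -/
def horizontalKite : Set ℂ :=
  polygon τ [(b, -a, 0), (1 - b, a, 0), (-b, a, b), (-(1 - b), -a, 1 - b), (0, 1, 1 - b),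
    (0, -1, b)]

/-- A neighbourhood of the open segment from `c` to `c + τ`. -/
def verticalKite : Set ℂ :=
  polygon τ [(0, 1, 0), (0, -1, 1), (1, 1 - a, -c), (1, -(1 - a), 1 - a - c), (-b, a, b * c),
    (-(1 - b), -a, a + (1 - b) * c)]

end regions

section cells

variable {τ z : ℂ} {a b : ℝ} {c : ℤ} {p : ℕ}

/-- The slanted coordinate bx - ay equals bm on the segment from m to m-z, and the cell asks for a
value strictly between bc and b(c+1). All other segments miss its range of heights. -/
lemma lowerCell_subset_cutPlane (hτ : 0 < τ.im) (hz : -z = a + b * τ) (ha : a ∈ Ioo (0 : ℝ) 1)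
    (hb : b ∈ Ioo (0 : ℝ) 1) : lowerCell τ a b c ⊆ cutPlane p z τ := by
  intro t ht
  obtain ⟨ha0, ha1⟩ := ha
  obtain ⟨hb0, hb1⟩ := hb
  simp only [lowerCell, polygon, List.forall_mem_cons, mem_ofPred_eq] at ht
  obtain ⟨h1, h2, h3, h4, -⟩ := ht
  refine mem_cutPlane_of_forall hτ hz fun m j s ⟨hs0, hs1⟩ => ⟨fun ⟨hx, hy⟩ => ?_, fun hx hy => ?_⟩
  · rw [hx, hy] at h1 h2 h3 h4
    have m1 := mul_nonneg hs0 hb0.le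
    have m2 := mul_nonneg (sub_nonneg.2 hs1) hb0.le
    rcases int_trichotomy j with hj | rfl | hj
    · linarith
    · have k1 : (0 : ℝ) < m - c := pos_of_mul_pos_right (a := b) (by push_cast at *; linarith) hb0.le
      have k2 : (m - c : ℝ) < 1 := by
        refine lt_of_mul_lt_mul_left (a := b) (by push_cast at *; linarith) hb0.le
      have k1' : 0 < m - c := by exact_mod_cast k1
      have k2' : m - c < 1 := by exact_mod_cast k2
      lia
    · linarith
  · exfalso
    rw [hx, hy] at h1 h2 h3 h4
    have m1 := mul_nonneg hs0 (sub_nonneg.2 hb1.le)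
    have m2 := mul_nonneg (sub_nonneg.2 hs1) (sub_nonneg.2 hb1.le)
    rcases int_trichotomy j with hj | rfl | hj
    · linarith
    · push_cast at *; linarith
    · linarith

lemma upperCell_subset_cutPlane (hτ : 0 < τ.im) (hz : -z = a + b * τ) (ha : a ∈ Ioo (0 : ℝ) 1)
    (hb : b ∈ Ioo (0 : ℝ) 1) : upperCell τ a b c ⊆ cutPlane p z τ := by
  intro t ht
  obtain ⟨ha0, ha1⟩ := ha
  obtain ⟨hb0, hb1⟩ := hb
  have hb1' := sub_pos.2 hb1
  simp only [upperCell, polygon, List.forall_mem_cons, mem_ofPred_eq] at ht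
  obtain ⟨h1, h2, h3, h4, -⟩ := ht
  refine mem_cutPlane_of_forall hτ hz fun m j s ⟨hs0, hs1⟩ => ⟨fun ⟨hx, hy⟩ => ?_, fun hx hy => ?_⟩
  · rw [hx, hy] at h1 h2 h3 h4
    have m1 := mul_nonneg hs0 hb0.le
    have m2 := mul_nonneg (sub_nonneg.2 hs1) hb0.le
    rcases int_trichotomy j with hj | rfl | hj
    · linarith
    · push_cast at *; linarith
    · linarith
  · exfalso
    rw [hx, hy] at h1 h2 h3 h4
    have m1 := mul_nonneg hs0 (sub_nonneg.2 hb1.le)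
    have m2 := mul_nonneg (sub_nonneg.2 hs1) (sub_nonneg.2 hb1.le)
    rcases int_trichotomy j with hj | rfl | hj
    · linarith
    · have k1 : (0 : ℝ) < m - c := pos_of_mul_pos_right (a := 1 - b) (by push_cast at *; linarith) hb1'.le
      have k2 : (m - c : ℝ) < 1 := by
        refine lt_of_mul_lt_mul_left (a := 1 - b) (by push_cast at *; linarith) hb1'.le
      have k1' : 0 < m - c := by exact_mod_cast k1
      have k2' : m - c < 1 := by exact_mod_cast k2
      lia
    · linarith

/-- The only segment between consecutive branch points that meets this region is [-z,τ], with m = 0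
and k = 1, and it is not cut for any p. -/
lemma doubleCell_subset_cutPlane (hτ : 0 < τ.im) (hz : -z = a + b * τ) (ha : a ∈ Ioo (0 : ℝ) 1)
    (hb : b ∈ Ioo (0 : ℝ) 1) : doubleCell τ a b ⊆ cutPlane p z τ := by
  intro t ht
  obtain ⟨ha0, ha1⟩ := ha
  obtain ⟨hb0, hb1⟩ := hb
  have hb1' := sub_pos.2 hb1
  simp only [doubleCell, polygon, List.forall_mem_cons, mem_ofPred_eq] at ht
  obtain ⟨h1, h2, h3, h4, -⟩ := ht
  refine mem_cutPlane_of_forall hτ hz fun m j s ⟨hs0, hs1⟩ => ⟨fun ⟨hx, hy⟩ => ?_, fun hx hy => ?_⟩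
  · rw [hx, hy] at h1 h2 h3 h4
    have m1 := mul_nonneg hs0 hb0.le
    have m2 := mul_nonneg (sub_nonneg.2 hs1) hb0.le
    rcases int_trichotomy j with hj | rfl | hj
    · linarith
    · push_cast at *; linarith
    · linarith
  · rw [hx, hy] at h1 h2 h3 h4
    have m1 := mul_nonneg hs0 (sub_nonneg.2 hb1.le)
    have m2 := mul_nonneg (sub_nonneg.2 hs1) (sub_nonneg.2 hb1.le)
    rcases int_trichotomy j with hj | rfl | hj
    · linarith
    · have k1 : (-1 : ℝ) < m := by
        refine lt_of_mul_lt_mul_left (a := 1 - b) (by push_cast at *; linarith) hb1'.le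
      have k2 : (m : ℝ) < 1 := by
        refine lt_of_mul_lt_mul_left (a := 1 - b) (by push_cast at *; linarith) hb1'.le
      have k1' : -1 < m := by exact_mod_cast k1
      have k2' : m < 1 := by exact_mod_cast k2
      obtain rfl : m = 0 := by lia
      rfl
    · linarith

lemma horizontalKite_subset_cutPlane (hτ : 0 < τ.im) (hz : -z = a + b * τ)
    (ha : a ∈ Ioo (0 : ℝ) 1) (hb : b ∈ Ioo (0 : ℝ) 1) :
    horizontalKite τ a b ⊆ cutPlane p z τ := by
  intro t ht
  obtain ⟨ha0, ha1⟩ := ha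
  obtain ⟨hb0, hb1⟩ := hb
  have hb1' := sub_pos.2 hb1
  simp only [horizontalKite, polygon, List.forall_mem_cons, mem_ofPred_eq] at ht
  obtain ⟨h1, h2, h3, h4, h5, h6, -⟩ := ht
  refine mem_cutPlane_of_forall hτ hz fun m j s ⟨hs0, hs1⟩ => ⟨fun ⟨hx, hy⟩ => ?_, fun hx hy => ?_⟩
  · rw [hx, hy] at h1 h2 h3 h4 h5 h6
    have m1 := mul_nonneg hs0 hb0.le
    have m2 := mul_nonneg (sub_nonneg.2 hs1) hb0.le
    rcases int_trichotomy j with hj | rfl | hj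
    · linarith
    · have k1 : (0 : ℝ) < m := pos_of_mul_pos_right (a := b) (by push_cast at *; linarith) hb0.le
      have k2 : (m : ℝ) < 1 := by
        refine lt_of_mul_lt_mul_left (a := b) (by push_cast at *; linarith) hb0.le
      have k1' : 0 < m := by exact_mod_cast k1
      have k2' : m < 1 := by exact_mod_cast k2
      lia
    · linarith
  · exfalso
    rw [hx, hy] at h1 h2 h3 h4 h5 h6
    have m1 := mul_nonneg hs0 (sub_nonneg.2 hb1.le)
    have m2 := mul_nonneg (sub_nonneg.2 hs1) (sub_nonneg.2 hb1.le)
    have hj : j = -1 := by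
      have k1 : (-2 : ℝ) < j := by linarith
      have k2 : (j : ℝ) < 0 := by linarith
      have k1' : -2 < j := by exact_mod_cast k1
      have k2' : j < 0 := by exact_mod_cast k2
      lia
    subst hj
    have k1 : (0 : ℝ) < m := pos_of_mul_pos_right (a := 1 - b) (by push_cast at *; linarith) hb1'.le
    have k2 : (m : ℝ) < 1 := by
      refine lt_of_mul_lt_mul_left (a := 1 - b) (by push_cast at *; linarith) hb1'.le
    have k1' : 0 < m := by exact_mod_cast k1
    have k2' : m < 1 := by exact_mod_cast k2
    lia

/-- On the right the kite leans against column c; on the left it stays beyond the abscissa c-1+a,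
the furthest that column c-1 reaches. -/
lemma verticalKite_subset_cutPlane (hτ : 0 < τ.im) (hz : -z = a + b * τ)
    (ha : a ∈ Ioo (0 : ℝ) 1) (hb : b ∈ Ioo (0 : ℝ) 1) :
    verticalKite τ a b c ⊆ cutPlane p z τ := by
  intro t ht
  obtain ⟨ha0, ha1⟩ := ha
  obtain ⟨hb0, hb1⟩ := hb
  have ha1' := sub_pos.2 ha1
  have hb1' := sub_pos.2 hb1
  simp only [verticalKite, polygon, List.forall_mem_cons, mem_ofPred_eq] at ht
  obtain ⟨h1, h2, h3, h4, h5, h6, -⟩ := ht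
  refine mem_cutPlane_of_forall hτ hz fun m j s ⟨hs0, hs1⟩ => ⟨fun ⟨hx, hy⟩ => ?_, fun hx hy => ?_⟩
  · rw [hx, hy] at h1 h2 h3 h4 h5 h6
    have m1 := mul_nonneg hs0 hb0.le
    have m2 := mul_nonneg (sub_nonneg.2 hs1) hb0.le
    have m3 := mul_nonneg hs0 ha0.le
    have m4 := mul_nonneg (sub_nonneg.2 hs1) ha0.le
    rcases int_trichotomy j with hj | rfl | hj
    · linarith
    · have k2 : (m - c : ℝ) < 0 := by
        refine lt_of_mul_lt_mul_left (a := b) (by push_cast at *; linarith) hb0.le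
      have k2' : m - c < 0 := by exact_mod_cast k2
      have k1 : (m - c : ℝ) ≤ -1 := by exact_mod_cast (by lia : m - c ≤ -1)
      have m5 := mul_nonneg m1 ha1'.le
      have m6 := mul_nonneg (mul_nonneg hs0 hb1'.le) ha1'.le
      push_cast at *
      nlinarith
    · linarith
  · exfalso
    rw [hx, hy] at h1 h2 h3 h4 h5 h6
    have m1 := mul_nonneg hs0 (sub_nonneg.2 hb1.le)
    have m2 := mul_nonneg (sub_nonneg.2 hs1) (sub_nonneg.2 hb1.le)
    rcases int_trichotomy j with hj | rfl | hj
    · linarith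
    · have k2 : (m - c : ℝ) < 0 := by
        refine lt_of_mul_lt_mul_left (a := 1 - b) (by push_cast at *; linarith) hb1'.le
      have k2' : m - c < 0 := by exact_mod_cast k2
      have k1 : (m - c : ℝ) ≤ -1 := by exact_mod_cast (by lia : m - c ≤ -1)
      have m3 := mul_nonneg hs0 ha0.le
      push_cast at *
      nlinarith [mul_nonneg m2 ha1'.le, mul_nonneg m1 ha1'.le]
    · linarith

lemma primeProd_ne_zero_of_mem_strip (hτ : 0 < τ.im) (h0 : deriv (fun y => theta1 y τ) 0 ≠ 0)
    (hz : -z = a + b * τ) (hb : b ∈ Ioo (0 : ℝ) 1) {t : ℂ} (ht : t ∈ strip τ b) :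
    primeProd z τ t ≠ 0 := by
  intro h
  simp only [strip, polygon, List.forall_mem_cons, mem_ofPred_eq] at ht
  obtain ⟨h1, h2, -⟩ := ht
  obtain ⟨m, n, e | e⟩ := isBranchPoint_of_primeProd_eq_zero hτ h0 h
  all_goals
    have hy : coordY τ ((m : ℂ) + n * τ) = n := by
      simpa using coordY_add_mul hτ (m : ℝ) (n : ℝ)
  · rw [e, hy] at h1 h2
    rcases int_trichotomy n with hj | rfl | hj
    · linarith
    · simp at h1
    · linarith [hb.2]
  · rw [e, map_sub (coordY τ), hy, coordY_eq_of_neg_eq hτ hz] at h1 h2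
    rcases int_trichotomy n with hj | rfl | hj
    · linarith [hb.2]
    · simp at h2
    · linarith

lemma lowerTriangle_subset_lowerCell (hτ : 0 < τ.im) (hz : -z = a + b * τ)
    (hb : b ∈ Ioo (0 : ℝ) 1) : lowerTriangle z ⊆ lowerCell τ a b 0 := by
  intro t ht
  -- An affine inequality on the triangle need only be tested at its vertices 0, 1 and -z.
  have key : ∀ α β γ : ℝ, 0 ≤ γ → 0 ≤ α + γ → 0 ≤ α * a + β * b + γ → (α ≠ 0 ∨ β ≠ 0) →
      0 < α * coordX τ t + β * coordY τ t + γ := by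
    intro α β γ g0 g1 g2 hne
    refine pos_of_mem_interior hτ hne (fun s hs => ?_) ht
    have hc : Convex ℝ {s | 0 ≤ α * coordX τ s + β * coordY τ s + γ} := by
      have : {s | 0 ≤ α * coordX τ s + β * coordY τ s + γ} =
          {s | -γ ≤ (α • coordX τ + β • coordY τ) s} := by
        ext s
        simp only [mem_ofPred_eq, _root_.add_apply, _root_.smul_apply,
          smul_eq_mul]
        constructor <;> intro h <;> linarith
      rw [this]
      exact convex_halfSpace_ge (α • coordX τ + β • coordY τ).toLinearMap.isLinear _
    refine convexHull_min ?_ hc hs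
    rintro s (rfl | rfl | rfl)
    · simpa using g0
    · simpa [coordX_one, coordY_one] using g1
    · simpa [hz, coordX_add_mul hτ, coordY_add_mul hτ] using g2
  have h1 := key 0 1 0 le_rfl (by simp) (by simpa using hb.1.le) (by simp)
  have h2 := key b (-a) 0 le_rfl (by simpa using hb.1.le) (by linarith) (Or.inl hb.1.ne')
  have h3 := key (-b) (a - 1) b hb.1.le (by simp) (by linarith) (Or.inl (by simpa using hb.1.ne'))
  simp only [lowerCell, polygon, List.forall_mem_cons, mem_ofPred_eq]
  refine ⟨h1, by linarith, by simpa using h2, by push_cast; linarith, by simp⟩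

end cells

section polygonPoints

variable {τ : ℂ} {l : List (ℝ × ℝ × ℝ)}

lemma add_mul_mem_polygon (hτ : 0 < τ.im) {x y : ℝ}
    (h : ∀ h ∈ l, 0 < h.1 * x + h.2.1 * y + h.2.2) : (x + y * τ : ℂ) ∈ polygon τ l := fun i hi => by
  rw [coordX_add_mul hτ, coordY_add_mul hτ]
  exact h i hi

end polygonPoints

/-! ### Determinations of the root under the symmetries. -/

section branches

variable {p : ℕ} {z τ : ℂ} {D D' : Set ℂ} {f g : ℂ → ℂ}

lemma IsBranch.isBranchOn (hf : IsBranch p z τ f) : IsBranchOn p z τ (cutPlane p z τ) f :=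
  ⟨hf.1, hf.2⟩

/-- If Θ₁'(0) vanished, the prime form would be 0 by the convention for division, which is
incompatible with f^p E(t)E(z+t) = 1. So the mere existence of f supplies this fact. -/
lemma IsBranch.deriv_theta1_ne_zero (hf : IsBranch p z τ f) {t : ℂ}
    (ht : t ∈ cutPlane p z τ) : deriv (fun y => theta1 y τ) 0 ≠ 0 := fun h => by
  simpa [primeForm, h] using hf.pow_mul_eq_one t ht

namespace IsBranchOn

lemma comp (h : IsBranchOn p z τ D g) {φ ψ : ℂ → ℂ} (hφ : Differentiable ℂ φ)
    (hψ : Differentiable ℂ ψ) (hD : MapsTo φ D' D)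
    (hN : ∀ t, ψ t ^ p * primeProd z τ t = primeProd z τ (φ t)) :
    IsBranchOn p z τ D' fun t => ψ t * g (φ t) :=
  ⟨hψ.differentiableOn.mul (h.differentiableOn.comp hφ.differentiableOn hD), fun t ht => by
    rw [mul_pow, mul_comm (ψ t ^ p), mul_assoc, hN, h.pow_mul _ (hD ht)]⟩

lemma comp_add_one (h : IsBranchOn p z τ D g) (hD : MapsTo (· + 1) D' D) :
    IsBranchOn p z τ D' fun t => g (t + 1) := by
  simpa using h.comp (ψ := fun _ => 1) (φ := (· + 1)) (by fun_prop) (by fun_prop) hD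
    fun t => by simp [primeProd_add_one]

lemma comp_neg_sub (h : IsBranchOn p z τ D g) (hD : MapsTo (-z - ·) D' D) :
    IsBranchOn p z τ D' fun t => g (-z - t) := by
  simpa using h.comp (ψ := fun _ => 1) (φ := (-z - ·)) (by fun_prop) (by fun_prop) hD
    fun t => by simp [primeProd_reflect]

lemma comp_one_sub (h : IsBranchOn p z τ D g) (hD : MapsTo (1 - z - ·) D' D) :
    IsBranchOn p z τ D' fun t => g (1 - z - t) := by
  simpa using h.comp (ψ := fun _ => 1) (φ := (1 - z - ·)) (by fun_prop) (by fun_prop) hD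
    fun t => by
      rw [show 1 - z - t = -z - t + 1 by ring, primeProd_add_one, primeProd_reflect]
      simp

lemma comp_tau_sub (hp : p ≠ 0) (h : IsBranchOn p z τ D g) (hD : MapsTo (τ - z - ·) D' D) :
    IsBranchOn p z τ D' fun t =>
      cexp (-(2 * Real.pi * I * (τ - z - 2 * t) / p)) * g (τ - z - t) := by
  have hpc : (p : ℂ) ≠ 0 := Nat.cast_ne_zero.2 hp
  refine h.comp (ψ := fun t => cexp (-(2 * Real.pi * I * (τ - z - 2 * t) / p)))
    (φ := (τ - z - ·)) (by fun_prop) (by fun_prop) hD fun t => ?_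
  rw [show τ - z - t = -z - t + τ by ring, primeProd_add_tau, primeProd_reflect,
    ← Complex.exp_nat_mul]
  congr 2
  field_simp
  ring

end IsBranchOn

namespace IsBranch

lemma one_sub_eq (hp : p ≠ 0) (hf : IsBranch p z τ f) (hD : Convex ℝ D) (hc : D ⊆ cutPlane p z τ)
    {w : ℂ} (hw : w ∈ D) (h : f (1 - z - w) = f w) : ∀ t ∈ D, f (1 - z - t) = f t := by
  simpa using (hf.isBranchOn.comp_one_sub fun t ht => one_sub_mem_cutPlane (hc ht)).eq_mul_of_eq
    (r := 1) hp hD.isPreconnected (hf.isBranchOn.mono hc) hw (by simpa using h)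

lemma add_one_eq (hp : p ≠ 0) (hf : IsBranch p z τ f) (hD : Convex ℝ D) (hc : D ⊆ cutPlane p z τ)
    (hc' : ∀ t ∈ D, t + 1 ∈ cutPlane p z τ) {w r : ℂ} (hw : w ∈ D) (h : f (w + 1) = r * f w) :
    ∀ t ∈ D, f (t + 1) = r * f t :=
  (hf.isBranchOn.comp_add_one hc').eq_mul_of_eq hp hD.isPreconnected (hf.isBranchOn.mono hc) hw h

/-- The fixed point w makes the exponential 1, so the two determinations agree at w and hence on all
of D. -/
lemma tau_sub_eq (hp : p ≠ 0) (hf : IsBranch p z τ f) (hD : Convex ℝ D) (hc : D ⊆ cutPlane p z τ)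
    {w : ℂ} (hw : w ∈ D) (h : τ - z - w = w) :
    ∀ t ∈ D, f (τ - z - t) = cexp (2 * Real.pi * I * (τ - z - 2 * t) / p) * f t := by
  intro t ht
  have h1 := (hf.isBranchOn.comp_tau_sub hp
    fun t ht => tau_sub_mem_cutPlane (hc ht)).eq_mul_of_eq
    (r := 1) hp hD.isPreconnected (hf.isBranchOn.mono hc) hw (by
      have h2 : τ - z - 2 * w = 0 := by linear_combination h
      simp [h, h2]) t ht
  rw [one_mul] at h1
  rw [← h1, ← mul_assoc, ← Complex.exp_add, add_neg_cancel, Complex.exp_zero, one_mul]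

end IsBranch

end branches

/-! ### Inclusions between the regions, base points and vertices. -/

section membership

variable {τ z : ℂ} {a b : ℝ}

lemma add_one_mem_lowerCell {c : ℤ} {t : ℂ} (ht : t ∈ lowerCell τ a b c) :
    t + 1 ∈ lowerCell τ a b (c + 1) := by
  simp only [lowerCell, polygon, List.forall_mem_cons, mem_ofPred_eq, map_add, coordX_one,
    coordY_one] at *
  push_cast
  refine ⟨by linarith [ht.1], by linarith [ht.2.1], by linarith [ht.2.2.1],
    by linarith [ht.2.2.2.1], by simp⟩

lemma add_one_mem_upperCell {c : ℤ} {t : ℂ} (ht : t ∈ upperCell τ a b c) :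
    t + 1 ∈ upperCell τ a b (c + 1) := by
  simp only [upperCell, polygon, List.forall_mem_cons, mem_ofPred_eq, map_add, coordX_one,
    coordY_one] at *
  push_cast
  refine ⟨by linarith [ht.1], by linarith [ht.2.1], by linarith [ht.2.2.1],
    by linarith [ht.2.2.2.1], by simp⟩

lemma add_one_mem_verticalKite {c : ℤ} {t : ℂ} (ht : t ∈ verticalKite τ a b c) :
    t + 1 ∈ verticalKite τ a b (c + 1) := by
  simp only [verticalKite, polygon, List.forall_mem_cons, mem_ofPred_eq, map_add, coordX_one,
    coordY_one] at *
  push_cast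
  refine ⟨by linarith [ht.1], by linarith [ht.2.1], by linarith [ht.2.2.1],
    by linarith [ht.2.2.2.1], by linarith [ht.2.2.2.2.1], by linarith [ht.2.2.2.2.2.1], by simp⟩

lemma lowerCell_subset_strip {c : ℤ} : lowerCell τ a b c ⊆ strip τ b := fun t ht => by
  simp only [lowerCell, strip, polygon, List.forall_mem_cons, mem_ofPred_eq] at *
  exact ⟨ht.1, ht.2.1, by simp⟩

lemma neg_sub_mem_strip (hτ : 0 < τ.im) (hz : -z = a + b * τ) {t : ℂ} (ht : t ∈ strip τ b) :
    -z - t ∈ strip τ b := by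
  simp only [strip, polygon, List.forall_mem_cons, mem_ofPred_eq, map_sub, map_neg,
    coordX_eq_of_neg_eq hτ hz, coordY_eq_of_neg_eq hτ hz] at *
  exact ⟨by linarith [ht.2.1], by linarith [ht.1], by simp⟩

lemma tau_sub_mem_doubleCell (hτ : 0 < τ.im) (hz : -z = a + b * τ) {t : ℂ}
    (ht : t ∈ doubleCell τ a b) : τ - z - t ∈ doubleCell τ a b := by
  simp only [doubleCell, polygon, List.forall_mem_cons, mem_ofPred_eq, map_sub, coordX_self hτ,
    coordY_self hτ, coordX_eq_of_neg_eq hτ hz, coordY_eq_of_neg_eq hτ hz] at *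
  exact ⟨by linarith [ht.2.1], by linarith [ht.1], by linarith [ht.2.2.2.1],
    by linarith [ht.2.2.1], by simp⟩

lemma mem_upperCell_of_mem_doubleCell {t : ℂ} (ht : t + 1 ∈ doubleCell τ a b)
    (ht' : t ∈ doubleCell τ a b) : t ∈ upperCell τ a b (-1) := by
  simp only [doubleCell, upperCell, polygon, List.forall_mem_cons, mem_ofPred_eq, map_add,
    coordX_one, coordY_one] at *
  push_cast
  exact ⟨ht'.1, ht'.2.1, by linarith [ht'.2.2.1], by linarith [ht.2.2.2.1], by simp⟩

lemma upperCell_subset_doubleCell : upperCell τ a b (-1) ⊆ doubleCell τ a b := by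
  intro t ht
  simp only [doubleCell, upperCell, polygon, List.forall_mem_cons, mem_ofPred_eq] at *
  push_cast at ht
  exact ⟨ht.1, ht.2.1, by linarith [ht.2.2.1], by linarith [ht.2.2.2.1], by simp⟩

/-- Below the height of -z the kite touches column 0 only from the left, which is the side where f
and its continuation through the cut differ. -/
lemma mem_lowerCell_of_mem_verticalKite (ha : a ∈ Ioo (0 : ℝ) 1) (hb : b ∈ Ioo (0 : ℝ) 1) {t : ℂ}
    (ht : t ∈ verticalKite τ a b 0) (ht' : t ∈ strip τ b) : t ∈ lowerCell τ a b (-1) := by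
  simp only [verticalKite, lowerCell, strip, polygon, List.forall_mem_cons, mem_ofPred_eq] at *
  obtain ⟨h1, h2, h3, h4, h5, h6, -⟩ := ht
  obtain ⟨-, h7, -⟩ := ht'
  obtain ⟨ha0, ha1⟩ := ha
  obtain ⟨hb0, hb1⟩ := hb
  push_cast at *
  set x := coordX τ t
  set y := coordY τ t
  have k : -(1 - a) < x := by linarith
  have m1 := mul_pos hb0 (sub_pos.2 k)
  have m2 : a * y < a * b := mul_lt_mul_of_pos_left (by linarith) ha0
  exact ⟨h1, h7, by linarith, by linarith, by simp⟩

end membership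

section points

variable {τ z : ℂ} {a b : ℝ}

lemma center_mem_lowerCell (hτ : 0 < τ.im) (hb : b ∈ Ioo (0 : ℝ) 1) (c : ℤ) :
    (((1 + a) / 2 + c : ℝ) + (b / 2 : ℝ) * τ : ℂ) ∈ lowerCell τ a b c := by
  refine add_mul_mem_polygon hτ ?_
  simp only [List.forall_mem_cons]
  obtain ⟨hb0, hb1⟩ := hb
  exact ⟨by linarith, by linarith, by linarith, by linarith, by simp⟩

lemma center_mem_upperCell (hτ : 0 < τ.im) (hb : b ∈ Ioo (0 : ℝ) 1) (c : ℤ) :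
    (((1 + a) / 2 + c : ℝ) + ((1 + b) / 2 : ℝ) * τ : ℂ) ∈ upperCell τ a b c := by
  refine add_mul_mem_polygon hτ ?_
  simp only [List.forall_mem_cons]
  obtain ⟨hb0, hb1⟩ := hb
  exact ⟨by linarith, by linarith, by linarith, by linarith, by simp⟩

lemma center_mem_doubleCell (hτ : 0 < τ.im) (hb : b ∈ Ioo (0 : ℝ) 1) :
    ((a / 2 : ℝ) + ((1 + b) / 2 : ℝ) * τ : ℂ) ∈ doubleCell τ a b := by
  refine add_mul_mem_polygon hτ ?_
  simp only [List.forall_mem_cons]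
  obtain ⟨hb0, hb1⟩ := hb
  exact ⟨by linarith, by linarith, by linarith, by linarith, by simp⟩

lemma center_mem_doubleCell' (hτ : 0 < τ.im) (hb : b ∈ Ioo (0 : ℝ) 1) :
    (((1 + a) / 2 : ℝ) + ((1 + b) / 2 : ℝ) * τ : ℂ) ∈ doubleCell τ a b := by
  refine add_mul_mem_polygon hτ ?_
  simp only [List.forall_mem_cons]
  obtain ⟨hb0, hb1⟩ := hb
  exact ⟨by linarith, by linarith, by linarith, by linarith, by simp⟩

lemma center_mem_strip (hτ : 0 < τ.im) (hb : b ∈ Ioo (0 : ℝ) 1) :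
    ((a / 2 : ℝ) + (b / 2 : ℝ) * τ : ℂ) ∈ strip τ b := by
  refine add_mul_mem_polygon hτ ?_
  simp only [List.forall_mem_cons]
  obtain ⟨hb0, hb1⟩ := hb
  exact ⟨by linarith, by linarith, by simp⟩

/-- A point of the lower cell above the segment from `0` to `1`. -/
lemma mem_lowerCell_inter_horizontalKite (hτ : 0 < τ.im) (ha : a ∈ Ioo (0 : ℝ) 1)
    (hb : b ∈ Ioo (0 : ℝ) 1) : ((1 / 2 : ℝ) + (b * (1 - b) / 2 : ℝ) * τ : ℂ) ∈
      lowerCell τ a b 0 ∩ horizontalKite τ a b := by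
  obtain ⟨ha0, ha1⟩ := ha
  obtain ⟨hb0, hb1⟩ := hb
  have hb1' := sub_pos.2 hb1
  have m1 := mul_pos hb0 hb1'
  have m2 := mul_pos ha0 m1
  have m3 := mul_pos (sub_pos.2 ha1) m1
  have m4 := mul_pos hb0 hb0
  have m5 := mul_pos hb1' hb1'
  constructor <;> refine add_mul_mem_polygon hτ ?_ <;>
    simp only [List.forall_mem_cons, Int.cast_zero]
  · exact ⟨by linarith, by linarith, by linarith, by linarith, by simp⟩
  · exact ⟨by linarith, by linarith, by linarith, by linarith, by linarith, by linarith, by simp⟩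

/-- A point of the horizontal kite below the segment from `0` to `1`. -/
lemma mem_horizontalKite (hτ : 0 < τ.im) (ha : a ∈ Ioo (0 : ℝ) 1)
    (hb : b ∈ Ioo (0 : ℝ) 1) : ((1 / 2 : ℝ) + (-(b * (1 - b) / 2) : ℝ) * τ : ℂ) ∈
      horizontalKite τ a b := by
  obtain ⟨ha0, ha1⟩ := ha
  obtain ⟨hb0, hb1⟩ := hb
  have hb1' := sub_pos.2 hb1
  have m1 := mul_pos hb0 hb1'
  have m2 := mul_pos ha0 m1
  have m3 := mul_pos (sub_pos.2 ha1) m1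
  have m4 := mul_pos hb0 hb0
  have m5 := mul_pos hb1' hb1'
  refine add_mul_mem_polygon hτ ?_
  simp only [List.forall_mem_cons]
  exact ⟨by linarith, by linarith, by linarith, by linarith, by linarith, by linarith, by simp⟩

lemma one_sub_mem_lowerCell (hτ : 0 < τ.im) (hz : -z = a + b * τ) {t : ℂ}
    (ht : t ∈ lowerCell τ a b 0) : 1 - z - t ∈ lowerCell τ a b 0 := by
  simp only [lowerCell, polygon, List.forall_mem_cons, mem_ofPred_eq, map_sub, coordX_one,
    coordY_one, coordX_eq_of_neg_eq hτ hz, coordY_eq_of_neg_eq hτ hz, Int.cast_zero] at *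
  exact ⟨by linarith [ht.2.1], by linarith [ht.1], by linarith [ht.2.2.2.1],
    by linarith [ht.2.2.1], by simp⟩

lemma one_sub_mem_doubleCell (hτ : 0 < τ.im) (hz : -z = a + b * τ) (ha : a ∈ Ioo (0 : ℝ) 1)
    (hb : b ∈ Ioo (0 : ℝ) 1) :
    1 - z - ((1 / 2 : ℝ) + (-(b * (1 - b) / 2) : ℝ) * τ : ℂ) ∈ doubleCell τ a b := by
  obtain ⟨ha0, ha1⟩ := ha
  obtain ⟨hb0, hb1⟩ := hb
  have hb1' := sub_pos.2 hb1
  have m1 := mul_pos hb0 hb1'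
  have m2 := mul_pos ha0 m1
  have m3 := mul_pos (sub_pos.2 ha1) m1
  have m4 := mul_pos hb0 hb0
  have m5 := mul_pos hb1' hb1'
  simp only [doubleCell, polygon, List.forall_mem_cons, mem_ofPred_eq, map_sub, coordX_one,
    coordY_one, coordX_eq_of_neg_eq hτ hz, coordY_eq_of_neg_eq hτ hz, coordX_add_mul hτ,
    coordY_add_mul hτ]
  exact ⟨by linarith, by linarith, by linarith, by linarith, by simp⟩

lemma mem_verticalKite_inter_lowerCell (hτ : 0 < τ.im) (ha : a ∈ Ioo (0 : ℝ) 1)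
    (hb : b ∈ Ioo (0 : ℝ) 1) : ((0 : ℝ) + (b / 2 : ℝ) * τ : ℂ) ∈
      verticalKite τ a b 0 ∩ lowerCell τ a b (-1) := by
  obtain ⟨ha0, ha1⟩ := ha
  obtain ⟨hb0, hb1⟩ := hb
  have m1 := mul_pos hb0 (sub_pos.2 ha1)
  have m2 := mul_pos ha0 hb0
  have m3 := mul_pos (sub_pos.2 ha1) (sub_pos.2 hb1)
  have m4 := mul_pos ha0 (sub_pos.2 hb1)
  constructor <;> refine add_mul_mem_polygon hτ ?_ <;>
    simp only [List.forall_mem_cons] <;> push_cast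
  · exact ⟨by linarith, by linarith, by linarith, by linarith, by linarith, by linarith, by simp⟩
  · exact ⟨by linarith, by linarith, by linarith, by linarith, by simp⟩

lemma mem_verticalKite_inter_upperCell (hτ : 0 < τ.im) (ha : a ∈ Ioo (0 : ℝ) 1)
    (hb : b ∈ Ioo (0 : ℝ) 1) : ((0 : ℝ) + ((1 + b) / 2 : ℝ) * τ : ℂ) ∈
      verticalKite τ a b 0 ∩ upperCell τ a b (-1) := by
  obtain ⟨ha0, ha1⟩ := ha
  obtain ⟨hb0, hb1⟩ := hb
  have m1 := mul_pos hb0 (sub_pos.2 ha1)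
  have m2 := mul_pos ha0 hb0
  have m3 := mul_pos (sub_pos.2 ha1) (sub_pos.2 hb1)
  have m4 := mul_pos ha0 (sub_pos.2 hb1)
  constructor <;> refine add_mul_mem_polygon hτ ?_ <;>
    simp only [List.forall_mem_cons] <;> push_cast
  · exact ⟨by linarith, by linarith, by linarith, by linarith, by linarith, by linarith, by simp⟩
  · exact ⟨by linarith, by linarith, by linarith, by linarith, by simp⟩

lemma closure_lowerCell (hτ : 0 < τ.im) (hz : -z = a + b * τ) (hb : b ∈ Ioo (0 : ℝ) 1) :
    0 ∈ closure (lowerCell τ a b 0) ∧ 1 ∈ closure (lowerCell τ a b 0) ∧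
      -z ∈ closure (lowerCell τ a b 0) ∧ 1 - z ∈ closure (lowerCell τ a b 0) := by
  have hw := center_mem_lowerCell (a := a) hτ hb 0
  obtain ⟨hb0, hb1⟩ := hb
  refine ⟨?_, ?_, ?_, ?_⟩ <;> refine mem_closure_polygon hw ?_ <;>
    simp only [List.forall_mem_cons, map_sub, map_neg, map_zero, coordX_one, coordY_one,
      coordX_eq_of_neg_eq hτ hz, coordY_eq_of_neg_eq hτ hz, Int.cast_zero] <;>
    exact ⟨by linarith, by linarith, by linarith, by linarith, by simp⟩

lemma closure_strip (hτ : 0 < τ.im) (hz : -z = a + b * τ) (hb : b ∈ Ioo (0 : ℝ) 1) :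
    0 ∈ closure (strip τ b) ∧ -z ∈ closure (strip τ b) := by
  have hw := center_mem_strip (a := a) hτ hb
  obtain ⟨hb0, hb1⟩ := hb
  refine ⟨?_, ?_⟩ <;> refine mem_closure_polygon hw ?_ <;>
    simp only [List.forall_mem_cons, map_neg, map_zero, coordX_eq_of_neg_eq hτ hz,
      coordY_eq_of_neg_eq hτ hz] <;>
    exact ⟨by linarith, by linarith, by simp⟩

lemma closure_doubleCell (hτ : 0 < τ.im) (hz : -z = a + b * τ) (hb : b ∈ Ioo (0 : ℝ) 1) :
    -z ∈ closure (doubleCell τ a b) ∧ τ ∈ closure (doubleCell τ a b) ∧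
      1 - z ∈ closure (doubleCell τ a b) ∧ 1 + τ ∈ closure (doubleCell τ a b) := by
  have hw := center_mem_doubleCell (a := a) hτ hb
  obtain ⟨hb0, hb1⟩ := hb
  refine ⟨?_, ?_, ?_, ?_⟩ <;> refine mem_closure_polygon hw ?_ <;>
    simp only [List.forall_mem_cons, map_sub, map_add, map_neg, coordX_one, coordY_one,
      coordX_self hτ, coordY_self hτ, coordX_eq_of_neg_eq hτ hz, coordY_eq_of_neg_eq hτ hz] <;>
    exact ⟨by linarith, by linarith, by linarith, by linarith, by simp⟩

lemma closure_horizontalKite (hτ : 0 < τ.im) (ha : a ∈ Ioo (0 : ℝ) 1) (hb : b ∈ Ioo (0 : ℝ) 1) :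
    0 ∈ closure (horizontalKite τ a b) ∧ 1 ∈ closure (horizontalKite τ a b) := by
  have hw := mem_horizontalKite hτ ha hb
  obtain ⟨hb0, hb1⟩ := hb
  refine ⟨?_, ?_⟩ <;> refine mem_closure_polygon hw ?_ <;>
    simp only [List.forall_mem_cons, map_zero, coordX_one, coordY_one] <;>
    exact ⟨by linarith, by linarith, by linarith, by linarith, by linarith, by linarith, by simp⟩

lemma closure_verticalKite (hτ : 0 < τ.im) (hz : -z = a + b * τ) (ha : a ∈ Ioo (0 : ℝ) 1)
    (hb : b ∈ Ioo (0 : ℝ) 1) :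
    0 ∈ closure (verticalKite τ a b 0) ∧ -z ∈ closure (verticalKite τ a b 0) ∧
      τ ∈ closure (verticalKite τ a b 0) := by
  have hw := (mem_verticalKite_inter_lowerCell hτ ha hb).1
  obtain ⟨ha0, ha1⟩ := ha
  obtain ⟨hb0, hb1⟩ := hb
  have m1 := mul_pos (sub_pos.2 ha1) hb0
  have m2 := mul_pos (sub_pos.2 ha1) (sub_pos.2 hb1)
  refine ⟨?_, ?_, ?_⟩ <;> refine mem_closure_polygon hw ?_ <;>
    simp only [List.forall_mem_cons, map_zero, map_neg, coordX_self hτ, coordY_self hτ,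
      coordX_eq_of_neg_eq hτ hz, coordY_eq_of_neg_eq hτ hz, Int.cast_zero] <;>
    exact ⟨by linarith, by linarith, by linarith, by linarith, by linarith, by linarith, by simp⟩

lemma line_mem_horizontalKite (hτ : 0 < τ.im) (hb : b ∈ Ioo (0 : ℝ) 1) {u : ℝ}
    (hu : u ∈ Ioo (0 : ℝ) 1) : (0 + u * (1 - 0) : ℂ) ∈ horizontalKite τ a b := by
  rw [show (0 + u * (1 - 0) : ℂ) = (u : ℝ) + (0 : ℝ) * τ by push_cast; ring]
  refine add_mul_mem_polygon hτ ?_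
  obtain ⟨hb0, hb1⟩ := hb
  obtain ⟨hu0, hu1⟩ := hu
  have m1 := mul_pos hb0 hu0
  have m2 := mul_pos hb0 (sub_pos.2 hu1)
  have m3 := mul_pos (sub_pos.2 hb1) hu0
  have m4 := mul_pos (sub_pos.2 hb1) (sub_pos.2 hu1)
  simp only [List.forall_mem_cons]
  exact ⟨by linarith, by linarith, by linarith, by linarith, by linarith, by linarith, by simp⟩

lemma line_mem_verticalKite (hτ : 0 < τ.im) (ha : a ∈ Ioo (0 : ℝ) 1) {u : ℝ}
    (hu : u ∈ Ioo (0 : ℝ) 1) : (0 + u * (τ - 0) : ℂ) ∈ verticalKite τ a b 0 := by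
  rw [show (0 + u * (τ - 0) : ℂ) = (0 : ℝ) + (u : ℝ) * τ by push_cast; ring]
  refine add_mul_mem_polygon hτ ?_
  obtain ⟨ha0, ha1⟩ := ha
  obtain ⟨hu0, hu1⟩ := hu
  have m1 := mul_pos ha0 hu0
  have m2 := mul_pos ha0 (sub_pos.2 hu1)
  have m3 := mul_pos (sub_pos.2 ha1) hu0
  have m4 := mul_pos (sub_pos.2 ha1) (sub_pos.2 hu1)
  simp only [List.forall_mem_cons, Int.cast_zero]
  exact ⟨by linarith, by linarith, by linarith, by linarith, by linarith, by linarith, by simp⟩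

end points

/-! ### Monodromy and the relations between periods. -/

/-- The determinations of the root on the strip and the behaviour of `f` under the symmetries of
the cut plane. -/
theorem IsBranch.exists_monodromy {p : ℕ} (hp : p ≠ 0) {z τ : ℂ} (hτ : 0 < τ.im) {a b : ℝ}
    (hz : -z = a + b * τ) (ha : a ∈ Ioo (0 : ℝ) 1) (hb : b ∈ Ioo (0 : ℝ) 1) {f : ℂ → ℂ}
    (hf : IsBranch p z τ f) :
    ∃ g : ℂ → ℂ, IsBranchOn p z τ (strip τ b) g ∧
      (∀ t ∈ strip τ b, g (-z - t) = g t) ∧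
      (∀ t ∈ lowerCell τ a b 0, f t = g t) ∧
      (∀ t ∈ lowerCell τ a b (-1), f t = (qTilde p)⁻¹ * g t) ∧
      (∀ t ∈ lowerCell τ a b 0, f (1 - z - t) = f t) ∧
      (∀ t ∈ horizontalKite τ a b, f (1 - z - t) = f t) ∧
      (∀ t ∈ doubleCell τ a b,
        f (τ - z - t) = cexp (2 * Real.pi * I * (τ - z - 2 * t) / p) * f t) ∧
      (∀ t ∈ doubleCell τ a b, 1 + τ - z - t ∈ doubleCell τ a b →
        f (1 + τ - z - t) = qTilde p * cexp (2 * Real.pi * I * (τ - z - 2 * t) / p) * f t) := by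
  have hLC : ∀ c : ℤ, lowerCell τ a b c ⊆ cutPlane p z τ := fun c =>
    lowerCell_subset_cutPlane hτ hz ha hb
  have hUC : ∀ c : ℤ, upperCell τ a b c ⊆ cutPlane p z τ := fun c =>
    upperCell_subset_cutPlane hτ hz ha hb
  have hVK : ∀ c : ℤ, verticalKite τ a b c ⊆ cutPlane p z τ := fun c =>
    verticalKite_subset_cutPlane hτ hz ha hb
  have hDC := doubleCell_subset_cutPlane (p := p) hτ hz ha hb
  have hHK := horizontalKite_subset_cutPlane (p := p) hτ hz ha hb
  have h0 := hf.deriv_theta1_ne_zero (hLC 0 (center_mem_lowerCell hτ hb 0))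
  have hLCc : ∀ c : ℤ, Convex ℝ (lowerCell τ a b c) := fun c => convex_polygon
  have hSc : Convex ℝ (strip τ b) := convex_polygon
  -- The centre of the cell is the fixed point of the reflection.
  have hlow : ∀ t ∈ lowerCell τ a b 0, f (1 - z - t) = f t := by
    refine hf.one_sub_eq hp (hLCc 0) (hLC 0) (center_mem_lowerCell hτ hb 0) (congrArg f ?_)
    push_cast
    linear_combination hz
  -- The fixed point is not used here; the equality is imported at a common point with the lower
  -- cell.
  have hkite : ∀ t ∈ horizontalKite τ a b, f (1 - z - t) = f t :=
    have hw := mem_lowerCell_inter_horizontalKite hτ ha hb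
    hf.one_sub_eq hp convex_polygon hHK hw.2 (hlow _ hw.1)
  have htau : ∀ t ∈ doubleCell τ a b,
      f (τ - z - t) = cexp (2 * Real.pi * I * (τ - z - 2 * t) / p) * f t := by
    refine hf.tau_sub_eq hp convex_polygon hDC (center_mem_doubleCell hτ hb) ?_
    push_cast
    linear_combination hz
  obtain ⟨g₀, hg₀⟩ := exists_isBranchOn hp hτ hSc isOpen_polygon
    fun t ht => primeProd_ne_zero_of_mem_strip hτ h0 hz hb ht
  obtain ⟨r, hr⟩ := (hf.isBranchOn.mono (hLC 0)).exists_eq_mul hp (hLCc 0).isPreconnected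
    (hg₀.mono lowerCell_subset_strip)
  have hr1 : r ^ p = 1 := (hf.isBranchOn.mono (hLC 0)).pow_eq_one
    (hg₀.mono lowerCell_subset_strip) (center_mem_lowerCell hτ hb 0) (hr _ (center_mem_lowerCell hτ hb 0))
  set g : ℂ → ℂ := fun t => r * g₀ t
  have hg : IsBranchOn p z τ (strip τ b) g := hg₀.const_mul hr1
  have hgr : ∀ t ∈ strip τ b, g (-z - t) = g t := by
    have := (hg.comp_neg_sub (D' := strip τ b) fun t ht => neg_sub_mem_strip hτ hz ht).eq_mul_of_eq
      (r := 1) hp hSc.isPreconnected hg (center_mem_strip (a := a) hτ hb) (by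
        rw [one_mul]
        refine congrArg g ?_
        push_cast
        linear_combination hz)
    simpa using this
  -- The unknown s is the jump across [0,-z]. It equals the factor of f under t ↦ t+1 from the cell
  -- on the left to the one on the right, because g is symmetric and the reflection joins the two
  -- centres.
  obtain ⟨s, hs⟩ := (hg.mono lowerCell_subset_strip).exists_eq_mul hp (hLCc (-1)).isPreconnected
    (hf.isBranchOn.mono (hLC (-1)))
  have hs1 : ∀ t ∈ lowerCell τ a b (-1), f (t + 1) = s * f t := by
    have hw := center_mem_lowerCell (a := a) hτ hb (-1)
    refine hf.add_one_eq hp (hLCc (-1)) (hLC (-1)) (fun t ht => hLC 0 (add_one_mem_lowerCell ht))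
      hw ?_
    rw [← hs _ hw, hr _ (add_one_mem_lowerCell hw), ← hgr _ (lowerCell_subset_strip hw)]
    refine congrArg g ?_
    push_cast
    linear_combination -hz
  -- The kite and its translate by 1 transport this factor past the height of -z to the upper cells.
  have hs2 : ∀ t ∈ verticalKite τ a b 0, f (t + 1) = s * f t := by
    have hw := mem_verticalKite_inter_lowerCell hτ ha hb
    exact hf.add_one_eq hp convex_polygon (hVK 0)
      (fun t ht => hVK (0 + 1) (add_one_mem_verticalKite ht)) hw.1 (hs1 _ hw.2)
  have hs3 : ∀ t ∈ upperCell τ a b (-1), f (t + 1) = s * f t := by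
    have hw := mem_verticalKite_inter_upperCell hτ ha hb
    exact hf.add_one_eq hp convex_polygon (hUC (-1))
      (fun t ht => hUC (-1 + 1) (add_one_mem_upperCell ht)) hw.2 (hs2 _ hw.1)
  have hsq : s = qTilde p := by
    have hw := center_mem_upperCell (a := a) hτ hb (-1)
    set w : ℂ := (((1 + a) / 2 + (-1 : ℤ) : ℝ) + ((1 + b) / 2 : ℝ) * τ : ℂ) with hwdef
    have e1 := hs3 _ hw
    have e2 := htau _ (upperCell_subset_doubleCell hw)
    -- At this centre the reflection acts as the translation by 1, and the exponent is 2πi/p; the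
    -- factor is thus q̃.
    have e3 : τ - z - w = w + 1 := by
      rw [hwdef]
      push_cast
      linear_combination hz
    have e4 : τ - z - 2 * w = 1 := by linear_combination e3
    rw [e3, e4, e1, mul_one] at e2
    exact mul_right_cancel₀ (hf.isBranchOn.ne_zero hp (hUC _ hw)) e2
  subst hsq
  have hq := qTilde_ne_zero p
  refine ⟨g, hg, hgr, hr, fun t ht => ?_, hlow, hkite, htau, fun t ht ht' => ?_⟩
  · rw [hs t ht, inv_mul_cancel_left₀ hq]
  · have h1 : t - 1 ∈ doubleCell τ a b := by
      have := tau_sub_mem_doubleCell hτ hz ht'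
      rwa [show τ - z - (1 + τ - z - t) = t - 1 by ring] at this
    have h2 := hs3 _ (mem_upperCell_of_mem_doubleCell (by rwa [sub_add_cancel]) h1)
    have h3 := htau _ h1
    have hpc : (p : ℂ) ≠ 0 := Nat.cast_ne_zero.2 hp
    rw [sub_add_cancel] at h2
    rw [show τ - z - (t - 1) = 1 + τ - z - t by ring] at h3
    rw [h3, h2, mul_assoc, mul_left_comm _ (qTilde p), ← mul_assoc (qTilde p), ← mul_assoc]
    congr 1
    rw [qTilde, ← Complex.exp_add, ← Complex.exp_add]
    congr 1
    field_simp
    ring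

lemma omega_eq_mul {p : ℕ} {z τ κ r : ℂ} {f g : ℂ → ℂ} {t : ℂ} (h : f t = r * g t) (μ : ℤ) :
    omega p z τ κ f μ t = r * omega p z τ κ g μ t := by
  rw [omega_eq, omega_eq, h]
  ring

/-- The finite part integrals of `ω_μ` from `0` to `1`, from `0` to `τ`, from `0` to `-z` below the
cut and from `-z` to `τ`, and the relations between them. -/
theorem IsBranch.exists_periodRelations {p : ℕ} (hp : 2 ≤ p) {z τ : ℂ} (hτ : 0 < τ.im) {a b : ℝ}
    (hz : -z = a + b * τ) (ha : a ∈ Ioo (0 : ℝ) 1) (hb : b ∈ Ioo (0 : ℝ) 1) {f : ℂ → ℂ}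
    (hf : IsBranch p z τ f) (κ : ℂ) :
    ∃ A B C D : ℤ → ℂ, PeriodRelations p A B C D ∧
      (∀ μ, HasFPIntegral p (omega p z τ κ f μ) 0 1 (A μ)) ∧
      (∀ μ, HasFPIntegral p (omega p z τ κ f μ) 0 τ (B μ)) ∧
      ∀ μ, ∀ w ∈ lowerTriangle z, HasFPIntegralVia p (omega p z τ κ f μ) 0 w (-z) (C μ) := by
  have hp0 : p ≠ 0 := by lia
  have hpp : 0 < p := by lia
  obtain ⟨g, hg, hgr, hlow, hlow', hone, hone', htau, honetau⟩ :=
    hf.exists_monodromy hp0 hτ hz ha hb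
  have hL := lowerCell_subset_cutPlane (c := 0) (p := p) hτ hz ha hb
  have hcL := center_mem_lowerCell (a := a) hτ hb 0
  have h0 := hf.deriv_theta1_ne_zero (hL hcL)
  have hzne : ∀ m n : ℤ, z ≠ m + n * τ := by
    intro m n h
    have h1 := coordY_eq_of_neg_eq hτ hz
    rw [h, show (m + n * τ : ℂ) = (m : ℝ) + (n : ℝ) * τ by push_cast; rfl,
      coordY_add_mul hτ] at h1
    obtain ⟨hb0, hb1⟩ := hb
    rcases int_trichotomy n with hj | rfl | hj
    · linarith
    · push_cast at h1
      linarith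
    · linarith
  have pot : ∀ {l : List (ℝ × ℝ × ℝ)} {g : ℂ → ℂ}, IsBranchOn p z τ (polygon τ l) g →
      ∀ μ, ∃ c, IsPotential p z τ (omega p z τ κ g μ) (polygon τ l) c := fun h μ =>
    h.exists_isPotential hp hτ h0 hzne convex_polygon isOpen_polygon μ
  choose cL hcL' using pot (hf.isBranchOn.mono hL)
  choose cH hcH using pot (hf.isBranchOn.mono (horizontalKite_subset_cutPlane hτ hz ha hb))
  choose cV hcV using pot (hf.isBranchOn.mono (verticalKite_subset_cutPlane (c := 0) hτ hz ha hb))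
  choose cD hcD using pot (hf.isBranchOn.mono (doubleCell_subset_cutPlane hτ hz ha hb))
  choose cS hcS using pot hg
  have b0 : IsBranchPoint z τ 0 := ⟨0, 0, Or.inl (by simp)⟩
  have b1 : IsBranchPoint z τ 1 := ⟨1, 0, Or.inl (by simp)⟩
  have bτ : IsBranchPoint z τ τ := ⟨0, 1, Or.inl (by simp)⟩
  have b1τ : IsBranchPoint z τ (1 + τ) := ⟨1, 1, Or.inl (by simp)⟩
  have bz : IsBranchPoint z τ (-z) := ⟨0, 0, Or.inr (by simp)⟩
  have b1z : IsBranchPoint z τ (1 - z) := ⟨1, 0, Or.inr (by simp)⟩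
  obtain ⟨kL0, kL1, kLz, kL1z⟩ := closure_lowerCell (a := a) hτ hz hb
  obtain ⟨kS0, kSz⟩ := closure_strip (a := a) hτ hz hb
  obtain ⟨kDz, kDτ, kD1z, kD1τ⟩ := closure_doubleCell (a := a) hτ hz hb
  obtain ⟨kH0, kH1⟩ := closure_horizontalKite hτ ha hb
  obtain ⟨kV0, kVz, kVτ⟩ := closure_verticalKite hτ hz ha hb
  have e0 : (1 : ℂ) - z - 0 = 1 - z := by ring
  have e1 : (1 : ℂ) - z - 1 = -z := by ring
  have e2 : (1 : ℂ) - z - -z = 1 := by ring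
  have e3 : -z - -z = 0 := by ring
  have e4 : -z - 0 = -z := by ring
  have e5 : τ - z - -z = τ := by ring
  have e6 : τ - z - τ = -z := by ring
  have e7 : 1 + τ - z - -z = 1 + τ := by ring
  have e8 : 1 + τ - z - τ = 1 - z := by ring
  have e9 : 1 + τ - z - (1 - z) = τ := by ring
  have hA : ∀ μ, HasFPIntegral p (omega p z τ κ f μ) 0 1 (cH μ 1 - cH μ 0) := fun μ =>
    (hcH μ).straight b0 b1 kH0 kH1 fun u hu => line_mem_horizontalKite hτ hb hu
  have hB : ∀ μ, HasFPIntegral p (omega p z τ κ f μ) 0 τ (cV μ τ - cV μ 0) := fun μ =>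
    (hcV μ).straight b0 bτ kV0 kVτ fun u hu => line_mem_verticalKite hτ ha hu
  have hC : ∀ μ, ∀ w ∈ lowerCell τ a b 0,
      HasFPIntegralVia p (omega p z τ κ f μ) 0 w (-z) (cL μ (-z) - cL μ 0) := fun μ w hw =>
    (hcL' μ).via b0 bz kL0 kLz w hw
  -- The reflection of the cut crosses it, so C must be rewritten through the continuation g on the
  -- strip before its oddness can be seen.
  have hCS : ∀ μ, cL μ (-z) - cL μ 0 = cS μ (-z) - cS μ 0 := fun μ => by
    simpa using (hcL' μ).sub_eq_of_inter (ρ := 1) hpp (hcS μ) convex_polygon isOpen_polygon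
      convex_polygon isOpen_polygon ⟨hcL, lowerCell_subset_strip hcL⟩
      (fun t ht => omega_eq_mul (by rw [one_mul, hlow t ht.1]) μ) b0 bz kL0 kS0 kLz kSz
  have hD2 : ∀ μ, cD (2 - μ) τ - cD (2 - μ) (-z) = -(cD μ τ - cD μ (-z)) := by
    intro μ
    have hw := center_mem_doubleCell (a := a) hτ hb
    have h1 := (hcD (2 - μ)).sub_eq_of_reflect (ρ := 1) (s := τ - z) (a := τ) (b := -z) hpp (hcD μ)
      convex_polygon isOpen_polygon convex_polygon isOpen_polygon
      (tau_sub_mem_doubleCell hτ hz hw) hw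
      (fun t ht _ => by rw [omega_tau_reflect hp0 (htau t ht), sub_sub_cancel, one_mul])
      bτ bz (by rwa [e6]) (by rwa [e5]) (by rwa [e6]) kDτ (by rwa [e5]) kDz
    rw [e5, e6] at h1
    linear_combination h1
  refine ⟨fun μ => cH μ 1 - cH μ 0, fun μ => cV μ τ - cV μ 0, fun μ => cL μ (-z) - cL μ 0,
    fun μ => cD μ τ - cD μ (-z), ⟨?_, ?_, ?_, ?_, ?_, ?_, ?_, ?_⟩, hA, hB, fun μ w hw => hC μ w
      (lowerTriangle_subset_lowerCell hτ hz hb hw)⟩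
  · intro μ
    have := hA (μ + 2 * p)
    rw [omega_add_two_mul hp0] at this
    exact this.unique hpp (hA μ)
  · intro μ
    have := hB (μ + 2 * p)
    rw [omega_add_two_mul hp0] at this
    exact this.unique hpp (hB μ)
  · intro μ
    have := hC (μ + 2 * p) _ hcL
    rw [omega_add_two_mul hp0] at this
    exact this.unique hpp (hC μ _ hcL)
  · intro μ
    simp only [hCS]
    have := (hcS (-μ)).sub_eq_of_reflect (ρ := 1) (s := -z) (a := -z) (b := 0) hpp (hcS μ)
      convex_polygon isOpen_polygon convex_polygon isOpen_polygon
      (neg_sub_mem_strip hτ hz (center_mem_strip (a := a) hτ hb)) (center_mem_strip hτ hb)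
      (fun t ht _ => by rw [omega_reflect (hgr t ht), neg_neg, one_mul]) bz b0
      (by rwa [e3]) (by rwa [e4]) (by rwa [e3]) kSz (by rwa [e4]) kS0
    rw [e3, e4] at this
    linear_combination this
  · exact hD2
  · intro μ
    -- The path from 0 to τ is broken at -z: the upper part is D, and the lower part runs on the
    -- left of the cut, where f is q̃^{-1}g.
    have h1 := (hcV μ).sub_eq_of_inter (ρ := 1) hpp (hcD μ) convex_polygon isOpen_polygon
      convex_polygon isOpen_polygon
      ⟨(mem_verticalKite_inter_upperCell hτ ha hb).1,
        upperCell_subset_doubleCell (mem_verticalKite_inter_upperCell hτ ha hb).2⟩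
      (fun t ht => (one_mul _).symm) bz bτ kVz kDz kVτ kDτ
    have h2 := (hcV μ).sub_eq_of_inter (ρ := (qTilde p)⁻¹) hpp (hcS μ) convex_polygon
      isOpen_polygon convex_polygon isOpen_polygon
      ⟨(mem_verticalKite_inter_lowerCell hτ ha hb).1,
        lowerCell_subset_strip (mem_verticalKite_inter_lowerCell hτ ha hb).2⟩
      (fun t ht => omega_eq_mul (hlow' t (mem_lowerCell_of_mem_verticalKite ha hb ht.1 ht.2)) μ)
      b0 bz kV0 kS0 kVz kSz
    simp only [hCS]
    linear_combination h1 + h2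
  · intro μ
    -- The potential of the lower parallelogram gives its bottom side (h1), its top side (h2) and
    -- its right side (h3); the last two are reflected images of the bottom and left sides for -μ.
    have hw := mem_lowerCell_inter_horizontalKite hτ ha hb
    have h1 := (hcL' μ).sub_eq_of_inter (ρ := 1) hpp (hcH μ) convex_polygon isOpen_polygon
      convex_polygon isOpen_polygon hw (fun t ht => (one_mul _).symm) b0 b1 kL0 kH0 kL1 kH1
    have h2 := (hcL' μ).sub_eq_of_reflect (ρ := qTilde p ^ (-μ)) (s := 1 - z) (a := 1) (b := 0)
      hpp (hcH (-μ)) convex_polygon isOpen_polygon convex_polygon isOpen_polygon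
      (one_sub_mem_lowerCell hτ hz hw.1) hw.2 (fun t ht _ => omega_one_reflect (hone' t ht) μ)
      b1 b0 (by rwa [e1]) (by rwa [e0]) (by rwa [e1]) kH1 (by rwa [e0]) kH0
    have h3 := (hcL' μ).sub_eq_of_reflect (ρ := qTilde p ^ (-μ)) (s := 1 - z) (a := -z) (b := 0)
      hpp (hcL' (-μ)) convex_polygon isOpen_polygon convex_polygon isOpen_polygon
      (one_sub_mem_lowerCell hτ hz hw.1) hw.1 (fun t ht _ => omega_one_reflect (hone t ht) μ)
      bz b0 (by rwa [e2]) (by rwa [e0]) (by rwa [e2]) kLz (by rwa [e0]) kL0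
    rw [e0, e1] at h2
    rw [e0, e2] at h3
    linear_combination h2 - h1 - h3
  · intro μ
    have hq := qTilde_ne_zero p
    have hw := center_mem_doubleCell' (a := a) hτ hb
    have hw' : 1 + τ - z - (((1 + a) / 2 : ℝ) + ((1 + b) / 2 : ℝ) * τ : ℂ) ∈ doubleCell τ a b := by
      convert hw using 1
      push_cast
      linear_combination hz
    -- The same for the upper parallelogram: bottom (h1), right (h2) and top (h3). The top is a
    -- reflected image of the bottom for 2-μ, and a second reflection makes this A_{μ-2}.
    have h1 : ∀ ν, cD ν (1 - z) - cD ν (-z) = qTilde p ^ (-ν) * (cH (-ν) 0 - cH (-ν) 1) := by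
      intro ν
      have := (hcD ν).sub_eq_of_reflect (ρ := qTilde p ^ (-ν)) (s := 1 - z) (a := 1) (b := 0)
        hpp (hcH (-ν)) convex_polygon isOpen_polygon convex_polygon isOpen_polygon
        (one_sub_mem_doubleCell hτ hz ha hb) (mem_horizontalKite hτ ha hb)
        (fun t ht _ => omega_one_reflect (hone' t ht) ν)
        b1 b0 (by rwa [e1]) (by rwa [e0]) (by rwa [e1]) kH1 (by rwa [e0]) kH0
      rwa [e0, e1] at this
    have h2 := (hcD μ).sub_eq_of_reflect (ρ := qTilde p ^ (1 - μ)) (s := 1 + τ - z) (a := τ)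
      (b := -z) hpp (hcD (2 - μ)) convex_polygon isOpen_polygon convex_polygon isOpen_polygon
      hw' hw (fun t ht ht' => omega_one_add_tau_reflect hp0 (honetau t ht ht') μ)
      bτ bz (by rwa [e8]) (by rwa [e7]) (by rwa [e8]) kDτ (by rwa [e7]) kDz
    have h3 := (hcD μ).sub_eq_of_reflect (ρ := qTilde p ^ (1 - μ)) (s := 1 + τ - z) (a := 1 - z)
      (b := -z) hpp (hcD (2 - μ)) convex_polygon isOpen_polygon convex_polygon isOpen_polygon
      hw' hw (fun t ht ht' => omega_one_add_tau_reflect hp0 (honetau t ht ht') μ)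
      b1z bz (by rwa [e9]) (by rwa [e7]) (by rwa [e9]) kD1z (by rwa [e7]) kDz
    rw [e7, e8] at h2
    rw [e7, e9] at h3
    have h4 := h1 (2 - μ)
    rw [neg_sub] at h4
    have h5 : qTilde p ^ (1 - μ) * qTilde p ^ (μ - 2) = (qTilde p)⁻¹ := by
      rw [← zpow_add₀ hq, ← zpow_neg_one]
      congr 1
      ring
    have h6 := hD2 μ
    linear_combination qTilde p ^ (1 - μ) * h6 - h1 μ - h2 + h3 - qTilde p ^ (1 - μ) * h4 -
      (cH (μ - 2) 0 - cH (μ - 2) 1) * h5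

theorem lemma2 (p : ℕ) (hp : 2 ≤ p) (z τ : ℂ) (hτ : 0 < τ.im)
    (hz : ∃ a ∈ Set.Ioo (0 : ℝ) 1, ∃ b ∈ Set.Ioo (0 : ℝ) 1, -z = (a : ℂ) + (b : ℂ) * τ)
    (κ : ℂ) (hκ : κ ^ (2 * p) = primeForm (-z) τ)
    (f : ℂ → ℂ) (hf : IsBranch p z τ f) :
    -- integrals around contractible loops in the cut plane vanish
    (∀ (μ : ℤ) (x : cutPlane p z τ) (γ : Path x x), γ.Homotopic (Path.refl x) →
      PiecewiseC1 (fun s : ℝ => (γ.extend s : ℂ)) →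
      (∫ s in (0 : ℝ)..1, omega p z τ κ f μ (γ.extend s : ℂ) *
        deriv (fun r : ℝ => (γ.extend r : ℂ)) s) = 0) ∧
    -- `A μ`, `B μ`, `C μ` are the integrals from `0` to `1`, to `τ`, and to `-z` below the cut
    ∃ A B C : ℤ → ℂ,
      (∀ μ L, HasFPIntegral p (omega p z τ κ f μ) 0 1 L ↔ L = A μ) ∧
      (∀ μ L, HasFPIntegral p (omega p z τ κ f μ) 0 τ L ↔ L = B μ) ∧
      (∀ μ, ∀ w ∈ lowerTriangle z, ∀ L,
        HasFPIntegralVia p (omega p z τ κ f μ) 0 w (-z) L ↔ L = C μ) ∧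
      -- the three identities
      (∀ μ, Relation5 p A C μ) ∧ (∀ μ, Relation6 p B C μ) ∧ (∀ μ, Relation7 p A B C μ) ∧
      -- every integral is expressed through the integrals from `0` to `1`
      (∀ μ : ℤ, ¬ (μ ≡ 0 [ZMOD p]) → ¬ (μ ≡ 1 [ZMOD p]) →
        B μ = -(qTilde p ^ (μ - 1) / (1 - qTilde p ^ μ)) * A μ
          + qTilde p ^ (μ - 2) / (1 - qTilde p ^ (μ - 1)) * A (μ - 2)
          + qTilde p ^ (μ - 2) * (1 - qTilde p) /
              ((1 - qTilde p ^ (μ - 1)) * (1 - qTilde p ^ μ)) * A (-μ)) ∧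
      (∀ μ : ℤ, μ ≡ 0 [ZMOD p] → B μ = (A μ - (qTilde p)⁻¹ * A (μ - 2)) / (1 - qTilde p)) ∧
      (∀ μ : ℤ, μ ≡ 1 [ZMOD p] → B μ = A μ / (qTilde p - 1)) ∧
      (∀ μ : ℤ, ¬ (μ ≡ 0 [ZMOD p]) →
        C μ = (A μ + qTilde p ^ (-μ) * A (-μ)) / (1 - qTilde p ^ (-μ))) ∧
      (∀ μ : ℤ, μ ≡ 0 [ZMOD p] → C μ = 0) ∧
      -- the selection rules
      (∀ μ : ℤ, μ ≡ 0 [ZMOD p] ∨ μ ≡ -1 [ZMOD p] → A μ = 0) ∧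
      -- the first and third relations imply the second one only if `μ ≢ 1 (mod p)`
      (∀ μ : ℤ, μ ≡ 1 [ZMOD p] → ∃ A' B' C' : ℤ → ℂ,
        (∀ ν, Relation5 p A' C' ν) ∧ (∀ ν, Relation7 p A' B' C' ν) ∧ ¬ Relation6 p B' C' μ) ∧
      (∀ A' B' C' : ℤ → ℂ, (∀ ν, Relation5 p A' C' ν) → (∀ ν, Relation7 p A' B' C' ν) →
        ∀ μ : ℤ, ¬ (μ ≡ 1 [ZMOD p]) →
          (μ ≡ 2 [ZMOD p] → C' (μ - 2) = 0 ∧ C' (2 - μ) = 0) → Relation6 p B' C' μ) := by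
  obtain ⟨a, ha, b, hb, hab⟩ := hz
  have hp0 : p ≠ 0 := by lia
  have hpp : 0 < p := by lia
  refine ⟨fun μ x γ hγ hc => integral_eq_zero_of_homotopic_refl (isOpen_cutPlane hτ hab ha hb)
    (hf.isBranchOn.differentiableOn_omega hp0 hτ μ) γ hγ hc, ?_⟩
  obtain ⟨A, B, C, D, h, hA, hB, hC⟩ := hf.exists_periodRelations hp hτ hab ha hb κ
  refine ⟨A, B, C, fun μ L => ⟨fun hL => hL.unique hpp (hA μ), fun hL => hL ▸ hA μ⟩,
    fun μ L => ⟨fun hL => hL.unique hpp (hB μ), fun hL => hL ▸ hB μ⟩,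
    fun μ w hw L => ⟨fun hL => hL.unique hpp (hC μ w hw), fun hL => hL ▸ hC μ w hw⟩,
    h.relation5, h.relation6, h.relation7, fun μ => h.B_eq_of_ne hp0,
    fun μ => h.B_eq_of_modEq_zero hp, fun μ => h.B_eq_of_modEq_one hp, fun μ => h.C_eq hp0,
    fun μ => h.C_eq_zero, fun μ => h.A_eq_zero hp0,
    fun μ => exists_relation5_relation7_not_relation6 hp0,
    fun A' B' C' h5 h7 μ hμ h2 => relation6_of_relation5_of_relation7 hp0 h5 h7 hμ h2⟩
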